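/- Let $\mathcal G=(\mathcal V,\mathcal E)$ be a connected, locally finite metric graph. That is, every edge $e\in\mathcal E$ has a length $l_e\in(0,\infty]$ and is identified with $I_e=[0,l_e]$ if $l_e<\infty$ and with $I_e=[0,\infty)$ if $l_e=\infty$; the point $0$ and, if $l_e<\infty$, the point $l_e$ are glued to vertices (loops and multiple edges are allowed); every vertex has degree at least one; $\mathcal G$ is nonempty and any two points are joined by a path; $\mathcal E$ is countable and every set that is bounded for the path distance meets only finitely many edges. Write $u_e=u|_e$ and $$L^p(\mathcal G)=\Big\{u\in\bigoplus_{e}L^p(I_e):\ \sum_e\|u_e\|_p^p<\infty\Big\}\quad(p<\infty),$$ with $\sup_e\|u_e\|_\infty<\infty$ in place of the sum if $p=\infty$. Let $\widetilde{W^{k,p}}(\mathcal G)$ be the set of continuous functions $u$ on $\mathcal G$ such that $u_e\in W^{k,p}(I_e)$ for all $e$ and $u$ and its edgewise derivatives up to order $k$ belong to $L^p(\mathcal G)$; $W^{1,p}(\mathcal G)=\widetilde{W^{1,p}}(\mathcal G)$, $H^1(\mathcal G)=W^{1,2}(\mathcal G)$, $\widetilde{H^2}(\mathcal G)=\widetilde{W^{2,2}}(\mathcal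 G)$. Let $M\in H^1(\mathcal G)+W^{1,\infty}(\mathcal G)$ and $V\in L^2(\mathcal G)+L^\infty(\mathcal G)$ be real-valued. For an end of an edge $e$ at a vertex $\mathsf v$ (a loop has two ends at its vertex) put $\nu=1$ if it is the end $x_e=0$ and $\nu=-1$ if it is the end $x_e=l_e$, so that $\nu\frac{\mathrm d}{\mathrm dx}$ is the derivative in the direction from $\mathsf v$ into the edge. Let $$A=\Big(i\frac{\mathrm d}{\mathrm dx}+M\Big)^2+V,$$ $$D(A)=\Big\{u\in\widetilde{H^2}(\mathcal G):\ \sum_{e\succ\mathsf v}\nu\Big(i\frac{\mathrm d}{\mathrm dx}+M\Big)u_e(\mathsf v)=0\ \text{ for all }\mathsf v\in\mathcal V\Big\},$$ where the sum runs over the edge ends at $\mathsf v$, and on each edge $A$ acts in the sense of weak derivatives. For $u,v\in H^1(\mathcal G)$ let $$a(u,v)=\int_{\mathcal G}\overline{\Big(i\frac{\mathrm d}{\mathrm dx}+M\Big)u}\,\Big(i\frac{\mathrm d}{\mathrm dx}+M\Big)v+V\,\overline u\,v\,\mathrm dx .$$ Then the integral defining $a(u,v)$ converges absolutely for all $u,v\in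 H^1(\mathcal G)$; $A$ is a well-defined, densely defined linear operator from $D(A)\subset L^2(\mathcal G)$ to $L^2(\mathcal G)$; $A$ is self-adjoint; and $$\langle Au,v\rangle=a(u,v)\qquad\text{for all }u,v\in D(A),$$ where $\langle u,v\rangle=\int_{\mathcal G}\overline u\,v\,\mathrm dx$. -/

import Mathlib

open MeasureTheory
open scoped ENNReal InnerProductSpace ComplexConjugate

noncomputable section

/-- A metric graph with vertex set `X` and edge set `E`. Each edge `e` carries a length in `(0, ∞]`.
The point `0` of the interval of `e` is attached to the vertex `source e`; if the length is finite, the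
other end point is attached to `target e`. An edge of infinite length is a ray (its "vertex at
infinity" is not a vertex). Loops and multiple edges are allowed, every vertex has degree at
least one. -/
structure MetricGraph (X : Type*) (E : Type*) where
  len : E → ℝ≥0∞
  len_pos : ∀ e, 0 < len e
  source : E → X
  target : (e : E) → len e ≠ ⊤ → X
  degree_pos : ∀ v, ∃ e, source e = v ∨ ∃ h : len e ≠ ⊤, target e h = v

namespace MetricGraph

variable {X : Type*} {E : Type*} {F : Type*} [NormedAddCommGroup F] [NormedSpace ℝ F]

/-- The interval of the edge `e`: `[0, len e]` if the length is finite, `[0, ∞)` otherwise. -/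
def interval (G : MetricGraph X E) (e : E) : Set ℝ := {x | 0 ≤ x ∧ ENNReal.ofReal x ≤ G.len e}

/-- The points of the edges, before the end points of edges are glued at the vertices. -/
abbrev Point (G : MetricGraph X E) := Σ e : E, G.interval e

/-- The ends of edges. A ray has one end, every other edge (also a loop) has two. -/
inductive EdgeEnd (G : MetricGraph X E)
  | start (e : E) : EdgeEnd G
  | finish (e : E) (h : G.len e ≠ ⊤) : EdgeEnd G

namespace EdgeEnd

variable {G : MetricGraph X E}

def edge : G.EdgeEnd → E
  | start e => e
  | finish e _ => e

/-- The vertex to which an end of an edge is attached. -/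
def vertex : G.EdgeEnd → X
  | start e => G.source e
  | finish e h => G.target e h

/-- The coordinate of an end of an edge. -/
def pos : G.EdgeEnd → ℝ
  | start _ => 0
  | finish e _ => (G.len e).toReal

/-- The direction `ν` pointing from the vertex into the edge, expressed in the coordinate of the
edge. -/
def sign : G.EdgeEnd → ℝ
  | start _ => 1
  | finish _ _ => -1

lemma pos_mem (h : G.EdgeEnd) : h.pos ∈ G.interval h.edge := by
  cases h with
  | start e => simp [pos, interval]
  | finish e h => exact ⟨ENNReal.toReal_nonneg, by simp [pos, edge, ENNReal.ofReal_toReal h]⟩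

/-- An end of an edge as a point. -/
def toPoint (h : G.EdgeEnd) : G.Point := ⟨h.edge, h.pos, h.pos_mem⟩

end EdgeEnd

/-- `G.HasPath p q r`: there is a path of length `r` from `p` to `q`. A path moves along edges, and
passes at a vertex from one edge end to another one. -/
inductive HasPath (G : MetricGraph X E) : G.Point → G.Point → ℝ → Prop
  | refl (p : G.Point) : HasPath G p p 0
  | move {p : G.Point} {e : E} {x : G.interval e} {r : ℝ} (y : G.interval e) :
      HasPath G p ⟨e, x⟩ r → HasPath G p ⟨e, y⟩ (r + |(x : ℝ) - y|)
  | cross {p : G.Point} {h : G.EdgeEnd} {r : ℝ} (h' : G.EdgeEnd) :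
      HasPath G p h.toPoint r → h.vertex = h'.vertex → HasPath G p h'.toPoint r

/-- A nonempty graph in which any two points are joined by a path. -/
def Connected (G : MetricGraph X E) : Prop :=
  Nonempty G.Point ∧ ∀ p q : G.Point, ∃ r, G.HasPath p q r

/-- The path distance of a connected metric graph. -/
def pathDist (G : MetricGraph X E) (p q : G.Point) : ℝ := sInf {r | G.HasPath p q r}

/-- A set of points that is bounded for the path distance. -/
def Bounded (G : MetricGraph X E) (S : Set G.Point) : Prop :=
  ∃ R : ℝ, ∀ p ∈ S, ∀ q ∈ S, G.pathDist p q ≤ R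

/-- The edge set is countable, and every bounded set meets only finitely many edges. -/
def LocallyFinite (G : MetricGraph X E) : Prop :=
  Countable E ∧ ∀ S : Set G.Point, G.Bounded S → {e | ∃ p ∈ S, p.1 = e}.Finite

/-- Lebesgue measure on the interval of an edge. -/
abbrev edgeMeasure (G : MetricGraph X E) (e : E) : Measure ℝ := volume.restrict (G.interval e)

/-- The Hilbert space `L²(G)`, the `ℓ²`-direct sum of the spaces `L²` of the edges. -/
abbrev L2 (G : MetricGraph X E) := lp (fun e : E => Lp ℂ 2 (G.edgeMeasure e)) 2

/-- A function on `G` is given by its restrictions `u e` to the edges (only the values of `u e` on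
the interval of `e` matter). `G.MemLp p u` says that it belongs to `L^p(G)`. -/
def MemLp (G : MetricGraph X E) (p : ℝ≥0∞) (u : E → ℝ → F) : Prop :=
  (∀ e, MeasureTheory.MemLp (u e) p (G.edgeMeasure e)) ∧
    Memℓp (fun e => (eLpNorm (u e) p (G.edgeMeasure e)).toReal) p

/-- Continuity on the glued graph: the restriction to each edge is continuous, and edge ends that
are glued at a vertex carry the same value. -/
def IsContinuous (G : MetricGraph X E) (u : E → ℝ → F) : Prop :=
  (∀ e, ContinuousOn (u e) (G.interval e)) ∧
    ∀ h h' : G.EdgeEnd, h.vertex = h'.vertex → u h.edge h.pos = u h'.edge h'.pos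

/-- `g` is a weak derivative of `f` in the interior of the set `J`. -/
def HasWeakDeriv (J : Set ℝ) (f g : ℝ → F) : Prop :=
  LocallyIntegrableOn f (interior J) ∧ LocallyIntegrableOn g (interior J) ∧
    ∀ φ : ℝ → ℝ, ContDiff ℝ (⊤ : ℕ∞) φ → HasCompactSupport φ → tsupport φ ⊆ interior J →
      ∫ x, deriv φ x • f x = - ∫ x, φ x • g x

/-- `u` is continuous on `G`, and on the edges it has weak derivatives up to order `k`; these and
`u` itself belong to `L^p(G)`. For `k = 1` this is `W^{1,p}(G)`. -/
def MemSobolev (G : MetricGraph X E) (k : ℕ) (p : ℝ≥0∞) (u : E → ℝ → F) : Prop :=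
  G.IsContinuous u ∧ ∃ D : ℕ → E → ℝ → F, D 0 = u ∧
    (∀ j < k, ∀ e, HasWeakDeriv (G.interval e) (D j e) (D (j + 1) e)) ∧
    ∀ j ≤ k, G.MemLp p (D j)

/-- `M ∈ H¹(G) + W^{1,∞}(G)`, real-valued. -/
def IsMagneticPotential (G : MetricGraph X E) (M : E → ℝ → ℝ) : Prop :=
  ∃ M₁ M₂ : E → ℝ → ℝ, G.MemSobolev 1 2 M₁ ∧ G.MemSobolev 1 ∞ M₂ ∧
    ∀ e, ∀ x ∈ G.interval e, M e x = M₁ e x + M₂ e x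

/-- `V ∈ L²(G) + L^∞(G)`, real-valued. -/
def IsElectricPotential (G : MetricGraph X E) (V : E → ℝ → ℝ) : Prop :=
  ∃ V₁ V₂ : E → ℝ → ℝ, G.MemLp 2 V₁ ∧ G.MemLp ∞ V₂ ∧
    ∀ e, ∀ᵐ x ∂G.edgeMeasure e, V e x = V₁ e x + V₂ e x

/-- `f` has a weak derivative in the interior of `J`. -/
def WeaklyDifferentiable (J : Set ℝ) (f : ℝ → ℂ) : Prop := ∃ g, HasWeakDeriv J f g

open Classical in
/-- The weak derivative of `f` in the interior of `J` (unique there up to null sets); `0` if `f` has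
none. -/
def weakDeriv (J : Set ℝ) (f : ℝ → ℂ) : ℝ → ℂ :=
  if h : WeaklyDifferentiable J f then h.choose else 0

/-- The magnetic derivative `(i d/dx + m) f` in the interior of `J`. -/
def magDeriv (J : Set ℝ) (m : ℝ → ℝ) (f : ℝ → ℂ) : ℝ → ℂ :=
  fun x => Complex.I * weakDeriv J f x + m x * f x

/-- The magnetic Kirchhoff condition at the vertex `v`: over the edge ends at `v`, the values at `v`
of the components of `(i d/dx + M) u` in the direction `ν` from `v` into the edge add up to zero.
(The direction is opposite to that of the coordinate at the second end of an edge.) -/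
def MagneticKirchhoff (G : MetricGraph X E) (M : E → ℝ → ℝ) (u : E → ℝ → ℂ) (v : X) : Prop :=
  ∑ᶠ (h : G.EdgeEnd) (_ : h.vertex = v),
    (h.sign : ℂ) * (Complex.I * derivWithin (u h.edge) (G.interval h.edge) h.pos
      + M h.edge h.pos * u h.edge h.pos) = 0

/-- The domain of the magnetic Schrödinger operator: the elements of `L²(G)` that have a continuous
representative which is edgewise `H²`, with square summable norms, and which satisfies the magnetic
Kirchhoff condition at every vertex. -/
def MemDomain (G : MetricGraph X E) (M : E → ℝ → ℝ) (u : G.L2) : Prop :=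
  ∃ w : E → ℝ → ℂ, (∀ e, u e =ᵐ[G.edgeMeasure e] w e) ∧ G.MemSobolev 2 2 w ∧
    ∀ v, G.MagneticKirchhoff M w v

/-- `A` is the operator `(i d/dx + M)² + V` with domain `MemDomain`. -/
def IsMagneticSchrodinger (G : MetricGraph X E) (M V : E → ℝ → ℝ) (A : G.L2 →ₗ.[ℂ] G.L2) : Prop :=
  (∀ u : G.L2, u ∈ A.domain ↔ G.MemDomain M u) ∧
  ∀ (u : A.domain) (e : E),
    WeaklyDifferentiable (G.interval e) ((u : G.L2) e) ∧
    WeaklyDifferentiable (G.interval e) (magDeriv (G.interval e) (M e) ((u : G.L2) e)) ∧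
    ∀ᵐ x ∂G.edgeMeasure e, A u e x =
      magDeriv (G.interval e) (M e) (magDeriv (G.interval e) (M e) ((u : G.L2) e)) x
        + V e x * (u : G.L2) e x

/-- The integrand of the sesquilinear form. -/
def formIntegrand (G : MetricGraph X E) (M V : E → ℝ → ℝ) (u v : E → ℝ → ℂ) : E → ℝ → ℂ :=
  fun e x => conj (magDeriv (G.interval e) (M e) (u e) x) * magDeriv (G.interval e) (M e) (v e) x
    + V e x * conj (u e x) * v e x

/-- Lebesgue integrability on `G`. -/
def IntegrableOnGraph (G : MetricGraph X E) (f : E → ℝ → ℂ) : Prop :=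
  (∀ e, Integrable (f e) (G.edgeMeasure e)) ∧ Summable fun e => ∫ x, ‖f e x‖ ∂G.edgeMeasure e

/-- The integral over `G`. -/
def integral (G : MetricGraph X E) (f : E → ℝ → ℂ) : ℂ := ∑' e, ∫ x, f e x ∂G.edgeMeasure e

/-- The sesquilinear form `a(u, v)`, antilinear in the first argument. -/
def form (G : MetricGraph X E) (M V : E → ℝ → ℝ) (u v : E → ℝ → ℂ) : ℂ :=
  G.integral (G.formIntegrand M V u v)

end MetricGraph

end

open Set Filter Topology

/-! ### Primitives of locally integrable functions -/

/-! The operator is recovered from its form. All integrals are taken over the disjoint union of the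
edges with the measure `graphMeasure`. Weak differentiability on an edge is traded for being a
primitive (`IsPrimitiveOn`): values at the end points then make sense, and the product rule and the
fundamental theorem of calculus hold up to the ends.

The analytic root is the embedding of `H¹` into `L^∞` (`exists_sup_bound`), which holds on every
connected graph, without a lower bound on the lengths of the edges. It makes `M` bounded, and
multiplication by `V` or by the derivative of `M` maps `H¹` boundedly into `L²`. Hence the form
converges absolutely and `A` takes values in `L²`.

Green's formula (`IsH1.integral_eq_zero_of_kirchhoff`) says that the integral of `z̄ v' + z̄' v`
vanishes if `z` satisfies the Kirchhoff condition and `v` is in `H¹`. The boundary terms cancel at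
each vertex because `v` has a single value there. Cutoff functions with slopes tending to zero
reduce to the case of finitely many boundary terms; this is where local finiteness enters. For `z =
(i d/dx + M) u` the formula becomes `⟨Au, v⟩ = a(u, v)`, and `A` is symmetric because the form is
Hermitian.

For a symmetric operator, density of the domain and self-adjointness both follow once `A + l` is
onto for one real `l` (`LinearPMap.dense_and_isSelfAdjoint_of_surjective`). Now `|⟨Vu, u⟩|` is at
most a constant times the product of the `H¹` and `L²` norms of `u`, so for large `l` the form of `A
+ l` is coercive on `H¹`, which is complete by `isClosed_h1Space`. The Lax-Milgram theorem gives
weak solutions (`IsPotential.exists_weak_solution`). Test functions supported inside an edge show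
that a weak solution is in `H²`, and test functions concentrated at one vertex give the Kirchhoff
condition (`IsPotential.exists_isH2`), so it lies in the domain. -/

/-- `f` is a primitive on `J` of the locally integrable function `g`. -/
def IsPrimitiveOn {F : Type*} [NormedAddCommGroup F] [NormedSpace ℝ F] (J : Set ℝ)
    (f g : ℝ → F) : Prop :=
  ∀ x ∈ J, ∀ y ∈ J, IntervalIntegrable g volume x y ∧ ∫ t in x..y, g t = f y - f x

/-- An increment of the primitive of `g` is bounded in norm by the increment of the primitive of
`‖g‖`, which reduces the vector-valued case to the scalar one. -/
theorem IntervalIntegrable.absolutelyContinuousOnInterval_integral {F : Type*}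
    [NormedAddCommGroup F] [NormedSpace ℝ F] {g : ℝ → F} {a b : ℝ}
    (hg : IntervalIntegrable g volume a b) :
    AbsolutelyContinuousOnInterval (fun x => ∫ t in a..x, g t) a b := by
  have h1 := hg.norm.absolutelyContinuousOnInterval_intervalIntegral (c := a) (by simp)
  unfold AbsolutelyContinuousOnInterval at h1 ⊢
  refine squeeze_zero' (Eventually.of_forall fun _ => Finset.sum_nonneg fun _ _ => dist_nonneg)
    ?_ h1
  rw [eventually_inf_principal]
  refine Eventually.of_forall fun E hE => Finset.sum_le_sum fun i hi => ?_
  obtain ⟨hx, hy⟩ := hE.1 i hi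
  have hi1 := hg.mono_set (uIcc_subset_uIcc_left hx)
  have hi2 := hg.mono_set (uIcc_subset_uIcc_left hy)
  rw [dist_eq_norm, dist_eq_norm, intervalIntegral.integral_interval_sub_left hi1 hi2,
    intervalIntegral.integral_interval_sub_left hi1.norm hi2.norm, Real.norm_eq_abs]
  exact intervalIntegral.norm_integral_le_abs_integral_norm

namespace IsPrimitiveOn

variable {F : Type*} [NormedAddCommGroup F] [NormedSpace ℝ F] {J : Set ℝ} {f g f' g' : ℝ → F}

theorem add (h : IsPrimitiveOn J f g) (h' : IsPrimitiveOn J f' g') :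
    IsPrimitiveOn J (fun x => f x + f' x) (fun x => g x + g' x) := by
  intro x hx y hy
  obtain ⟨h1, h2⟩ := h x hx y hy
  obtain ⟨h3, h4⟩ := h' x hx y hy
  refine ⟨h1.add h3, ?_⟩
  rw [intervalIntegral.integral_add h1 h3, h2, h4, add_sub_add_comm]

theorem clm {F' : Type*} [NormedAddCommGroup F'] [NormedSpace ℝ F'] [CompleteSpace F]
    [CompleteSpace F'] (L : F →L[ℝ] F') (h : IsPrimitiveOn J f g) :
    IsPrimitiveOn J (fun x => L (f x)) (fun x => L (g x)) := by
  intro x hx y hy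
  obtain ⟨h1, h2⟩ := h x hx y hy
  refine ⟨⟨L.integrable_comp h1.1, L.integrable_comp h1.2⟩, ?_⟩
  rw [L.intervalIntegral_comp_comm h1, h2, map_sub]

theorem congr (h : IsPrimitiveOn J f g) (hJ : J.OrdConnected) (hf : ∀ x ∈ J, f x = f' x)
    (hg : g =ᵐ[volume.restrict J] g') : IsPrimitiveOn J f' g' := by
  intro x hx y hy
  obtain ⟨h1, h2⟩ := h x hx y hy
  have hsub : uIoc x y ⊆ J := uIoc_subset_uIcc.trans (hJ.uIcc_subset hx hy)
  have h3 : ∀ᵐ t, t ∈ uIoc x y → g t = g' t := by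
    rw [← ae_restrict_iff' measurableSet_uIoc]
    exact ae_restrict_of_ae_restrict_of_subset hsub hg
  refine ⟨h1.congr_ae ((ae_restrict_iff' measurableSet_uIoc).2 h3), ?_⟩
  rw [← intervalIntegral.integral_congr_ae h3, h2, hf y hy, hf x hx]

theorem absolutelyContinuousOnInterval (h : IsPrimitiveOn J f g) (hJ : J.OrdConnected) {a b : ℝ}
    (ha : a ∈ J) (hb : b ∈ J) : AbsolutelyContinuousOnInterval f a b := by
  have h1 := (h a ha b hb).1.absolutelyContinuousOnInterval_integral
  have h2 : AbsolutelyContinuousOnInterval (fun _ : ℝ => f a) a b := by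
    refine LipschitzOnWith.absolutelyContinuousOnInterval (K := 0) ?_
    intro x _ y _
    simp
  have h3 := h1.add h2
  unfold AbsolutelyContinuousOnInterval at h3 ⊢
  refine h3.congr' ?_
  rw [EventuallyEq, eventually_inf_principal]
  refine Eventually.of_forall fun E hE => Finset.sum_congr rfl fun i hi => ?_
  obtain ⟨hx, hy⟩ := hE.1 i hi
  have hx' := hJ.uIcc_subset ha hb hx
  have hy' := hJ.uIcc_subset ha hb hy
  simp [(h a ha _ hx').2, (h a ha _ hy').2]

theorem continuousOn_uIcc (h : IsPrimitiveOn J f g) (hJ : J.OrdConnected) {a b : ℝ}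
    (ha : a ∈ J) (hb : b ∈ J) : ContinuousOn f (uIcc a b) :=
  (h.absolutelyContinuousOnInterval hJ ha hb).continuousOn

theorem ae_hasDerivAt [CompleteSpace F] (h : IsPrimitiveOn J f g) (hJ : J.OrdConnected) {a b : ℝ}
    (ha : a ∈ J) (hb : b ∈ J) : ∀ᵐ x, x ∈ uIoo a b → HasDerivAt f (g x) x := by
  filter_upwards [(h a ha b hb).1.ae_hasDerivAt_integral] with x hx hxab
  have h1 := (hx (Ioo_subset_Icc_self hxab) a (by simp)).add_const (f a)
  refine h1.congr_of_eventuallyEq ?_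
  filter_upwards [isOpen_Ioo.mem_nhds hxab] with y hy
  rw [(h a ha y (hJ.uIcc_subset ha hb (Ioo_subset_Icc_self hy))).2, sub_add_cancel]

/-- The product minus its candidate primitive is absolutely continuous with derivative zero almost
everywhere, hence constant. The derivatives need only be integrable. -/
theorem smul {𝕜 : Type*} [NormedField 𝕜] [NormedAlgebra ℝ 𝕜] [NormedSpace 𝕜 F]
    [IsScalarTower ℝ 𝕜 F] [CompleteSpace 𝕜] [CompleteSpace F] {c c' : ℝ → 𝕜}
    (hJ : J.OrdConnected)
    (h : IsPrimitiveOn J c c') (h' : IsPrimitiveOn J f g) :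
    IsPrimitiveOn J (fun x => c x • f x) (fun x => c x • g x + c' x • f x) := by
  intro a ha b hb
  have hc := h.continuousOn_uIcc hJ ha hb
  have hf := h'.continuousOn_uIcc hJ ha hb
  have hi : IntervalIntegrable (fun x => c x • g x + c' x • f x) volume a b :=
    ((h' a ha b hb).1.continuousOn_smul hc).add ((h a ha b hb).1.smul_continuousOn hf)
  refine ⟨hi, ?_⟩
  have hac : AbsolutelyContinuousOnInterval
      (fun x => c x • f x - ∫ t in a..x, (c t • g t + c' t • f t)) a b :=
    ((h.absolutelyContinuousOnInterval hJ ha hb).smul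
      (h'.absolutelyContinuousOnInterval hJ ha hb)).sub hi.absolutelyContinuousOnInterval_integral
  have hz : ∀ᵐ x, x ∈ uIcc a b → HasDerivAt
      (fun x => c x • f x - ∫ t in a..x, (c t • g t + c' t • f t)) 0 x := by
    -- The derivatives of `c` and `f` are available only at interior points, so the two end points
    -- are discarded as a null set.
    have ha' : ∀ᵐ x : ℝ, x ≠ a := by simp [ae_iff, measure_singleton]
    have hb' : ∀ᵐ x : ℝ, x ≠ b := by simp [ae_iff, measure_singleton]
    filter_upwards [h.ae_hasDerivAt hJ ha hb, h'.ae_hasDerivAt hJ ha hb,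
      hi.ae_hasDerivAt_integral, ha', hb'] with x h1 h2 h3 h4 h5 hx
    have hx' : x ∈ uIoo a b := by
      rw [uIcc, mem_Icc] at hx
      rw [uIoo, mem_Ioo]
      grind
    have h6 := ((h1 hx').smul (h2 hx')).sub (h3 hx a (by simp))
    rw [sub_self] at h6
    exact h6
  obtain ⟨C, hC⟩ := hac.const_of_ae_hasDerivAt_zero hz
  have h1 := hC a (by simp)
  have h2 := hC b (by simp)
  simp only [intervalIntegral.integral_same, sub_zero] at h1
  simp only [h1, ← h2, sub_sub_cancel]

theorem of_hasDerivAt [CompleteSpace F] (h : ∀ x, HasDerivAt f (g x) x) (hg : Continuous g) :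
    IsPrimitiveOn J f g := fun _ _ _ _ =>
  ⟨hg.intervalIntegrable _ _, intervalIntegral.integral_eq_sub_of_hasDerivAt (fun t _ => h t)
    (hg.intervalIntegrable _ _)⟩

end IsPrimitiveOn

theorem isPrimitiveOn_integral {F : Type*} [NormedAddCommGroup F] [NormedSpace ℝ F] {J : Set ℝ}
    {g : ℝ → F} {c : ℝ} (hc : c ∈ J) (h : ∀ x ∈ J, ∀ y ∈ J, IntervalIntegrable g volume x y) :
    IsPrimitiveOn J (fun x => ∫ t in c..x, g t) g := fun x hx y hy =>
  ⟨h x hx y hy, (intervalIntegral.integral_interval_sub_left (h c hc y hy) (h c hc x hx)).symm⟩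

/-! ### Weak derivatives on intervals -/

theorem MeasureTheory.LocallyIntegrableOn.integrable_smul_of_tsupport_subset {F : Type*}
    [NormedAddCommGroup F] [NormedSpace ℝ F] {f : ℝ → F} {U : Set ℝ} {φ : ℝ → ℝ}
    (hf : LocallyIntegrableOn f U) (hφ : Continuous φ) (hφc : HasCompactSupport φ)
    (hφs : tsupport φ ⊆ U) : Integrable (fun x => φ x • f x) := by
  have h1 : IntegrableOn (fun x => φ x • f x) (tsupport φ) :=
    (hf.integrableOn_compact_subset hφs hφc).continuousOn_smul hφ.continuousOn hφc
  refine (integrableOn_iff_integrable_of_support_subset ?_).1 h1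
  intro x hx
  refine subset_tsupport _ fun h => hx ?_
  simp [h]

/-- Puts the support of a test function strictly between two points of `U`, so that integrals over
the line become integrals over an interval without boundary terms. -/
theorem IsOpen.exists_Ioo_of_isCompact {U K : Set ℝ} (hU : IsOpen U) (hne : U.Nonempty)
    (hK : IsCompact K) (hKU : K ⊆ U) : ∃ a ∈ U, ∃ b ∈ U, a < b ∧ K ⊆ Ioo a b := by
  have aux : ∀ x ∈ U, ∃ a ∈ U, ∃ b ∈ U, a < x ∧ x < b := by
    intro x hx
    obtain ⟨ε, hε, h⟩ := Metric.isOpen_iff.1 hU x hx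
    refine ⟨x - ε / 2, h ?_, x + ε / 2, h ?_, by linarith, by linarith⟩ <;>
    · rw [Metric.mem_ball, Real.dist_eq, abs_lt]
      constructor <;> linarith
  rcases K.eq_empty_or_nonempty with rfl | hKne
  · obtain ⟨x, hx⟩ := hne
    obtain ⟨a, ha, b, hb, h1, h2⟩ := aux x hx
    exact ⟨a, ha, b, hb, h1.trans h2, empty_subset _⟩
  · obtain ⟨a, ha, -, -, h1, -⟩ := aux _ (hKU (hK.sInf_mem hKne))
    obtain ⟨-, -, b, hb, -, h2⟩ := aux _ (hKU (hK.sSup_mem hKne))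
    have h3 : ∀ x ∈ K, a < x ∧ x < b := fun x hx =>
      ⟨h1.trans_le (csInf_le hK.bddBelow hx), (le_csSup hK.bddAbove hx).trans_lt h2⟩
    obtain ⟨x, hx⟩ := hKne
    exact ⟨a, ha, b, hb, (h3 x hx).1.trans (h3 x hx).2, h3⟩

namespace MetricGraph

namespace HasWeakDeriv

variable {F : Type*} [NormedAddCommGroup F] [NormedSpace ℝ F] {J : Set ℝ} {f g f' g' : ℝ → F}

theorem congr_ae (h : HasWeakDeriv J f g) (hf : f =ᵐ[volume.restrict J] f')
    (hg : g =ᵐ[volume.restrict J] g') : HasWeakDeriv J f' g' := by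
  have hf' : f =ᵐ[volume.restrict (interior J)] f' :=
    ae_restrict_of_ae_restrict_of_subset interior_subset hf
  have hg' : g =ᵐ[volume.restrict (interior J)] g' :=
    ae_restrict_of_ae_restrict_of_subset interior_subset hg
  obtain ⟨h1, h2, h3⟩ := h
  have aux : ∀ {k k' : ℝ → F}, k =ᵐ[volume.restrict (interior J)] k' →
      LocallyIntegrableOn k (interior J) → LocallyIntegrableOn k' (interior J) := by
    intro k k' hk hki x hx
    obtain ⟨s, hs, his⟩ := hki x hx
    refine ⟨s ∩ interior J, inter_mem hs self_mem_nhdsWithin, ?_⟩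
    exact (his.mono_set inter_subset_left).congr
      (ae_restrict_of_ae_restrict_of_subset inter_subset_right hk)
  refine ⟨aux hf' h1, aux hg' h2, fun φ hφ hφc hφs => ?_⟩
  have key : ∀ {k k' : ℝ → F} {ψ : ℝ → ℝ}, k =ᵐ[volume.restrict (interior J)] k' →
      (∀ x, x ∉ interior J → ψ x = 0) → ∫ x, ψ x • k x = ∫ x, ψ x • k' x := by
    intro k k' ψ hk hψ
    refine integral_congr_ae ?_
    rw [EventuallyEq, ae_restrict_iff' isOpen_interior.measurableSet] at hk
    filter_upwards [hk] with x hx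
    by_cases hxJ : x ∈ interior J
    · rw [hx hxJ]
    · rw [hψ x hxJ, zero_smul, zero_smul]
  rw [← key hf' fun x hx => ?_, ← key hg' fun x hx => ?_]
  · exact h3 φ hφ hφc hφs
  · exact image_eq_zero_of_notMem_tsupport fun h => hx (hφs h)
  · exact image_eq_zero_of_notMem_tsupport fun h => hx (hφs (tsupport_deriv_subset h))

theorem ae_eq_interior [CompleteSpace F] (h : HasWeakDeriv J f g) (h' : HasWeakDeriv J f g') :
    ∀ᵐ x, x ∈ interior J → g x = g' x := by
  have h1 : ∀ᵐ x, x ∈ interior J → g x - g' x = 0 := by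
    refine isOpen_interior.ae_eq_zero_of_integral_contDiff_smul_eq_zero (h.2.1.sub h'.2.1) ?_
    intro φ hφ hφc hφs
    have e1 := h.2.2 φ hφ hφc hφs
    have e2 := h'.2.2 φ hφ hφc hφs
    have i1 : Integrable (fun x => φ x • g x) :=
      h.2.1.integrable_smul_of_tsupport_subset hφ.continuous hφc hφs
    have i2 : Integrable (fun x => φ x • g' x) :=
      h'.2.1.integrable_smul_of_tsupport_subset hφ.continuous hφc hφs
    simp_rw [smul_sub]
    rw [integral_sub i1 i2, sub_eq_zero]
    rw [e1] at e2
    exact neg_injective e2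
  filter_upwards [h1] with x hx hxJ using sub_eq_zero.1 (hx hxJ)

theorem sub (h : HasWeakDeriv J f g) (h' : HasWeakDeriv J f' g') :
    HasWeakDeriv J (fun x => f x - f' x) (fun x => g x - g' x) := by
  refine ⟨h.1.sub h'.1, h.2.1.sub h'.2.1, fun φ hφ hφc hφs => ?_⟩
  have hφ' : Continuous (deriv φ) := hφ.continuous_deriv (by simp)
  have hs' : tsupport (deriv φ) ⊆ interior J := (tsupport_deriv_subset).trans hφs
  simp_rw [smul_sub]
  rw [integral_sub (h.1.integrable_smul_of_tsupport_subset hφ' hφc.deriv hs')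
      (h'.1.integrable_smul_of_tsupport_subset hφ' hφc.deriv hs'),
    integral_sub (h.2.1.integrable_smul_of_tsupport_subset hφ.continuous hφc hφs)
      (h'.2.1.integrable_smul_of_tsupport_subset hφ.continuous hφc hφs),
    h.2.2 φ hφ hφc hφs, h'.2.2 φ hφ hφc hφs]
  abel

end HasWeakDeriv

/-- Integrate the Leibniz rule for `φ` and `f` over an interval that contains the support of `φ` in
its interior; the boundary values vanish. -/
theorem _root_.IsPrimitiveOn.hasWeakDeriv {F : Type*} [NormedAddCommGroup F] [NormedSpace ℝ F]
    [CompleteSpace F] {J : Set ℝ} {f g : ℝ → F} (hJ : J.OrdConnected)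
    (h : IsPrimitiveOn J f g) : HasWeakDeriv J f g := by
  have hU : (interior J).OrdConnected := hJ.convex.interior.ordConnected
  have hnb : ∀ x ∈ interior J, ∃ a ∈ J, ∃ b ∈ J, a ≤ b ∧ Icc a b ∈ 𝓝 x := by
    intro x hx
    obtain ⟨a, ha, b, hb, hab, hx'⟩ := isOpen_interior.exists_Ioo_of_isCompact ⟨x, hx⟩
      (isCompact_singleton (x := x)) (singleton_subset_iff.2 hx)
    exact ⟨a, interior_subset ha, b, interior_subset hb, hab.le,
      mem_of_superset (isOpen_Ioo.mem_nhds (hx' rfl)) Ioo_subset_Icc_self⟩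
  have hc : ContinuousOn f (interior J) := by
    intro x hx
    obtain ⟨a, ha, b, hb, hab, hx'⟩ := hnb x hx
    have h1 := h.continuousOn_uIcc hJ ha hb
    rw [uIcc_of_le hab] at h1
    exact (h1.continuousAt hx').continuousWithinAt
  refine ⟨hc.locallyIntegrableOn isOpen_interior.measurableSet, fun x hx => ?_,
    fun φ hφ hφc hφs => ?_⟩
  · obtain ⟨a, ha, b, hb, hab, hx'⟩ := hnb x hx
    refine ⟨Icc a b, mem_nhdsWithin_of_mem_nhds hx', ?_⟩
    rw [integrableOn_Icc_iff_integrableOn_Ioc, ← uIoc_of_le hab]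
    exact (intervalIntegrable_iff.1 (h a ha b hb).1)
  · rcases (interior J).eq_empty_or_nonempty with he | hne
    · have h0 : φ = 0 := by
        rw [← tsupport_eq_empty_iff]
        exact subset_empty_iff.1 (he ▸ hφs)
      subst h0
      have h1 : deriv (0 : ℝ → ℝ) = 0 := by
        funext x
        exact deriv_const x 0
      simp [h1]
    obtain ⟨a, ha, b, hb, hab, hs⟩ := isOpen_interior.exists_Ioo_of_isCompact hne hφc hφs
    have h1 : IsPrimitiveOn J φ (deriv φ) := IsPrimitiveOn.of_hasDerivAt
      (fun x => (hφ.differentiable (by simp) x).hasDerivAt) (hφ.continuous_deriv (by simp))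
    obtain ⟨hi, h2⟩ := h1.smul hJ h a (interior_subset ha) b (interior_subset hb)
    have ha0 : φ a = 0 := image_eq_zero_of_notMem_tsupport fun h => (hs h).1.false
    have hb0 : φ b = 0 := image_eq_zero_of_notMem_tsupport fun h => (hs h).2.false
    have hsub : Function.support (fun t => φ t • g t) ⊆ Ioc a b := by
      intro x hx
      refine Ioo_subset_Ioc_self (hs (subset_tsupport _ fun h => hx ?_))
      simp [h]
    have hsub' : Function.support (fun t => deriv φ t • f t) ⊆ Ioc a b := by
      intro x hx
      refine Ioo_subset_Ioc_self (hs (tsupport_deriv_subset (subset_tsupport _ fun h => hx ?_)))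
      simp [h]
    have hfc := h.continuousOn_uIcc hJ (interior_subset ha) (interior_subset hb)
    beta_reduce at h2
    rw [ha0, hb0, zero_smul, zero_smul, sub_zero, intervalIntegral.integral_add
      ((h a (interior_subset ha) b (interior_subset hb)).1.continuousOn_smul
        hφ.continuous.continuousOn)
      ((h1 a (interior_subset ha) b (interior_subset hb)).1.smul_continuousOn hfc),
      intervalIntegral.integral_of_le hab.le, intervalIntegral.integral_of_le hab.le,
      setIntegral_eq_integral_of_forall_compl_eq_zero
        (fun x hx => Function.notMem_support.1 fun h => hx (hsub h)),
      setIntegral_eq_integral_of_forall_compl_eq_zero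
        (fun x hx => Function.notMem_support.1 fun h => hx (hsub' h))] at h2
    exact eq_neg_of_add_eq_zero_right h2

/-- The du Bois-Reymond argument: fix a test function `ψ` with integral one. For every test function
`η`, the function `η - (∫ η) ψ` has mean zero and so is the derivative of a test function, whence `∫
η f = (∫ η) ∫ ψ f`. The constant is `∫ ψ f`. -/
theorem HasWeakDeriv.ae_eq_const {F : Type*} [NormedAddCommGroup F] [NormedSpace ℝ F]
    [CompleteSpace F] {J : Set ℝ} {f : ℝ → F} (hne : (interior J).Nonempty)
    (hJ : J.OrdConnected) (h : HasWeakDeriv J f 0) : ∃ c, ∀ᵐ x, x ∈ interior J → f x = c := by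
  have hU : (interior J).OrdConnected := hJ.convex.interior.ordConnected
  obtain ⟨x₀, hx₀⟩ := hne
  obtain ⟨ε, hε, hball⟩ := Metric.isOpen_iff.1 isOpen_interior x₀ hx₀
  let B : ContDiffBump x₀ := ⟨ε / 4, ε / 2, by positivity, by linarith⟩
  set ψ : ℝ → ℝ := B.normed volume with hψ
  have hψd : ContDiff ℝ (⊤ : ℕ∞) ψ := B.contDiff_normed
  have hψc : HasCompactSupport ψ := B.hasCompactSupport_normed
  have hψs : tsupport ψ ⊆ interior J := by
    rw [hψ, B.tsupport_normed_eq]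
    refine (Metric.closedBall_subset_ball ?_).trans hball
    change ε / 2 < ε
    linarith
  have hψ1 : ∫ x, ψ x = 1 := B.integral_normed
  have hψi : Integrable (fun x => ψ x • f x) :=
    h.1.integrable_smul_of_tsupport_subset hψd.continuous hψc hψs
  refine ⟨∫ x, ψ x • f x, ?_⟩
  have hcl : LocallyIntegrableOn (fun _ : ℝ => ∫ x, ψ x • f x) (interior J) :=
    continuousOn_const.locallyIntegrableOn isOpen_interior.measurableSet
  have key : ∀ᵐ x, x ∈ interior J → f x - ∫ x, ψ x • f x = 0 := by
    refine isOpen_interior.ae_eq_zero_of_integral_contDiff_smul_eq_zero (h.1.sub hcl) ?_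
    intro η hη hηc hηs
    have hηi : Integrable (fun x => η x • f x) :=
      h.1.integrable_smul_of_tsupport_subset hη.continuous hηc hηs
    have hηi' : Integrable η := hη.continuous.integrable_of_hasCompactSupport hηc
    have hψi' : Integrable ψ := hψd.continuous.integrable_of_hasCompactSupport hψc
    obtain ⟨a, ha, b, hb, hab, hs⟩ := isOpen_interior.exists_Ioo_of_isCompact ⟨x₀, hx₀⟩
      (hηc.isCompact.union hψc.isCompact) (union_subset hηs hψs)
    set I : ℝ := ∫ x, η x with hI
    set ρ : ℝ → ℝ := fun x => η x - I * ψ x with hρ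
    have hρd : ContDiff ℝ (⊤ : ℕ∞) ρ := hη.sub (contDiff_const.mul hψd)
    have hρ0 : ∀ x, x ∉ Ioo a b → ρ x = 0 := by
      intro x hx
      have h1 : η x = 0 := image_eq_zero_of_notMem_tsupport fun h => hx (hs (Or.inl h))
      have h2 : ψ x = 0 := image_eq_zero_of_notMem_tsupport fun h => hx (hs (Or.inr h))
      simp [hρ, h1, h2]
    set φ : ℝ → ℝ := fun x => ∫ t in a..x, ρ t with hφ
    have hφ' : ∀ x, HasDerivAt φ (ρ x) x := fun x =>
      intervalIntegral.integral_hasDerivAt_right (hρd.continuous.intervalIntegrable _ _)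
        (hρd.continuous.stronglyMeasurableAtFilter _ _) hρd.continuous.continuousAt
    have hφd' : deriv φ = ρ := funext fun x => (hφ' x).deriv
    have hφd : ContDiff ℝ (⊤ : ℕ∞) φ := by
      rw [contDiff_infty_iff_deriv]
      exact ⟨fun x => (hφ' x).differentiableAt, hφd' ▸ hρd⟩
    have hρint : ∫ t, ρ t = 0 := by
      rw [hρ, integral_sub hηi' (hψi'.const_mul I), integral_const_mul, hψ1, ← hI]
      ring
    -- Beyond `b` the primitive equals the total integral of `ρ`, which is zero. This is what makes
    -- `φ` compactly supported.
    have hφ0 : ∀ x, x ∉ Icc a b → φ x = 0 := by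
      intro x hx
      rw [mem_Icc, not_and_or, not_le, not_le] at hx
      rcases hx with hx | hx
      · have h1 : ∫ t in a..x, ρ t = ∫ t in a..x, (0 : ℝ) :=
          intervalIntegral.integral_congr fun t ht => hρ0 t fun ht' => by
            rw [uIcc_of_ge hx.le] at ht
            exact (ht.2.trans_lt ht'.1).false
        simp [hφ, h1]
      · rw [hφ, ← hρint]
        simp only
        rw [intervalIntegral.integral_of_le (hab.trans hx).le]
        refine setIntegral_eq_integral_of_forall_compl_eq_zero fun t ht => hρ0 t fun ht' => ht ?_
        exact ⟨ht'.1, (ht'.2.trans hx).le⟩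
    have hφs' : tsupport φ ⊆ Icc a b :=
      closure_minimal (fun x hx => by_contra fun h => hx (hφ0 x h)) isClosed_Icc
    have hφc : HasCompactSupport φ := isCompact_Icc.of_isClosed_subset isClosed_closure hφs'
    have h3 := h.2.2 φ hφd hφc (hφs'.trans (hU.out ha hb))
    rw [hφd'] at h3
    simp only [hρ, sub_smul, mul_smul, Pi.zero_apply, smul_zero, integral_zero, neg_zero] at h3
    rw [integral_sub hηi (hψi.fun_smul I), integral_smul, sub_eq_zero] at h3
    simp only [smul_sub]
    rw [integral_sub hηi (hηi'.smul_const _), h3, integral_smul_const, sub_self]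
  filter_upwards [key] with x hx hxJ using sub_eq_zero.1 (hx hxJ)

theorem volume_diff_interior {J : Set ℝ} (hJ : J.OrdConnected) : volume (J \ interior J) = 0 :=
  measure_mono_null (sdiff_subset_sdiff_left subset_closure) (hJ.convex.addHaar_frontier volume)

theorem ae_restrict_of_interior {J : Set ℝ} (hJ : J.OrdConnected) {p : ℝ → Prop}
    (h : ∀ᵐ x, x ∈ interior J → p x) : ∀ᵐ x ∂volume.restrict J, p x := by
  rw [ae_restrict_iff' hJ.measurableSet]
  have h1 : ∀ᵐ x, x ∉ J \ interior J := measure_eq_zero_iff_ae_notMem.1 (volume_diff_interior hJ)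
  filter_upwards [h, h1] with x hx hx1 hxJ
  exact hx (by_contra fun h2 => hx1 ⟨hxJ, h2⟩)

theorem HasWeakDeriv.ae_eq {F : Type*} [NormedAddCommGroup F] [NormedSpace ℝ F]
    [CompleteSpace F] {J : Set ℝ} {f g g' : ℝ → F} (hJ : J.OrdConnected)
    (h : HasWeakDeriv J f g) (h' : HasWeakDeriv J f g') : g =ᵐ[volume.restrict J] g' :=
  ae_restrict_of_interior hJ (h.ae_eq_interior h')

/-- Subtracting a primitive of `g` from `f` leaves a function with weak derivative zero, which is
constant almost everywhere. -/
theorem HasWeakDeriv.exists_isPrimitiveOn {F : Type*} [NormedAddCommGroup F] [NormedSpace ℝ F]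
    [CompleteSpace F] {J : Set ℝ} {f g : ℝ → F} (hJ : J.OrdConnected)
    (hne : (interior J).Nonempty) (h : HasWeakDeriv J f g)
    (hg : ∀ x ∈ J, ∀ y ∈ J, IntervalIntegrable g volume x y) :
    ∃ f', IsPrimitiveOn J f' g ∧ f =ᵐ[volume.restrict J] f' := by
  obtain ⟨x₀, hx₀⟩ := hne
  have h1 := isPrimitiveOn_integral (interior_subset hx₀) hg
  have h2 := h.sub (h1.hasWeakDeriv hJ)
  simp only [sub_self] at h2
  obtain ⟨c, hc⟩ := HasWeakDeriv.ae_eq_const ⟨x₀, hx₀⟩ hJ h2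
  refine ⟨fun x => (∫ t in x₀..x, g t) + c, ?_, ae_restrict_of_interior hJ ?_⟩
  · intro x hx y hy
    refine ⟨(h1 x hx y hy).1, ?_⟩
    rw [(h1 x hx y hy).2, add_sub_add_right_eq_sub]
  · filter_upwards [hc] with x hx hxJ
    rw [← hx hxJ, add_sub_cancel]

end MetricGraph

namespace MetricGraph

variable {X E F : Type*} [NormedAddCommGroup F] (G : MetricGraph X E)

/-! ### The intervals of the edges -/

theorem interval_of_eq_top {e : E} (h : G.len e = ⊤) : G.interval e = Ici 0 := by
  ext x
  simp [interval, h]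

theorem interval_of_ne_top {e : E} (h : G.len e ≠ ⊤) :
    G.interval e = Icc 0 (G.len e).toReal := by
  ext x
  simp only [interval, mem_ofPred_eq, mem_Icc]
  exact and_congr_right fun _ => ENNReal.ofReal_le_iff_le_toReal h

theorem toReal_len_pos {e : E} (h : G.len e ≠ ⊤) : 0 < (G.len e).toReal :=
  ENNReal.toReal_pos (G.len_pos e).ne' h

theorem ordConnected_interval (e : E) : (G.interval e).OrdConnected := by
  by_cases h : G.len e = ⊤
  · rw [G.interval_of_eq_top h]
    exact ordConnected_Ici
  · rw [G.interval_of_ne_top h]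
    exact ordConnected_Icc

theorem measurableSet_interval (e : E) : MeasurableSet (G.interval e) :=
  (G.ordConnected_interval e).measurableSet

theorem interior_interval_nonempty (e : E) : (interior (G.interval e)).Nonempty := by
  by_cases h : G.len e = ⊤
  · rw [G.interval_of_eq_top h, interior_Ici]
    exact nonempty_Ioi
  · rw [G.interval_of_ne_top h, interior_Icc]
    exact nonempty_Ioo.2 (G.toReal_len_pos h)

theorem zero_mem_interval (e : E) : (0 : ℝ) ∈ G.interval e := by simp [interval]

/-- Every point of an edge has a neighbourhood in the edge that is a compact interval
starting at `0`. -/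
theorem exists_Icc_mem_nhdsWithin {e : E} {x : ℝ} (hx : x ∈ G.interval e) :
    ∃ b ∈ G.interval e, 0 < b ∧ x ∈ Icc 0 b ∧ Icc 0 b ∈ 𝓝[G.interval e] x := by
  by_cases h : G.len e = ⊤
  · rw [G.interval_of_eq_top h] at hx ⊢
    have hx' : (0 : ℝ) ≤ x := hx
    refine ⟨x + 1, by simp only [mem_Ici]; linarith, by linarith, ⟨hx', by linarith⟩, ?_⟩
    rw [← Ici_inter_Iic]
    exact inter_mem self_mem_nhdsWithin (mem_nhdsWithin_of_mem_nhds (Iic_mem_nhds (by linarith)))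
  · rw [G.interval_of_ne_top h] at hx ⊢
    exact ⟨_, ⟨(G.toReal_len_pos h).le, le_rfl⟩, G.toReal_len_pos h, hx, self_mem_nhdsWithin⟩

theorem _root_.IsPrimitiveOn.continuousOn_interval [NormedSpace ℝ F] {e : E} {f g : ℝ → F}
    (h : IsPrimitiveOn (G.interval e) f g) : ContinuousOn f (G.interval e) := by
  intro x hx
  obtain ⟨b, hb, hb0, hxb, hn⟩ := G.exists_Icc_mem_nhdsWithin hx
  have h1 := h.continuousOn_uIcc (G.ordConnected_interval e) (G.zero_mem_interval e) hb
  rw [uIcc_of_le hb0.le] at h1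
  exact (h1 x hxb).mono_of_mem_nhdsWithin hn

theorem intervalIntegrable_of_memLp {e : E} {g : ℝ → F} {p : ℝ≥0∞} (hp : 1 ≤ p)
    (hg : MeasureTheory.MemLp g p (G.edgeMeasure e)) {x y : ℝ} (hx : x ∈ G.interval e)
    (hy : y ∈ G.interval e) : IntervalIntegrable g volume x y := by
  rw [intervalIntegrable_iff]
  have h1 : MeasureTheory.MemLp g p (volume.restrict (uIoc x y)) :=
    hg.mono_measure (Measure.restrict_mono
      (uIoc_subset_uIcc.trans ((G.ordConnected_interval e).uIcc_subset hx hy)) le_rfl)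
  have : IsFiniteMeasure (volume.restrict (uIoc x y)) := ⟨by simp [uIoc]⟩
  exact h1.integrable hp

/-- Nonempty open sets have positive measure, so the functions agree in the interior, and the
interval lies in the closure of its nonempty interior. -/
theorem eq_of_ae_eq_of_continuousOn {e : E} {f g : ℝ → F} (hf : ContinuousOn f (G.interval e))
    (hg : ContinuousOn g (G.interval e)) (h : f =ᵐ[G.edgeMeasure e] g) :
    ∀ x ∈ G.interval e, f x = g x := by
  have h1 : EqOn f g (interior (G.interval e)) :=
    Measure.eqOn_open_of_ae_eq (ae_restrict_of_ae_restrict_of_subset interior_subset h)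
      isOpen_interior (hf.mono interior_subset) (hg.mono interior_subset)
  refine h1.of_subset_closure hf hg interior_subset ?_
  rw [(convex_iff_ordConnected.2 (G.ordConnected_interval e)).closure_interior_eq_closure_of_nonempty_interior
    (G.interior_interval_nonempty e)]
  exact subset_closure

/-- A continuous function with a weak derivative that is integrable up to the end points is a
primitive of its weak derivative. -/
theorem HasWeakDeriv.isPrimitiveOn [NormedSpace ℝ F] [CompleteSpace F] {e : E} {f g : ℝ → F}
    (h : HasWeakDeriv (G.interval e) f g) (hf : ContinuousOn f (G.interval e)) {p : ℝ≥0∞}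
    (hp : 1 ≤ p) (hg : MeasureTheory.MemLp g p (G.edgeMeasure e)) :
    IsPrimitiveOn (G.interval e) f g := by
  obtain ⟨f', h1, h2⟩ := h.exists_isPrimitiveOn (G.ordConnected_interval e)
    (G.interior_interval_nonempty e) fun x hx y hy => G.intervalIntegrable_of_memLp hp hg hx hy
  exact h1.congr (G.ordConnected_interval e)
    (fun x hx => (G.eq_of_ae_eq_of_continuousOn hf (h1.continuousOn_interval G) h2 x hx).symm)
    (EventuallyEq.refl _ _)

/-! ### Lebesgue measure on the graph -/

theorem measurableEmbedding_sigmaMk (e : E) :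
    MeasurableEmbedding (Sigma.mk (β := fun _ : E => ℝ) e) where
  injective := sigma_mk_injective
  measurable := fun _ hs => MeasurableSpace.measurableSet_iInf.1 hs e
  measurableSet_image' := by
    intro s hs
    refine MeasurableSpace.measurableSet_iInf.2 fun e' => ?_
    change MeasurableSet (Sigma.mk (β := fun _ : E => ℝ) e' ⁻¹'
      (Sigma.mk (β := fun _ : E => ℝ) e '' s))
    by_cases h : e' = e
    · subst h
      rwa [preimage_image_eq _ sigma_mk_injective]
    · rw [preimage_image_sigmaMk_of_ne h]
      exact MeasurableSet.empty

/-- Lebesgue measure on the disjoint union of the edges. -/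
noncomputable def graphMeasure : Measure (Σ _ : E, ℝ) :=
  Measure.sum fun e => (G.edgeMeasure e).map (Sigma.mk e)

/-- A family of functions on the edges as a function on their disjoint union. -/
abbrev unc {F : Type*} (u : E → ℝ → F) : (Σ _ : E, ℝ) → F := fun q => u q.1 q.2

section graphMeasure

theorem map_le_graphMeasure (e : E) : (G.edgeMeasure e).map (Sigma.mk e) ≤ G.graphMeasure :=
  Measure.le_sum (fun e => (G.edgeMeasure e).map (Sigma.mk e)) e

theorem memLp_edge {f : (Σ _ : E, ℝ) → F} {p : ℝ≥0∞} (h : MeasureTheory.MemLp f p G.graphMeasure)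
    (e : E) : MeasureTheory.MemLp (fun x => f ⟨e, x⟩) p (G.edgeMeasure e) :=
  (measurableEmbedding_sigmaMk e).memLp_map_measure_iff.1 (h.mono_measure (G.map_le_graphMeasure e))

theorem lintegral_graphMeasure (f : (Σ _ : E, ℝ) → ℝ≥0∞) :
    ∫⁻ q, f q ∂G.graphMeasure = ∑' e, ∫⁻ x, f ⟨e, x⟩ ∂G.edgeMeasure e := by
  rw [graphMeasure, lintegral_sum_measure]
  simp_rw [(measurableEmbedding_sigmaMk _).lintegral_map]

theorem integral_graphMeasure [NormedSpace ℝ F] {f : (Σ _ : E, ℝ) → F}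
    (hf : Integrable f G.graphMeasure) :
    ∫ q, f q ∂G.graphMeasure = ∑' e, ∫ x, f ⟨e, x⟩ ∂G.edgeMeasure e := by
  rw [graphMeasure, integral_sum_measure hf]
  simp_rw [(measurableEmbedding_sigmaMk _).integral_map]

variable [Countable E]

theorem ae_graphMeasure_iff {p : (Σ _ : E, ℝ) → Prop} :
    (∀ᵐ q ∂G.graphMeasure, p q) ↔ ∀ e, ∀ᵐ x ∂G.edgeMeasure e, p ⟨e, x⟩ := by
  rw [graphMeasure, Measure.ae_sum_iff]
  simp_rw [(measurableEmbedding_sigmaMk _).ae_map_iff]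

theorem aestronglyMeasurable_graphMeasure_iff {f : (Σ _ : E, ℝ) → F} :
    AEStronglyMeasurable f G.graphMeasure ↔
      ∀ e, AEStronglyMeasurable (fun x => f ⟨e, x⟩) (G.edgeMeasure e) := by
  rw [graphMeasure, aestronglyMeasurable_sum_measure_iff]
  simp_rw [(measurableEmbedding_sigmaMk _).aestronglyMeasurable_map_iff]
  rfl

theorem integrable_graphMeasure_iff {f : (Σ _ : E, ℝ) → F} :
    Integrable f G.graphMeasure ↔ (∀ e, Integrable (fun x => f ⟨e, x⟩) (G.edgeMeasure e)) ∧
      Summable fun e => ∫ x, ‖f ⟨e, x⟩‖ ∂G.edgeMeasure e := by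
  rw [graphMeasure, integrable_sum_measure_iff]
  simp_rw [(measurableEmbedding_sigmaMk _).integrable_map_iff,
    (measurableEmbedding_sigmaMk _).integral_map]
  rfl

/-- Both sides say that the integrals of `‖u‖²` over the edges are summable. -/
theorem memLp_two_iff {u : E → ℝ → F} :
    G.MemLp 2 u ↔ MeasureTheory.MemLp (unc u) 2 G.graphMeasure := by
  have key : ∀ e, MeasureTheory.MemLp (u e) 2 (G.edgeMeasure e) →
      ‖(eLpNorm (u e) 2 (G.edgeMeasure e)).toReal‖ ^ (2 : ℝ≥0∞).toReal =
        ∫ x, ‖‖u e x‖ ^ 2‖ ∂G.edgeMeasure e := by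
    intro e he
    rw [he.eLpNorm_eq_integral_rpow_norm (by simp) (by simp)]
    simp only [norm_pow, norm_norm, ENNReal.toReal_ofNat, Real.rpow_ofNat]
    have h0 : 0 ≤ ∫ x, ‖u e x‖ ^ 2 ∂G.edgeMeasure e := integral_nonneg fun x => by positivity
    rw [ENNReal.toReal_ofReal (by positivity), Real.norm_eq_abs, sq_abs, ← Real.rpow_natCast,
      ← Real.rpow_mul h0]
    simp
  constructor
  · rintro ⟨h1, h2⟩
    have hm : AEStronglyMeasurable (unc u) G.graphMeasure :=
      G.aestronglyMeasurable_graphMeasure_iff.2 fun e => (h1 e).1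
    rw [memLp_two_iff_integrable_sq_norm hm, G.integrable_graphMeasure_iff]
    refine ⟨fun e => (memLp_two_iff_integrable_sq_norm (h1 e).1).1 (h1 e), ?_⟩
    rw [memℓp_gen_iff (by simp)] at h2
    refine h2.congr ?_
    intro e
    exact key e (h1 e)
  · intro h
    have h1 := fun e => G.memLp_edge h e
    refine ⟨h1, ?_⟩
    rw [memLp_two_iff_integrable_sq_norm h.1, G.integrable_graphMeasure_iff] at h
    rw [memℓp_gen_iff (by simp)]
    refine h.2.congr ?_
    intro e
    exact (key e (h1 e)).symm

theorem MemLp.memLp_top {u : E → ℝ → F} (h : G.MemLp ∞ u) :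
    MeasureTheory.MemLp (unc u) ∞ G.graphMeasure := by
  obtain ⟨h1, h2⟩ := h
  obtain ⟨C, hC⟩ := memℓp_infty_iff.1 h2
  refine memLp_top_of_bound (G.aestronglyMeasurable_graphMeasure_iff.2 fun e => (h1 e).1) C ?_
  refine G.ae_graphMeasure_iff.2 fun e => ?_
  have h3 := hC ⟨e, rfl⟩
  filter_upwards [ae_le_eLpNormEssSup (f := u e) (μ := G.edgeMeasure e)] with x hx
  rw [← eLpNorm_exponent_top, ← ofReal_norm] at hx
  beta_reduce at h3
  rw [Real.norm_of_nonneg ENNReal.toReal_nonneg] at h3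
  exact ((ENNReal.ofReal_le_iff_le_toReal (h1 e).2.ne).1 hx).trans h3

theorem memLp_L2 (u : G.L2) :
    MeasureTheory.MemLp (unc fun e => (u e : ℝ → ℂ)) 2 G.graphMeasure := by
  refine G.memLp_two_iff.1 ⟨fun e => Lp.memLp (u e), ?_⟩
  have h := (memℓp_gen_iff (by simp)).1 (lp.memℓp u)
  rw [memℓp_gen_iff (by simp)]
  refine h.congr fun e => ?_
  rw [← Lp.norm_def, norm_norm]

theorem exists_L2 {f : E → ℝ → ℂ} (hf : MeasureTheory.MemLp (unc f) 2 G.graphMeasure) :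
    ∃ u : G.L2, ∀ e, u e =ᵐ[G.edgeMeasure e] f e := by
  obtain ⟨h1, h2⟩ := G.memLp_two_iff.2 hf
  refine ⟨⟨fun e => (h1 e).toLp (f e), ?_⟩, fun e => (h1 e).coeFn_toLp⟩
  rw [memℓp_gen_iff (by simp)] at h2
  refine (memℓp_gen_iff (by simp)).2 (h2.congr fun e => ?_)
  rw [Lp.norm_toLp, Real.norm_of_nonneg ENNReal.toReal_nonneg]

theorem inner_L2 (u v : G.L2) :
    ⟪u, v⟫_ℂ = ∫ q, conj (u q.1 q.2) * v q.1 q.2 ∂G.graphMeasure := by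
  have h : Integrable (fun q : Σ _ : E, ℝ => conj (u q.1 q.2) * v q.1 q.2) G.graphMeasure :=
    (G.memLp_L2 u).star.integrable_mul (G.memLp_L2 v)
  rw [G.integral_graphMeasure h, lp.inner_eq_tsum]
  refine tsum_congr fun e => ?_
  rw [L2.inner_def]
  refine integral_congr_ae (Eventually.of_forall fun x => ?_)
  simp [mul_comm]

end graphMeasure

end MetricGraph

namespace MetricGraph

variable {X E F : Type*} {G : MetricGraph X E}

/-! ### Paths and the path distance -/

theorem HasPath.nonneg {p q : G.Point} {r : ℝ} (h : G.HasPath p q r) : 0 ≤ r := by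
  induction h with
  | refl => exact le_rfl
  | move y _ ih => positivity
  | cross h' _ _ ih => exact ih

theorem HasPath.trans {p q q' : G.Point} {r r' : ℝ} (h : G.HasPath p q r)
    (h' : G.HasPath q q' r') : G.HasPath p q' (r + r') := by
  induction h' with
  | refl => simpa using h
  | move y _ ih =>
    rw [← add_assoc]
    exact HasPath.move y ih
  | cross h'' _ hv ih => exact HasPath.cross h'' ih hv

theorem HasPath.symm {p q : G.Point} {r : ℝ} (h : G.HasPath p q r) : G.HasPath q p r := by
  induction h with
  | refl => exact HasPath.refl _
  | move y h1 ih =>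
    have h2 := (HasPath.move (G := G) _ (HasPath.refl ⟨_, y⟩)).trans ih
    rw [abs_sub_comm]
    convert h2 using 1
    ring
  | @cross h r h' h1 hv ih =>
    have h2 := (HasPath.cross h (HasPath.refl h'.toPoint) hv.symm).trans ih
    rwa [zero_add] at h2

theorem pathDist_le {p q : G.Point} {r : ℝ} (h : G.HasPath p q r) : G.pathDist p q ≤ r :=
  csInf_le ⟨0, fun _ hr => HasPath.nonneg hr⟩ h

theorem le_pathDist (hG : G.Connected) {p q : G.Point} {c : ℝ}
    (h : ∀ r, G.HasPath p q r → c ≤ r) : c ≤ G.pathDist p q :=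
  le_csInf (hG.2 p q) h

theorem pathDist_le_add_abs (hG : G.Connected) (p : G.Point) {e : E} (x y : G.interval e) :
    G.pathDist p ⟨e, y⟩ ≤ G.pathDist p ⟨e, x⟩ + |(x : ℝ) - y| := by
  rw [← sub_le_iff_le_add]
  refine le_pathDist hG fun r hr => ?_
  rw [sub_le_iff_le_add]
  exact pathDist_le (HasPath.move y hr)

theorem pathDist_eq_of_vertex_eq (hG : G.Connected) (p : G.Point) {h h' : G.EdgeEnd}
    (hv : h.vertex = h'.vertex) : G.pathDist p h.toPoint = G.pathDist p h'.toPoint :=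
  le_antisymm (le_pathDist hG fun _ hr => pathDist_le (hr.cross h hv.symm))
    (le_pathDist hG fun _ hr => pathDist_le (hr.cross h' hv))

theorem pathDist_triangle (hG : G.Connected) (p₀ p q : G.Point) :
    G.pathDist p q ≤ G.pathDist p₀ p + G.pathDist p₀ q := by
  rw [← sub_le_iff_le_add]
  refine le_pathDist hG fun r hr => ?_
  rw [sub_le_iff_le_add, ← sub_le_iff_le_add']
  refine le_pathDist hG fun r' hr' => ?_
  rw [sub_le_iff_le_add']
  exact pathDist_le (hr.symm.trans hr')

theorem exists_end (v : X) : ∃ h : G.EdgeEnd, h.vertex = v := by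
  obtain ⟨e, h | ⟨h, h'⟩⟩ := G.degree_pos v
  · exact ⟨.start e, h⟩
  · exact ⟨.finish e h, h'⟩

/-- The distance of a vertex from a point. -/
noncomputable def vertexDist (p : G.Point) (v : X) : ℝ :=
  G.pathDist p (exists_end (G := G) v).choose.toPoint

/-- Crossing a vertex costs no length, so the choice of an edge end in `vertexDist` is immaterial.
-/
theorem vertexDist_vertex (hG : G.Connected) (p : G.Point) (h : G.EdgeEnd) :
    vertexDist p h.vertex = G.pathDist p h.toPoint :=
  pathDist_eq_of_vertex_eq hG p (exists_end h.vertex).choose_spec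

theorem vertexDist_nonneg (p : G.Point) (v : X) : 0 ≤ vertexDist p v :=
  Real.sInf_nonneg fun _ hr => HasPath.nonneg hr

theorem abs_vertexDist_sub_le (hG : G.Connected) (p : G.Point) (e : E) (h : G.len e ≠ ⊤) :
    |vertexDist p (G.target e h) - vertexDist p (G.source e)| ≤ (G.len e).toReal := by
  have h1 := vertexDist_vertex hG p (.start e)
  have h2 := vertexDist_vertex hG p (.finish e h)
  have h3 := pathDist_le_add_abs hG p (e := e) ⟨_, (EdgeEnd.start (G := G) e).pos_mem⟩
    ⟨_, (EdgeEnd.finish e h).pos_mem⟩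
  have h4 := pathDist_le_add_abs hG p (e := e) ⟨_, (EdgeEnd.finish e h).pos_mem⟩
    ⟨_, (EdgeEnd.start (G := G) e).pos_mem⟩
  have h5 : (0 : ℝ) ≤ (G.len e).toReal := ENNReal.toReal_nonneg
  simp only [EdgeEnd.vertex, EdgeEnd.toPoint, EdgeEnd.pos, EdgeEnd.edge, zero_sub, abs_neg,
    sub_zero, abs_of_nonneg h5] at h1 h2 h3 h4
  rw [h1, h2, abs_le]
  constructor <;> linarith

theorem finite_ends_of_edges {S : Set E} (hS : S.Finite) : {h : G.EdgeEnd | h.edge ∈ S}.Finite := by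
  classical
  have h1 : {h : G.EdgeEnd | h.edge ∈ S} ⊆
      (EdgeEnd.start '' S) ∪ ((fun e => if h : G.len e ≠ ⊤ then EdgeEnd.finish e h
        else EdgeEnd.start e) '' S) := by
    rintro (e | ⟨e, h⟩) he
    · exact Or.inl ⟨e, he, rfl⟩
    · exact Or.inr ⟨e, he, by simp [h]⟩
  exact ((hS.image _).union (hS.image _)).subset h1

/-- The edge ends within distance `R` of `p` are pairwise at distance at most `R + R`, so they form
a bounded set and meet finitely many edges. -/
theorem finite_edges_of_vertexDist_le (hG : G.Connected) (hfin : G.LocallyFinite) (p : G.Point)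
    (R : ℝ) : {e | ∃ h : G.EdgeEnd, h.edge = e ∧ vertexDist p h.vertex ≤ R}.Finite := by
  refine (hfin.2 (EdgeEnd.toPoint '' {h | vertexDist p h.vertex ≤ R}) ⟨R + R, ?_⟩).subset ?_
  · rintro _ ⟨h, hh, rfl⟩ _ ⟨h', hh', rfl⟩
    simp only [mem_ofPred_eq, vertexDist_vertex hG] at hh hh'
    exact (pathDist_triangle hG p _ _).trans (add_le_add hh hh')
  · rintro e ⟨h, rfl, hh⟩
    exact ⟨h.toPoint, ⟨h, hh, rfl⟩, rfl⟩

theorem finite_edges_at (hG : G.Connected) (hfin : G.LocallyFinite) (v : X) :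
    {e | ∃ h : G.EdgeEnd, h.edge = e ∧ h.vertex = v}.Finite := by
  obtain ⟨p⟩ := hG.1
  refine (finite_edges_of_vertexDist_le hG hfin p (vertexDist p v)).subset ?_
  rintro e ⟨h, rfl, rfl⟩
  exact ⟨h, rfl, le_rfl⟩

theorem finite_ends_at (hG : G.Connected) (hfin : G.LocallyFinite) (v : X) :
    {h : G.EdgeEnd | h.vertex = v}.Finite :=
  (finite_ends_of_edges (finite_edges_at hG hfin v)).subset fun h hv => ⟨h, rfl, hv⟩

/-! ### Functions with square integrable derivative -/

/-- Continuity at the vertices. -/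
def IsGlued (G : MetricGraph X E) (u : E → ℝ → F) : Prop :=
  ∀ h h' : G.EdgeEnd, h.vertex = h'.vertex → u h.edge h.pos = u h'.edge h'.pos

/-- An intermediate value theorem along paths: a move along an edge is covered by the classical one,
and crossing a vertex does not change the value. -/
theorem exists_eq_of_hasPath {f : E → ℝ → ℝ} (hg : G.IsGlued f)
    (hc : ∀ e, ContinuousOn (f e) (G.interval e)) {p q : G.Point} {r : ℝ} (h : G.HasPath p q r)
    {c : ℝ} (hcpq : c ∈ uIcc (f p.1 p.2) (f q.1 q.2)) :
    ∃ e, ∃ x ∈ G.interval e, f e x = c := by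
  induction h with
  | refl =>
    rw [uIcc_self, mem_singleton_iff] at hcpq
    exact ⟨p.1, p.2, p.2.2, hcpq.symm⟩
  | @move e x r y _ ih =>
    rcases uIcc_subset_uIcc_union_uIcc hcpq with h1 | h1
    · exact ih h1
    · have h2 := (G.ordConnected_interval e).uIcc_subset x.2 y.2
      obtain ⟨z, hz, hzc⟩ := intermediate_value_uIcc ((hc e).mono h2) h1
      exact ⟨e, z, h2 hz, hzc⟩
  | @cross h r h' _ hv ih =>
    apply ih
    have h1 := hg h h' hv
    simp only [EdgeEnd.toPoint] at hcpq ⊢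
    rwa [h1]

/-- A path may run through an edge many times, so the variation is not summed along it. Instead, all
values between `f e' y` and `f e x` are attained; this interval of values is covered by the images
of the edges, and the image of each edge has diameter at most the integral of `‖f'‖` over that edge.
-/
theorem sub_le_integral_norm_deriv [Countable E] (hG : G.Connected) {f f' : E → ℝ → ℝ}
    (hg : G.IsGlued f) (hf : ∀ e, IsPrimitiveOn (G.interval e) (f e) (f' e))
    (hi : Integrable (unc f') G.graphMeasure) {e e' : E} {x y : ℝ} (hx : x ∈ G.interval e)
    (hy : y ∈ G.interval e') : f e x - f e' y ≤ ∫ q, ‖unc f' q‖ ∂G.graphMeasure := by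
  obtain ⟨r, hr⟩ := hG.2 ⟨e', y, hy⟩ ⟨e, x, hx⟩
  have h1 : Icc (f e' y) (f e x) ⊆ ⋃ e, f e '' G.interval e := by
    intro c hc
    obtain ⟨e₁, x₁, hx₁, h⟩ := exists_eq_of_hasPath hg
      (fun e => (hf e).continuousOn_interval G) hr (Icc_subset_uIcc hc)
    exact mem_iUnion.2 ⟨e₁, x₁, hx₁, h⟩
  have h2 : ∀ e, volume (f e '' G.interval e) ≤ ∫⁻ x, ‖f' e x‖ₑ ∂G.edgeMeasure e := by
    intro e
    refine (Real.volume_le_diam _).trans (Metric.ediam_image_le_iff.2 fun x hx y hy => ?_)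
    obtain ⟨-, h3⟩ := hf e y hy x hx
    rw [edist_eq_enorm_sub, ← h3]
    rw [enorm_eq_iff_norm_eq.2 (intervalIntegral.norm_intervalIntegral_eq _ _ _ _)]
    refine (enorm_integral_le_lintegral_enorm _).trans ?_
    exact lintegral_mono' (Measure.restrict_mono
      (uIoc_subset_uIcc.trans ((G.ordConnected_interval e).uIcc_subset hy hx)) le_rfl) le_rfl
  have h3 : ENNReal.ofReal (f e x - f e' y) ≤ ∫⁻ q, ‖unc f' q‖ₑ ∂G.graphMeasure := by
    rw [← Real.volume_Icc, lintegral_graphMeasure]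
    exact (measure_mono h1).trans ((measure_iUnion_le _).trans (ENNReal.tsum_le_tsum h2))
  rw [← ofReal_integral_norm_eq_lintegral_enorm hi] at h3
  exact (ENNReal.ofReal_le_ofReal_iff (integral_nonneg fun _ => norm_nonneg _)).1 h3

/-- `u` is a continuous function on the graph in `L²` with edgewise derivative `p` in `L²`. -/
structure IsH1 (G : MetricGraph X E) (u p : E → ℝ → ℂ) : Prop where
  glued : G.IsGlued u
  isPrimitiveOn : ∀ e, IsPrimitiveOn (G.interval e) (u e) (p e)
  memLp : MeasureTheory.MemLp (unc u) 2 G.graphMeasure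
  memLp_deriv : MeasureTheory.MemLp (unc p) 2 G.graphMeasure

theorem _root_.MeasureTheory.MemLp.integral_norm_sq_nonneg {α : Type*} {m : MeasurableSpace α}
    (μ : Measure α) (f : α → ℂ) : 0 ≤ ∫ q, ‖f q‖ ^ 2 ∂μ := integral_nonneg fun _ => by positivity

/-- The oscillation bound is applied to `‖u‖²`, whose derivative `2 Re (ū p)` is at most `‖u‖² +
‖p‖²` in absolute value, and then averaged over an initial piece of one fixed edge. Only the length
of that piece enters the constant. -/
theorem exists_sup_bound [Countable E] (hG : G.Connected) : ∃ C : ℝ, 0 ≤ C ∧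
    ∀ u p : E → ℝ → ℂ, G.IsH1 u p → ∀ e, ∀ x ∈ G.interval e,
      ‖u e x‖ ^ 2 ≤ C * (∫ q, ‖unc u q‖ ^ 2 ∂G.graphMeasure +
        ∫ q, ‖unc p q‖ ^ 2 ∂G.graphMeasure) := by
  obtain ⟨⟨e₀, x₀⟩⟩ := hG.1
  obtain ⟨b, hb, hb0, -, -⟩ := G.exists_Icc_mem_nhdsWithin x₀.2
  -- Averaging over `[0, b]` contributes `b⁻¹`, the oscillation of `‖u‖²` contributes `1`.
  refine ⟨b⁻¹ + 1, by positivity, fun u p hu e x hx => ?_⟩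
  set f : E → ℝ → ℝ := fun e x => ‖u e x‖ ^ 2 with hf
  set f' : E → ℝ → ℝ := fun e x => 2 * (conj (u e x) * p e x).re with hf'
  have hprim : ∀ e, IsPrimitiveOn (G.interval e) (f e) (f' e) := by
    intro e
    have h1 := (((hu.isPrimitiveOn e).clm Complex.conjCLE.toContinuousLinearMap).smul
      (G.ordConnected_interval e) (hu.isPrimitiveOn e)).clm Complex.reCLM
    refine h1.congr (G.ordConnected_interval e) (fun x _ => ?_) (Eventually.of_forall fun x => ?_)
    · simp only [hf, ← Complex.normSq_eq_norm_sq, Complex.normSq_apply]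
      simp
    · simp [hf']
      ring
  have hu2 : Integrable (fun q => ‖unc u q‖ ^ 2) G.graphMeasure :=
    (memLp_two_iff_integrable_sq_norm hu.memLp.1).1 hu.memLp
  have hp2 : Integrable (fun q => ‖unc p q‖ ^ 2) G.graphMeasure :=
    (memLp_two_iff_integrable_sq_norm hu.memLp_deriv.1).1 hu.memLp_deriv
  have hi : Integrable (unc f') G.graphMeasure :=
    ((hu.memLp.star.integrable_mul hu.memLp_deriv).re).const_mul 2
  set N := ∫ q, ‖unc f' q‖ ∂G.graphMeasure with hN
  have hNle : N ≤ ∫ q, ‖unc u q‖ ^ 2 ∂G.graphMeasure + ∫ q, ‖unc p q‖ ^ 2 ∂G.graphMeasure := by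
    rw [← integral_add hu2 hp2]
    refine integral_mono hi.norm (hu2.add hp2) fun q => ?_
    have h1 : |(conj (u q.1 q.2) * p q.1 q.2).re| ≤ ‖u q.1 q.2‖ * ‖p q.1 q.2‖ := by
      refine (Complex.abs_re_le_norm _).trans ?_
      rw [norm_mul, RCLike.norm_conj]
    simp only [hf', Real.norm_eq_abs, abs_mul, abs_two]
    nlinarith [sq_nonneg (‖u q.1 q.2‖ - ‖p q.1 q.2‖)]
  have hgl : G.IsGlued f := fun h h' hv => by simp only [hf, hu.glued h h' hv]
  have hsub : Icc 0 b ⊆ G.interval e₀ :=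
    (G.ordConnected_interval e₀).out (G.zero_mem_interval e₀) hb
  have h1 : ∀ y ∈ Icc 0 b, f e x ≤ f e₀ y + N := fun y hy => by
    have := sub_le_integral_norm_deriv hG hgl hprim hi hx (hsub hy)
    linarith
  have hi0 : Integrable (f e₀) (G.edgeMeasure e₀) := (G.integrable_graphMeasure_iff.1 hu2).1 e₀
  have hint : IntervalIntegrable (f e₀) volume 0 b := by
    rw [intervalIntegrable_iff_integrableOn_Icc_of_le hb0.le]
    exact hi0.mono_measure (Measure.restrict_mono hsub le_rfl)
  have h2 : ∫ _ in (0 : ℝ)..b, f e x ≤ ∫ y in (0 : ℝ)..b, (f e₀ y + N) :=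
    intervalIntegral.integral_mono_on hb0.le (by simp) (hint.add (by simp)) h1
  have h3 : ∫ y in (0 : ℝ)..b, f e₀ y ≤ ∫ q, ‖unc u q‖ ^ 2 ∂G.graphMeasure := by
    rw [intervalIntegral.integral_of_le hb0.le]
    calc ∫ y in Ioc 0 b, f e₀ y ≤ ∫ y, f e₀ y ∂G.edgeMeasure e₀ :=
          setIntegral_mono_set hi0 (Eventually.of_forall fun y => by simp only [hf]; positivity)
            (Ioc_subset_Icc_self.trans hsub).eventuallyLE
      _ = ∫ q, ‖unc u q‖ ^ 2 ∂((G.edgeMeasure e₀).map (Sigma.mk e₀)) :=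
          ((measurableEmbedding_sigmaMk e₀).integral_map fun q => ‖unc u q‖ ^ 2).symm
      _ ≤ _ := integral_mono_measure (G.map_le_graphMeasure e₀)
          (Eventually.of_forall fun q => by positivity) hu2
  rw [intervalIntegral.integral_add hint (by simp)] at h2
  simp only [intervalIntegral.integral_const, sub_zero, smul_eq_mul] at h2
  have h4 : b * f e x ≤ ∫ q, ‖unc u q‖ ^ 2 ∂G.graphMeasure + b * N := by linarith
  have hP := MeasureTheory.MemLp.integral_norm_sq_nonneg G.graphMeasure (unc p)
  have h5 : f e x ≤ b⁻¹ * (∫ q, ‖unc u q‖ ^ 2 ∂G.graphMeasure) + N := by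
    rw [← mul_le_mul_iff_right₀ hb0]
    refine h4.trans (le_of_eq ?_)
    field_simp
  have h6 := mul_nonneg (inv_nonneg.2 hb0.le) hP
  change f e x ≤ _
  nlinarith

/-! ### Integration by parts on the graph -/

open Classical in
/-- The ends of an edge. -/
noncomputable def endsOf (G : MetricGraph X E) (e : E) : Finset G.EdgeEnd :=
  if h : G.len e ≠ ⊤ then {.start e, .finish e h} else {.start e}

theorem mem_endsOf {e : E} {h : G.EdgeEnd} : h ∈ G.endsOf e ↔ h.edge = e := by
  unfold endsOf
  split_ifs with hl
  · rcases h with e' | ⟨e', h'⟩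
    · simp [EdgeEnd.edge]
    · simp only [EdgeEnd.edge, Finset.mem_insert, reduceCtorEq, Finset.mem_singleton, false_or,
        EdgeEnd.finish.injEq]
  · rcases h with e' | ⟨e', h'⟩
    · simp [EdgeEnd.edge]
    · simp only [EdgeEnd.edge, Finset.mem_singleton, reduceCtorEq, false_iff]
      rintro rfl
      exact hl h'

/-- The minus sign appears because `sign` points into the edge. A ray has no boundary term at
infinity: `f` converges there since `f'` is integrable, and the limit is zero since `f` is
integrable. -/
theorem setIntegral_deriv_eq_neg_sum_ends {e : E} {f f' : ℝ → ℂ}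
    (h : IsPrimitiveOn (G.interval e) f f') (hf : Integrable f (G.edgeMeasure e))
    (hf' : Integrable f' (G.edgeMeasure e)) :
    ∫ x, f' x ∂G.edgeMeasure e = -∑ h ∈ G.endsOf e, (h.sign : ℂ) * f h.pos := by
  classical
  unfold endsOf
  split_ifs with hl
  · have h1 := (h 0 (G.zero_mem_interval e) (G.len e).toReal
      (EdgeEnd.finish (G := G) e hl).pos_mem).2
    rw [intervalIntegral.integral_of_le (G.toReal_len_pos hl).le,
      ← integral_Icc_eq_integral_Ioc] at h1
    rw [edgeMeasure, G.interval_of_ne_top hl, h1, Finset.sum_pair (by simp)]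
    simp [EdgeEnd.sign, EdgeEnd.pos, sub_eq_add_neg]
  · rw [not_not] at hl
    have hI : G.interval e = Ici 0 := G.interval_of_eq_top hl
    rw [edgeMeasure, hI] at hf hf' ⊢
    have hf1 : IntegrableOn f (Ioi 0) := IntegrableOn.mono_set hf Ioi_subset_Ici_self
    have hf2 : IntegrableOn f' (Ioi 0) := IntegrableOn.mono_set hf' Ioi_subset_Ici_self
    have h1 := intervalIntegral_tendsto_integral_Ioi 0 hf2 tendsto_id
    have h2 : Tendsto f atTop (𝓝 ((∫ x in Ioi 0, f' x) + f 0)) := by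
      refine (h1.add_const (f 0)).congr' ?_
      filter_upwards [eventually_ge_atTop 0] with b hb
      rw [id_eq, (h 0 (G.zero_mem_interval e) b (by rw [hI]; exact hb)).2, sub_add_cancel]
    have h3 : (∫ x in Ioi 0, f' x) + f 0 = 0 := by
      refine IntegrableAtFilter.eq_zero_of_tendsto (μ := volume) (l := atTop)
        ⟨Ioi 0, Ioi_mem_atTop 0, hf1⟩ (fun s hs => ?_) h2
      obtain ⟨b, hb⟩ := mem_atTop_sets.1 hs
      exact top_le_iff.1 (Real.volume_Ici (a := b) ▸ measure_mono hb)
    rw [integral_Ici_eq_integral_Ioi, eq_neg_of_add_eq_zero_left h3]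
    simp [EdgeEnd.sign, EdgeEnd.pos]

theorem integral_deriv_eq_neg_finsum_ends [Countable E] {f f' : E → ℝ → ℂ}
    (h : ∀ e, IsPrimitiveOn (G.interval e) (f e) (f' e))
    (hf : Integrable (unc f) G.graphMeasure) (hf' : Integrable (unc f') G.graphMeasure)
    (hfin : {e | ∃ h : G.EdgeEnd, h.edge = e ∧ f h.edge h.pos ≠ 0}.Finite) :
    ∫ q, unc f' q ∂G.graphMeasure =
      -∑ᶠ h : G.EdgeEnd, (h.sign : ℂ) * f h.edge h.pos := by
  classical
  have h1 : ∀ e, ∫ x, f' e x ∂G.edgeMeasure e =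
      -∑ h ∈ G.endsOf e, (h.sign : ℂ) * f h.edge h.pos := by
    intro e
    rw [setIntegral_deriv_eq_neg_sum_ends (h e) ((G.integrable_graphMeasure_iff.1 hf).1 e)
      ((G.integrable_graphMeasure_iff.1 hf').1 e)]
    refine congrArg _ (Finset.sum_congr rfl fun h hh => ?_)
    rw [mem_endsOf.1 hh]
  rw [G.integral_graphMeasure hf', tsum_congr h1, tsum_eq_sum (s := hfin.toFinset),
    Finset.sum_neg_distrib, ← Finset.sum_biUnion]
  · congr 1
    refine (finsum_eq_sum_of_support_subset _ fun h hh => ?_).symm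
    simp only [Finset.coe_biUnion, mem_iUnion, Finset.mem_coe]
    refine ⟨h.edge, ?_, mem_endsOf.2 rfl⟩
    rw [Finite.mem_toFinset]
    exact ⟨h, rfl, right_ne_zero_of_mul hh⟩
  · intro e _ e' _ hne
    rw [Function.onFun, Finset.disjoint_left]
    intro h hh hh'
    exact hne ((mem_endsOf.1 hh).symm.trans (mem_endsOf.1 hh'))
  · intro e he
    rw [neg_eq_zero]
    refine Finset.sum_eq_zero fun h hh => ?_
    rw [Finite.mem_toFinset] at he
    have h2 : f h.edge h.pos = 0 := by
      by_contra h3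
      exact he ⟨h, mem_endsOf.1 hh, h3⟩
    rw [h2, mul_zero]

/-- Group the edge ends by their vertices. At each vertex `v` has a single value, which factors out
and leaves the conjugate of the Kirchhoff sum of `z`. -/
theorem finsum_ends_eq_zero {z : E → ℝ → ℂ} {v : E → ℝ → ℂ} (hv : G.IsGlued v)
    (hz : ∀ x : X, ∑ᶠ (h : G.EdgeEnd) (_ : h.vertex = x), (h.sign : ℂ) * z h.edge h.pos = 0)
    (hfin : {e | ∃ h : G.EdgeEnd, h.edge = e ∧ v h.edge h.pos ≠ 0}.Finite) :
    ∑ᶠ h : G.EdgeEnd, (h.sign : ℂ) * (conj (z h.edge h.pos) * v h.edge h.pos) = 0 := by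
  classical
  set T := (finite_ends_of_edges (G := G) hfin).toFinset with hT
  have hmem : ∀ h : G.EdgeEnd, v h.edge h.pos ≠ 0 → h ∈ T := by
    intro h hh
    rw [hT, Finite.mem_toFinset]
    exact ⟨h, rfl, hh⟩
  rw [finsum_eq_sum_of_support_subset (s := T) _ fun h hh =>
    hmem h (right_ne_zero_of_mul (right_ne_zero_of_mul hh)),
    ← Finset.sum_fiberwise_of_maps_to (t := T.image EdgeEnd.vertex)
      (fun h hh => Finset.mem_image_of_mem _ hh)]
  refine Finset.sum_eq_zero fun x _ => ?_
  by_cases hx : ∃ h₀ : G.EdgeEnd, h₀.vertex = x ∧ v h₀.edge h₀.pos ≠ 0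
  · obtain ⟨h₀, rfl, h0⟩ := hx
    -- As `v` is nonzero at `h₀`, all ends at the same vertex lie in `T`, so this is the whole
    -- Kirchhoff sum.
    have h1 : ∑ h ∈ T with h.vertex = h₀.vertex, (h.sign : ℂ) * z h.edge h.pos = 0 := by
      rw [← hz h₀.vertex]
      symm
      refine finsum_mem_eq_sum_of_inter_support_eq
        (s := {h : G.EdgeEnd | h.vertex = h₀.vertex}) _ ?_
      congr 1
      ext h
      simp only [mem_ofPred_eq, Finset.coe_filter]
      refine ⟨fun hh => ⟨hmem h ?_, hh⟩, fun hh => hh.2⟩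
      rwa [hv h h₀ hh]
    have h2 : ∀ h ∈ T.filter fun h => h.vertex = h₀.vertex,
        (h.sign : ℂ) * (conj (z h.edge h.pos) * v h.edge h.pos) =
          conj ((h.sign : ℂ) * z h.edge h.pos) * v h₀.edge h₀.pos := by
      intro h hh
      rw [hv h h₀ (Finset.mem_filter.1 hh).2, map_mul, Complex.conj_ofReal, mul_assoc]
    rw [Finset.sum_congr rfl h2, ← Finset.sum_mul, ← map_sum, h1, map_zero, zero_mul]
  · push Not at hx
    refine Finset.sum_eq_zero fun h hh => ?_
    rw [hx h (Finset.mem_filter.1 hh).2, mul_zero, mul_zero]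

/-! ### Extending functions from the vertices to the edges -/

open Classical in
/-- A function on the vertices, extended linearly to the edges of finite length, and with
exponential decay to the rays. -/
noncomputable def extend (G : MetricGraph X E) (ε : ℝ) (k : X → ℝ) (e : E) (x : ℝ) : ℝ :=
  if h : G.len e ≠ ⊤ then
    k (G.source e) + (k (G.target e h) - k (G.source e)) / (G.len e).toReal * x
  else k (G.source e) * Real.exp (-ε * x)

open Classical in
/-- The derivative of `extend`. -/
noncomputable def extendDeriv (G : MetricGraph X E) (ε : ℝ) (k : X → ℝ) (e : E) (x : ℝ) : ℝ :=
  if h : G.len e ≠ ⊤ then (k (G.target e h) - k (G.source e)) / (G.len e).toReal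
  else k (G.source e) * (Real.exp (-ε * x) * -ε)

variable {ε : ℝ} {k : X → ℝ}

theorem extend_end (h : G.EdgeEnd) : G.extend ε k h.edge h.pos = k h.vertex := by
  rcases h with e | ⟨e, h⟩
  · simp [extend, EdgeEnd.edge, EdgeEnd.pos, EdgeEnd.vertex]
  · have := (G.toReal_len_pos h).ne'
    change G.extend ε k e (G.len e).toReal = k (G.target e h)
    simp only [extend, dif_pos h]
    field_simp
    ring

theorem isGlued_extend : G.IsGlued (G.extend ε k) := fun h h' hv => by
  rw [extend_end, extend_end, hv]

theorem continuous_extend (e : E) : Continuous (G.extend ε k e) := by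
  unfold extend
  split_ifs <;> fun_prop

theorem continuous_extendDeriv (e : E) : Continuous (G.extendDeriv ε k e) := by
  unfold extendDeriv
  split_ifs <;> fun_prop

theorem hasDerivAt_extend (e : E) (x : ℝ) :
    HasDerivAt (G.extend ε k e) (G.extendDeriv ε k e x) x := by
  unfold extend extendDeriv
  split_ifs
  · rename_i h
    simpa using ((hasDerivAt_id x).const_mul
      ((k (G.target e h) - k (G.source e)) / (G.len e).toReal)).const_add (k (G.source e))
  · have h1 : HasDerivAt (fun x => -ε * x) (-ε) x := by
      simpa using (hasDerivAt_id x).const_mul (-ε)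
    exact h1.exp.const_mul _

theorem isPrimitiveOn_extend (e : E) :
    IsPrimitiveOn (G.interval e) (G.extend ε k e) (G.extendDeriv ε k e) :=
  IsPrimitiveOn.of_hasDerivAt (hasDerivAt_extend e) (continuous_extendDeriv e)

theorem extend_mem_Icc (hε : 0 ≤ ε) (hk : ∀ v, k v ∈ Icc (0 : ℝ) 1) {e : E} {x : ℝ}
    (hx : x ∈ G.interval e) : G.extend ε k e x ∈ Icc (0 : ℝ) 1 := by
  by_cases h : G.len e ≠ ⊤
  · have hl := G.toReal_len_pos h
    simp only [extend, dif_pos h]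
    rw [G.interval_of_ne_top h] at hx
    have hs0 : 0 ≤ x / (G.len e).toReal := div_nonneg hx.1 hl.le
    have hs1 : x / (G.len e).toReal ≤ 1 := (div_le_one hl).2 hx.2
    obtain ⟨h1, h2⟩ := hk (G.source e)
    obtain ⟨h3, h4⟩ := hk (G.target e h)
    rw [div_mul_eq_mul_div, mul_div_assoc]
    constructor <;> nlinarith
  · simp only [extend, dif_neg h]
    obtain ⟨h1, h2⟩ := hk (G.source e)
    have h3 : Real.exp (-ε * x) ≤ 1 := Real.exp_le_one_iff.2 (by nlinarith [hx.1])
    exact ⟨by positivity, mul_le_one₀ h2 (Real.exp_nonneg _) h3⟩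

/-- The decay rate on rays is `ε`, so the slope bound that `hkl` imposes on the finite edges holds
on the rays as well. -/
theorem abs_extendDeriv_le (hε : 0 ≤ ε) (hk : ∀ v, k v ∈ Icc (0 : ℝ) 1)
    (hkl : ∀ e, ∀ h : G.len e ≠ ⊤, |k (G.target e h) - k (G.source e)| ≤ ε * (G.len e).toReal)
    {e : E} {x : ℝ} (hx : x ∈ G.interval e) : |G.extendDeriv ε k e x| ≤ ε := by
  by_cases h : G.len e ≠ ⊤
  · have hl := G.toReal_len_pos h
    simp only [extendDeriv, dif_pos h]
    rw [abs_div, abs_of_pos hl, div_le_iff₀ hl]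
    exact hkl e h
  · simp only [extendDeriv, dif_neg h]
    obtain ⟨h1, h2⟩ := hk (G.source e)
    have h3 : Real.exp (-ε * x) ≤ 1 := Real.exp_le_one_iff.2 (by nlinarith [hx.1])
    rw [abs_mul, abs_mul, abs_of_nonneg h1, abs_of_nonneg (Real.exp_nonneg _), abs_neg,
      abs_of_nonneg hε]
    have h4 : Real.exp (-ε * x) * ε ≤ 1 * ε := mul_le_mul_of_nonneg_right h3 hε
    nlinarith [Real.exp_nonneg (-ε * x), mul_nonneg (Real.exp_nonneg (-ε * x)) hε]

theorem extend_eq_zero {e : E} (h : ∀ h : G.EdgeEnd, h.edge = e → k h.vertex = 0) (x : ℝ) :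
    G.extend ε k e x = 0 ∧ G.extendDeriv ε k e x = 0 := by
  have h1 : k (G.source e) = 0 := h (.start e) rfl
  unfold extend extendDeriv
  split_ifs with hl
  · have h2 : k (G.target e hl) = 0 := h (.finish e hl) rfl
    simp [h1, h2]
  · simp [h1]

theorem memLp_extend_edge (hε : 0 < ε) (e : E) :
    MeasureTheory.MemLp (G.extend ε k e) 2 (G.edgeMeasure e) ∧
      MeasureTheory.MemLp (G.extendDeriv ε k e) 2 (G.edgeMeasure e) := by
  by_cases h : G.len e ≠ ⊤
  · have key : ∀ f : ℝ → ℝ, Continuous f → MeasureTheory.MemLp f 2 (G.edgeMeasure e) := by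
      intro f hf
      rw [edgeMeasure, G.interval_of_ne_top h]
      obtain ⟨C, hC⟩ := isCompact_Icc.exists_bound_of_continuousOn
        (hf.continuousOn (s := Icc 0 (G.len e).toReal))
      exact MeasureTheory.MemLp.of_bound hf.aestronglyMeasurable C
        ((ae_restrict_iff' measurableSet_Icc).2 (Eventually.of_forall hC))
    exact ⟨key _ (continuous_extend e), key _ (continuous_extendDeriv e)⟩
  · have key : MeasureTheory.MemLp (fun x => Real.exp (-ε * x)) 2 (G.edgeMeasure e) := by
      rw [memLp_two_iff_integrable_sq_norm (by fun_prop), edgeMeasure,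
        G.interval_of_eq_top (not_not.1 h)]
      have h1 := (integrableOn_Ici_iff_integrableOn_Ioi (by simp)).2
        (exp_neg_integrableOn_Ioi 0 (mul_pos two_pos hε))
      refine h1.congr (Eventually.of_forall fun x => ?_)
      simp only [Real.norm_eq_abs, sq_abs]
      rw [← Real.exp_nat_mul]
      congr 1
      push_cast
      ring
    have h1 : G.extend ε k e = fun x => k (G.source e) * Real.exp (-ε * x) := by
      funext x
      simp [extend, dif_neg h]
    have h2 : G.extendDeriv ε k e = fun x => -ε * k (G.source e) * Real.exp (-ε * x) := by
      funext x
      simp only [extendDeriv, dif_neg h]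
      ring
    rw [h1, h2]
    exact ⟨key.const_mul _, key.const_mul _⟩

/-- A function that is square integrable on the edges and vanishes outside finitely many of them
is square integrable on the graph. -/
theorem memLp_of_finite_edges [Countable E] [NormedAddCommGroup F] {u : E → ℝ → F} {S : Set E}
    (hS : S.Finite) (hu : ∀ e, MeasureTheory.MemLp (u e) 2 (G.edgeMeasure e))
    (h0 : ∀ e, e ∉ S → u e =ᵐ[G.edgeMeasure e] 0) :
    MeasureTheory.MemLp (unc u) 2 G.graphMeasure := by
  rw [← memLp_two_iff]
  refine ⟨hu, (memℓp_gen_iff (by simp)).2 (summable_of_ne_finset_zero (s := hS.toFinset) ?_)⟩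
  intro e he
  rw [Finite.mem_toFinset] at he
  rw [eLpNorm_congr_ae (h0 e he)]
  simp

/-- Supplies test functions with prescribed values at the vertices. The exponential decay makes them
square integrable on the rays. -/
theorem isH1_extend [Countable E] (hε : 0 < ε)
    (hk : {e | ∃ h : G.EdgeEnd, h.edge = e ∧ k h.vertex ≠ 0}.Finite) :
    G.IsH1 (fun e x => (G.extend ε k e x : ℂ)) (fun e x => (G.extendDeriv ε k e x : ℂ)) := by
  have h0 : ∀ e, e ∉ {e | ∃ h : G.EdgeEnd, h.edge = e ∧ k h.vertex ≠ 0} → ∀ x,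
      G.extend ε k e x = 0 ∧ G.extendDeriv ε k e x = 0 := by
    intro e he
    refine extend_eq_zero fun h hh => ?_
    by_contra h1
    exact he ⟨h, hh, h1⟩
  refine ⟨fun h h' hv => by simp only [isGlued_extend h h' hv],
    fun e => (isPrimitiveOn_extend e).clm Complex.ofRealCLM, ?_, ?_⟩
  · exact memLp_of_finite_edges hk (fun e => (memLp_extend_edge hε e).1.ofReal)
      fun e he => Eventually.of_forall fun x => by simp [(h0 e he x).1]
  · exact memLp_of_finite_edges hk (fun e => (memLp_extend_edge hε e).2.ofReal)
      fun e he => Eventually.of_forall fun x => by simp [(h0 e he x).2]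

/-- Multiplication of a function in `H¹` by the extension of a function on the vertices. -/
theorem IsH1.extend_mul [Countable E] {u p : E → ℝ → ℂ} (hu : G.IsH1 u p) (hε : 0 ≤ ε)
    (hk : ∀ v, k v ∈ Icc (0 : ℝ) 1)
    (hkl : ∀ e, ∀ h : G.len e ≠ ⊤, |k (G.target e h) - k (G.source e)| ≤ ε * (G.len e).toReal) :
    G.IsH1 (fun e x => G.extend ε k e x * u e x)
      (fun e x => G.extend ε k e x * p e x + G.extendDeriv ε k e x * u e x) := by
  have hm : AEStronglyMeasurable (unc (G.extend ε k)) G.graphMeasure :=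
    G.aestronglyMeasurable_graphMeasure_iff.2 fun e => (continuous_extend e).aestronglyMeasurable
  have hm' : AEStronglyMeasurable (unc (G.extendDeriv ε k)) G.graphMeasure :=
    G.aestronglyMeasurable_graphMeasure_iff.2
      fun e => (continuous_extendDeriv e).aestronglyMeasurable
  have hb : ∀ᵐ q ∂G.graphMeasure, ‖((unc (G.extend ε k) q : ℝ) : ℂ)‖ ≤ 1 := by
    refine G.ae_graphMeasure_iff.2 fun e => ?_
    filter_upwards [ae_restrict_mem (G.measurableSet_interval e)] with x hx
    obtain ⟨h1, h2⟩ := extend_mem_Icc hε hk hx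
    rw [Complex.norm_real, Real.norm_of_nonneg h1]
    exact h2
  have hb' : ∀ᵐ q ∂G.graphMeasure, ‖((unc (G.extendDeriv ε k) q : ℝ) : ℂ)‖ ≤ ε := by
    refine G.ae_graphMeasure_iff.2 fun e => ?_
    filter_upwards [ae_restrict_mem (G.measurableSet_interval e)] with x hx
    rw [Complex.norm_real, Real.norm_eq_abs]
    exact abs_extendDeriv_le hε hk hkl hx
  have key : ∀ (c : (Σ _ : E, ℝ) → ℝ) (C : ℝ) (f : E → ℝ → ℂ),
      AEStronglyMeasurable c G.graphMeasure → (∀ᵐ q ∂G.graphMeasure, ‖(c q : ℂ)‖ ≤ C) →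
      MeasureTheory.MemLp (unc f) 2 G.graphMeasure →
      MeasureTheory.MemLp (fun q => (c q : ℂ) * unc f q) 2 G.graphMeasure := by
    intro c C f hc hC hf
    refine hf.of_le_mul (c := C) ((Complex.continuous_ofReal.comp_aestronglyMeasurable hc).mul hf.1)
      ?_
    filter_upwards [hC] with q hq
    rw [norm_mul]
    gcongr
  refine ⟨fun h h' hv => by simp only [isGlued_extend h h' hv, hu.glued h h' hv], fun e => ?_,
    key _ 1 _ hm hb hu.memLp, (key _ 1 _ hm hb hu.memLp_deriv).add (key _ ε _ hm' hb' hu.memLp)⟩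
  exact (isPrimitiveOn_extend e).clm Complex.ofRealCLM |>.smul (G.ordConnected_interval e)
    (hu.isPrimitiveOn e)

end MetricGraph

namespace MetricGraph

variable {X E F : Type*} {G : MetricGraph X E}

/-! ### Sobolev functions and weak derivatives -/

theorem MemSobolev.exists_isPrimitiveOn [NormedAddCommGroup F] [NormedSpace ℝ F] [CompleteSpace F]
    {p : ℝ≥0∞} (hp : 1 ≤ p) {u : E → ℝ → F} (h : G.MemSobolev 1 p u) :
    ∃ u' : E → ℝ → F, (∀ e, IsPrimitiveOn (G.interval e) (u e) (u' e)) ∧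
      G.MemLp p u ∧ G.MemLp p u' := by
  obtain ⟨⟨hc, -⟩, D, rfl, hD, hL⟩ := h
  exact ⟨D 1, fun e => HasWeakDeriv.isPrimitiveOn G (hD 0 one_pos e) (hc e) hp ((hL 1 le_rfl).1 e),
    hL 0 zero_le_one, hL 1 le_rfl⟩

theorem memSobolev_one_two_iff [Countable E] {u : E → ℝ → ℂ} :
    G.MemSobolev 1 2 u ↔ ∃ p, G.IsH1 u p := by
  constructor
  · intro h
    obtain ⟨p, h1, h2, h3⟩ := h.exists_isPrimitiveOn one_le_two
    exact ⟨p, h.1.2, h1, G.memLp_two_iff.1 h2, G.memLp_two_iff.1 h3⟩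
  · rintro ⟨p, h⟩
    refine ⟨⟨fun e => (h.isPrimitiveOn e).continuousOn_interval G, h.glued⟩,
      fun j => if j = 0 then u else p, rfl, fun j hj e => ?_, fun j hj => ?_⟩
    · obtain rfl : j = 0 := by omega
      exact (h.isPrimitiveOn e).hasWeakDeriv (G.ordConnected_interval e)
    · by_cases hj0 : j = 0
      · simpa [hj0] using G.memLp_two_iff.2 h.memLp
      · simpa [hj0] using G.memLp_two_iff.2 h.memLp_deriv

/-- `u` is in `H¹`, its derivative `p` is edgewise in `H¹`, and `q` is the second derivative. -/
structure IsH2 (G : MetricGraph X E) (u p q : E → ℝ → ℂ) : Prop where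
  isH1 : G.IsH1 u p
  isPrimitiveOn_deriv : ∀ e, IsPrimitiveOn (G.interval e) (p e) (q e)
  memLp_deriv_deriv : MeasureTheory.MemLp (unc q) 2 G.graphMeasure

/-- In `MemSobolev` the first derivative is fixed only up to null sets. It is replaced by its
absolutely continuous representative, whose values at the edge ends enter the Kirchhoff condition.
-/
theorem memSobolev_two_two_iff [Countable E] {u : E → ℝ → ℂ} :
    G.MemSobolev 2 2 u ↔ ∃ p q, G.IsH2 u p q := by
  constructor
  · rintro ⟨hc, D, rfl, hD, hL⟩
    have h1 : ∀ e, ∃ f, IsPrimitiveOn (G.interval e) f (D 2 e) ∧ D 1 e =ᵐ[G.edgeMeasure e] f :=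
      fun e => (hD 1 one_lt_two e).exists_isPrimitiveOn (G.ordConnected_interval e)
        (G.interior_interval_nonempty e)
        fun x hx y hy => G.intervalIntegrable_of_memLp one_le_two ((hL 2 le_rfl).1 e) hx hy
    choose p hp hDp using h1
    have hae : unc (D 1) =ᵐ[G.graphMeasure] unc p := G.ae_graphMeasure_iff.2 hDp
    refine ⟨p, D 2, ⟨hc.2, fun e => ?_, G.memLp_two_iff.1 (hL 0 zero_le_two), ?_⟩, hp,
      G.memLp_two_iff.1 (hL 2 le_rfl)⟩
    · exact (HasWeakDeriv.isPrimitiveOn G (hD 0 two_pos e) (hc.1 e) one_le_two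
        ((hL 1 one_le_two).1 e)).congr (G.ordConnected_interval e) (fun _ _ => rfl) (hDp e)
    · exact (G.memLp_two_iff.1 (hL 1 one_le_two)).ae_eq hae
  · rintro ⟨p, q, h⟩
    refine ⟨⟨fun e => (h.isH1.isPrimitiveOn e).continuousOn_interval G, h.isH1.glued⟩,
      fun j => if j = 0 then u else if j = 1 then p else q, rfl, fun j hj e => ?_, fun j hj => ?_⟩
    · obtain rfl | rfl : j = 0 ∨ j = 1 := by omega
      · exact (h.isH1.isPrimitiveOn e).hasWeakDeriv (G.ordConnected_interval e)
      · exact (h.isPrimitiveOn_deriv e).hasWeakDeriv (G.ordConnected_interval e)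
    · obtain rfl | rfl | rfl : j = 0 ∨ j = 1 ∨ j = 2 := by omega
      · exact G.memLp_two_iff.2 h.isH1.memLp
      · exact G.memLp_two_iff.2 h.isH1.memLp_deriv
      · exact G.memLp_two_iff.2 h.memLp_deriv_deriv

theorem HasWeakDeriv.weakDeriv_ae_eq {J : Set ℝ} (hJ : J.OrdConnected) {f g : ℝ → ℂ}
    (h : HasWeakDeriv J f g) : weakDeriv J f =ᵐ[volume.restrict J] g := by
  have h1 : WeaklyDifferentiable J f := ⟨g, h⟩
  rw [weakDeriv, dif_pos h1]
  exact h1.choose_spec.ae_eq hJ h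

theorem HasWeakDeriv.magDeriv_ae_eq {J : Set ℝ} (hJ : J.OrdConnected) {f f' g : ℝ → ℂ} {m : ℝ → ℝ}
    (h : HasWeakDeriv J f' g) (hf : f =ᵐ[volume.restrict J] f') :
    magDeriv J m f =ᵐ[volume.restrict J] fun x => Complex.I * g x + m x * f' x := by
  filter_upwards [(h.congr_ae hf.symm (EventuallyEq.refl _ _)).weakDeriv_ae_eq hJ, hf] with x h1 h2
  rw [magDeriv, h1, h2]

/-- After `g` is extended by constants beyond `[0, b]`, its primitive has a two-sided derivative
everywhere, which settles the end points too. -/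
theorem _root_.IsPrimitiveOn.hasDerivWithinAt [NormedAddCommGroup F] [NormedSpace ℝ F]
    [CompleteSpace F] {e : E} {f g : ℝ → F}
    (h : IsPrimitiveOn (G.interval e) f g) (hg : ContinuousOn g (G.interval e)) {x : ℝ}
    (hx : x ∈ G.interval e) : HasDerivWithinAt f (g x) (G.interval e) x := by
  obtain ⟨b, hb, hb0, hxb, hn⟩ := G.exists_Icc_mem_nhdsWithin hx
  have hsub : Icc 0 b ⊆ G.interval e := (G.ordConnected_interval e).out (G.zero_mem_interval e) hb
  set k : ℝ → F := IccExtend hb0.le ((Icc 0 b).domRestrict g) with hk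
  have hkc : Continuous k := (continuousOn_iff_continuous_domRestrict.1 (hg.mono hsub)).Icc_extend'
  have hkg : ∀ y ∈ Icc 0 b, k y = g y := fun y hy => by
    rw [hk, IccExtend_of_mem _ _ hy]
    rfl
  have h1 : HasDerivAt (fun y => (∫ t in (0 : ℝ)..y, k t) + f 0) (g x) x := by
    rw [← hkg x hxb]
    exact (intervalIntegral.integral_hasDerivAt_right (hkc.intervalIntegrable _ _)
      (hkc.stronglyMeasurableAtFilter _ _) hkc.continuousAt).add_const _
  have h2 : ∀ y ∈ Icc 0 b, f y = (∫ t in (0 : ℝ)..y, k t) + f 0 := by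
    intro y hy
    have h3 : ∫ t in (0 : ℝ)..y, k t = ∫ t in (0 : ℝ)..y, g t := by
      refine intervalIntegral.integral_congr fun t ht => hkg t ?_
      rw [uIcc_of_le hy.1] at ht
      exact ⟨ht.1, ht.2.trans hy.2⟩
    rw [h3, (h 0 (G.zero_mem_interval e) y (hsub hy)).2, sub_add_cancel]
  exact (h1.hasDerivWithinAt.congr h2 (h2 x hxb)).mono_of_mem_nhdsWithin hn

theorem _root_.IsPrimitiveOn.derivWithin_eq [NormedAddCommGroup F] [NormedSpace ℝ F]
    [CompleteSpace F] {e : E} {f g : ℝ → F}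
    (h : IsPrimitiveOn (G.interval e) f g) (hg : ContinuousOn g (G.interval e)) {x : ℝ}
    (hx : x ∈ G.interval e) : derivWithin f (G.interval e) x = g x := by
  refine (h.hasDerivWithinAt hg hx).derivWithin ?_
  exact uniqueDiffWithinAt_convex (convex_iff_ordConnected.2 (G.ordConnected_interval e))
    (G.interior_interval_nonempty e) (subset_closure hx)

/-! ### The potentials -/

/-- The norm of `L²(G)`. -/
noncomputable def norm2 (G : MetricGraph X E) (f : (Σ _ : E, ℝ) → ℂ) : ℝ :=
  (eLpNorm f 2 G.graphMeasure).toReal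

theorem norm2_nonneg (f : (Σ _ : E, ℝ) → ℂ) : 0 ≤ G.norm2 f := ENNReal.toReal_nonneg

theorem norm2_sq {f : (Σ _ : E, ℝ) → ℂ} (hf : MeasureTheory.MemLp f 2 G.graphMeasure) :
    G.norm2 f ^ 2 = ∫ q, ‖f q‖ ^ 2 ∂G.graphMeasure := by
  have h0 : 0 ≤ ∫ q, ‖f q‖ ^ 2 ∂G.graphMeasure := integral_nonneg fun x => by positivity
  rw [norm2, hf.eLpNorm_eq_integral_rpow_norm (by simp) (by simp)]
  simp only [ENNReal.toReal_ofNat, Real.rpow_ofNat]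
  rw [ENNReal.toReal_ofReal (by positivity), ← Real.rpow_natCast, ← Real.rpow_mul h0]
  simp

theorem norm2_add_le {f g : (Σ _ : E, ℝ) → ℂ} (hf : MeasureTheory.MemLp f 2 G.graphMeasure)
    (hg : MeasureTheory.MemLp g 2 G.graphMeasure) :
    G.norm2 (fun q => f q + g q) ≤ G.norm2 f + G.norm2 g := by
  unfold norm2
  rw [← ENNReal.toReal_add hf.2.ne hg.2.ne]
  exact ENNReal.toReal_mono (ENNReal.add_ne_top.2 ⟨hf.2.ne, hg.2.ne⟩)
    (eLpNorm_add_le hf.1 hg.1 one_le_two)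

theorem norm2_congr {f g : (Σ _ : E, ℝ) → ℂ} (h : f =ᵐ[G.graphMeasure] g) :
    G.norm2 f = G.norm2 g := by
  rw [norm2, norm2, eLpNorm_congr_ae h]

theorem norm2_le_mul {f : (Σ _ : E, ℝ) → ℂ} [NormedAddCommGroup F] {g : (Σ _ : E, ℝ) → F} {c : ℝ}
    (hc : 0 ≤ c) (hg : MeasureTheory.MemLp g 2 G.graphMeasure)
    (h : ∀ᵐ q ∂G.graphMeasure, ‖f q‖ ≤ c * ‖g q‖) :
    G.norm2 f ≤ c * (eLpNorm g 2 G.graphMeasure).toReal := by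
  rw [← ENNReal.toReal_ofReal hc, ← ENNReal.toReal_mul]
  exact ENNReal.toReal_mono (ENNReal.mul_ne_top ENNReal.ofReal_ne_top hg.2.ne)
    (eLpNorm_le_mul_eLpNorm_of_ae_le_mul h 2)

theorem exists_sup_norm_bound [Countable E] (hG : G.Connected) : ∃ C : ℝ, 0 ≤ C ∧
    ∀ u p : E → ℝ → ℂ, G.IsH1 u p → ∀ e, ∀ x ∈ G.interval e,
      ‖u e x‖ ≤ C * (G.norm2 (unc u) + G.norm2 (unc p)) := by
  obtain ⟨C, hC, h⟩ := exists_sup_bound hG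
  refine ⟨√C, Real.sqrt_nonneg _, fun u p hu e x hx => ?_⟩
  have h1 := h u p hu e x hx
  rw [← norm2_sq hu.memLp, ← norm2_sq hu.memLp_deriv] at h1
  have h2 := norm2_nonneg (G := G) (unc u)
  have h3 := norm2_nonneg (G := G) (unc p)
  refine abs_le_of_sq_le_sq' ?_ (by positivity) |>.2
  rw [mul_pow, Real.sq_sqrt hC]
  refine h1.trans (mul_le_mul_of_nonneg_left ?_ hC)
  nlinarith [mul_nonneg h2 h3]

/-- The `L²` part of `V` is paired with the supremum of `f`, the `L^∞` part with the `L²` norm of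
`f`. For `f` in `H¹` both are under control. -/
theorem IsElectricPotential.exists_mul_bound [Countable E] {V : E → ℝ → ℝ}
    (hV : G.IsElectricPotential V) : ∃ K : ℝ, 0 ≤ K ∧ ∀ (f : (Σ _ : E, ℝ) → ℂ) (B : ℝ), 0 ≤ B →
      MeasureTheory.MemLp f 2 G.graphMeasure → (∀ᵐ q ∂G.graphMeasure, ‖f q‖ ≤ B) →
      MeasureTheory.MemLp (fun q => (V q.1 q.2 : ℂ) * f q) 2 G.graphMeasure ∧
      G.norm2 (fun q => (V q.1 q.2 : ℂ) * f q) ≤ K * (B + G.norm2 f) := by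
  obtain ⟨V₁, V₂, h1, h2, h⟩ := hV
  have m1 := G.memLp_two_iff.1 h1
  have m2 := MemLp.memLp_top G h2
  set C := (eLpNorm (unc V₂) ∞ G.graphMeasure).toReal with hC
  have hC2 : ∀ᵐ q ∂G.graphMeasure, ‖unc V₂ q‖ ≤ C := by
    filter_upwards [ae_le_eLpNormEssSup (f := unc V₂) (μ := G.graphMeasure)] with q hq
    rw [← eLpNorm_exponent_top, ← ofReal_norm] at hq
    exact (ENNReal.ofReal_le_iff_le_toReal m2.2.ne).1 hq
  set K₁ := (eLpNorm (unc V₁) 2 G.graphMeasure).toReal with hK₁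
  have hC0 : 0 ≤ C := ENNReal.toReal_nonneg
  have hK0 : 0 ≤ K₁ := ENNReal.toReal_nonneg
  refine ⟨K₁ + C, by positivity, fun f B hB hf hfB => ?_⟩
  have b1 : ∀ᵐ q ∂G.graphMeasure, ‖(V₁ q.1 q.2 : ℂ) * f q‖ ≤ B * ‖unc V₁ q‖ := by
    filter_upwards [hfB] with q hq
    rw [norm_mul, Complex.norm_real, mul_comm]
    gcongr
  have b2 : ∀ᵐ q ∂G.graphMeasure, ‖(V₂ q.1 q.2 : ℂ) * f q‖ ≤ C * ‖f q‖ := by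
    filter_upwards [hC2] with q hq
    rw [norm_mul, Complex.norm_real]
    gcongr
  have l1 : MeasureTheory.MemLp (fun q => (V₁ q.1 q.2 : ℂ) * f q) 2 G.graphMeasure :=
    m1.of_le_mul ((Complex.continuous_ofReal.comp_aestronglyMeasurable m1.1).mul hf.1) b1
  have l2 : MeasureTheory.MemLp (fun q => (V₂ q.1 q.2 : ℂ) * f q) 2 G.graphMeasure :=
    hf.of_le_mul ((Complex.continuous_ofReal.comp_aestronglyMeasurable m2.1).mul hf.1) b2
  have hae : (fun q => (V₁ q.1 q.2 : ℂ) * f q + (V₂ q.1 q.2 : ℂ) * f q) =ᵐ[G.graphMeasure]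
      fun q => (V q.1 q.2 : ℂ) * f q := by
    filter_upwards [(G.ae_graphMeasure_iff (p := fun q => V q.1 q.2 = V₁ q.1 q.2 + V₂ q.1 q.2)).2 h]
      with q hq
    simp only [hq]
    push_cast
    ring
  refine ⟨(l1.add l2).ae_eq hae, ?_⟩
  rw [← norm2_congr hae]
  refine (norm2_add_le l1 l2).trans ?_
  have n1 := norm2_le_mul hB m1 b1
  have n2 := norm2_le_mul hC0 hf b2
  rw [← hK₁] at n1
  change G.norm2 _ ≤ C * G.norm2 f at n2
  nlinarith [mul_nonneg hC0 hB, mul_nonneg hK0 (norm2_nonneg (G := G) f)]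

/-- The `H¹` part of `M` is bounded by the Sobolev embedding. The derivative of `M` lies in `L² +
L^∞` and can therefore be treated like an electric potential. -/
theorem IsMagneticPotential.exists_isPrimitiveOn [Countable E] (hG : G.Connected) {M : E → ℝ → ℝ}
    (hM : G.IsMagneticPotential M) : ∃ M' : E → ℝ → ℝ,
      (∀ e, IsPrimitiveOn (G.interval e) (M e) (M' e)) ∧ G.IsElectricPotential M' ∧
      ∃ C : ℝ, 0 ≤ C ∧ ∀ e, ∀ x ∈ G.interval e, |M e x| ≤ C := by
  obtain ⟨M₁, M₂, h1, h2, h⟩ := hM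
  obtain ⟨N₁, p1, l1, l1'⟩ := h1.exists_isPrimitiveOn one_le_two
  obtain ⟨N₂, p2, l2, l2'⟩ := h2.exists_isPrimitiveOn le_top
  have hH1 : G.IsH1 (fun e x => (M₁ e x : ℂ)) (fun e x => (N₁ e x : ℂ)) :=
    ⟨fun k k' hv => by simp only [h1.1.2 k k' hv], fun e => (p1 e).clm Complex.ofRealCLM,
      (G.memLp_two_iff.1 l1).ofReal, (G.memLp_two_iff.1 l1').ofReal⟩
  obtain ⟨C, hC, hb⟩ := exists_sup_norm_bound hG
  have m2 := MemLp.memLp_top G l2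
  set C₁ := C * (G.norm2 (unc fun e x => (M₁ e x : ℂ)) + G.norm2 (unc fun e x => (N₁ e x : ℂ)))
  set C₂ := (eLpNorm (unc M₂) ∞ G.graphMeasure).toReal with hC₂
  have hb2 : ∀ᵐ q ∂G.graphMeasure, ‖unc M₂ q‖ ≤ C₂ := by
    filter_upwards [ae_le_eLpNormEssSup (f := unc M₂) (μ := G.graphMeasure)] with q hq
    rw [← eLpNorm_exponent_top, ← ofReal_norm] at hq
    exact (ENNReal.ofReal_le_iff_le_toReal m2.2.ne).1 hq
  -- The bound is known almost everywhere; it says that the continuous functions `min |M₂| C₂` and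
  -- `|M₂|` agree, hence it holds at every point.
  have hb2' : ∀ e, ∀ x ∈ G.interval e, |M₂ e x| ≤ C₂ := by
    intro e x hx
    have hc := ((p2 e).continuousOn_interval G).abs
    have := G.eq_of_ae_eq_of_continuousOn (hc.inf continuousOn_const) hc
      ((G.ae_graphMeasure_iff.1 hb2 e).mono fun x hx => inf_eq_left.2 hx) x hx
    exact inf_eq_left.1 this
  refine ⟨fun e x => N₁ e x + N₂ e x, fun e => ((p1 e).add (p2 e)).congr (G.ordConnected_interval e)
    (fun x hx => (h e x hx).symm) (EventuallyEq.refl _ _),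
    ⟨N₁, N₂, l1', l2', fun e => Eventually.of_forall fun x => rfl⟩, C₁ + C₂, ?_, fun e x hx => ?_⟩
  · have := norm2_nonneg (G := G) (unc fun e x => (M₁ e x : ℂ))
    have := norm2_nonneg (G := G) (unc fun e x => (N₁ e x : ℂ))
    have : 0 ≤ C₂ := ENNReal.toReal_nonneg
    positivity
  · rw [h e x hx]
    have := hb _ _ hH1 e x hx
    rw [Complex.norm_real, Real.norm_eq_abs] at this
    exact (abs_add_le _ _).trans (add_le_add this (hb2' e x hx))

/-! ### Green's formula -/

theorem IsH1.isPrimitiveOn_conj_mul {e : E} {z ζ v r : ℝ → ℂ}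
    (hz : IsPrimitiveOn (G.interval e) z ζ) (hv : IsPrimitiveOn (G.interval e) v r) :
    IsPrimitiveOn (G.interval e) (fun x => conj (z x) * v x)
      (fun x => conj (z x) * r x + conj (ζ x) * v x) :=
  (hz.clm Complex.conjCLE.toContinuousLinearMap).smul (G.ordConnected_interval e) hv

theorem integrable_conj_mul {f g : (Σ _ : E, ℝ) → ℂ} (hf : MeasureTheory.MemLp f 2 G.graphMeasure)
    (hg : MeasureTheory.MemLp g 2 G.graphMeasure) :
    Integrable (fun q => conj (f q) * g q) G.graphMeasure :=
  hf.star.integrable_mul hg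

/-- Integration by parts against a function in `H¹`, with the boundary terms at the vertices. -/
theorem IsH1.integral_eq_neg_finsum_ends [Countable E] {z ζ v r : E → ℝ → ℂ}
    (hz : ∀ e, IsPrimitiveOn (G.interval e) (z e) (ζ e))
    (hz2 : MeasureTheory.MemLp (unc z) 2 G.graphMeasure)
    (hζ2 : MeasureTheory.MemLp (unc ζ) 2 G.graphMeasure) (hv : G.IsH1 v r)
    (hfin : {e | ∃ h : G.EdgeEnd, h.edge = e ∧ v h.edge h.pos ≠ 0}.Finite) :
    ∫ q, conj (unc z q) * unc r q + conj (unc ζ q) * unc v q ∂G.graphMeasure =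
      -∑ᶠ h : G.EdgeEnd, (h.sign : ℂ) * (conj (z h.edge h.pos) * v h.edge h.pos) := by
  refine integral_deriv_eq_neg_finsum_ends (f := fun e x => conj (z e x) * v e x)
    (f' := fun e x => conj (z e x) * r e x + conj (ζ e x) * v e x)
    (fun e => IsH1.isPrimitiveOn_conj_mul (hz e) (hv.isPrimitiveOn e))
    (integrable_conj_mul hz2 hv.memLp)
    ((integrable_conj_mul hz2 hv.memLp_deriv).add (integrable_conj_mul hζ2 hv.memLp)) ?_
  refine hfin.subset ?_
  rintro e ⟨h, he, hh⟩
  exact ⟨h, he, right_ne_zero_of_mul hh⟩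

/-- A cutoff function on the vertices. -/
noncomputable def vertexCutoff (G : MetricGraph X E) (p : G.Point) (ε : ℝ) (v : X) : ℝ :=
  max 0 (1 - ε * vertexDist p v)

theorem vertexCutoff_mem_Icc {p : G.Point} {ε : ℝ} (hε : 0 ≤ ε) (v : X) :
    G.vertexCutoff p ε v ∈ Icc (0 : ℝ) 1 := by
  refine ⟨le_max_left _ _, max_le zero_le_one ?_⟩
  have := mul_nonneg hε (vertexDist_nonneg p v)
  linarith

theorem abs_vertexCutoff_sub_le (hG : G.Connected) {p : G.Point} {ε : ℝ} (hε : 0 ≤ ε) (e : E)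
    (h : G.len e ≠ ⊤) : |G.vertexCutoff p ε (G.target e h) - G.vertexCutoff p ε (G.source e)| ≤
      ε * (G.len e).toReal := by
  unfold vertexCutoff
  have h0 : 0 ≤ ε * (G.len e).toReal := mul_nonneg hε ENNReal.toReal_nonneg
  refine (abs_max_sub_max_le_max _ _ _ _).trans (max_le (by simpa using h0) ?_)
  have h2 : 1 - ε * vertexDist p (G.target e h) - (1 - ε * vertexDist p (G.source e)) =
      -(ε * (vertexDist p (G.target e h) - vertexDist p (G.source e))) := by ring
  rw [h2, abs_neg, abs_mul, abs_of_nonneg hε]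
  exact mul_le_mul_of_nonneg_left (abs_vertexDist_sub_le hG p e h) hε

theorem finite_vertexCutoff_ne_zero (hG : G.Connected) (hfin : G.LocallyFinite) {p : G.Point}
    {ε : ℝ} (hε : 0 < ε) :
    {e | ∃ h : G.EdgeEnd, h.edge = e ∧ G.vertexCutoff p ε h.vertex ≠ 0}.Finite := by
  refine (finite_edges_of_vertexDist_le hG hfin p ε⁻¹).subset ?_
  rintro e ⟨h, he, hh⟩
  refine ⟨h, he, ?_⟩
  by_contra h1
  rw [not_le, inv_lt_iff_one_lt_mul₀ hε] at h1
  refine hh (max_eq_left ?_)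
  linarith

theorem tendsto_vertexCutoff {p : G.Point} {ε : ℕ → ℝ} (hε : Tendsto ε atTop (𝓝 0)) (v : X) :
    Tendsto (fun n => G.vertexCutoff p (ε n) v) atTop (𝓝 1) := by
  have h1 : Tendsto (fun n => max 0 (1 - ε n * vertexDist p v)) atTop
      (𝓝 (max 0 (1 - 0 * vertexDist p v))) :=
    tendsto_const_nhds.max (tendsto_const_nhds.sub (hε.mul_const _))
  simpa [vertexCutoff] using h1

theorem tendsto_extend {ε : ℕ → ℝ} {k : ℕ → X → ℝ} (hε : Tendsto ε atTop (𝓝 0))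
    (hk : ∀ v, Tendsto (fun n => k n v) atTop (𝓝 1)) (e : E) (x : ℝ) :
    Tendsto (fun n => G.extend (ε n) (k n) e x) atTop (𝓝 1) := by
  unfold extend
  split_ifs with h
  · have h1 := (hk (G.source e)).add
      ((((hk (G.target e h)).sub (hk (G.source e))).div_const (G.len e).toReal).mul_const x)
    simpa using h1
  · have h1 : Tendsto (fun n => Real.exp (-ε n * x)) atTop (𝓝 (Real.exp (-0 * x))) :=
      (Real.continuous_exp.tendsto _).comp (hε.neg.mul_const x)
    simpa using (hk (G.source e)).mul h1

/-- Green's formula: there are no boundary terms if the Kirchhoff condition holds. -/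
theorem IsH1.integral_eq_zero_of_kirchhoff [Countable E] (hG : G.Connected) (hfin : G.LocallyFinite)
    {z ζ v r : E → ℝ → ℂ} (hz : ∀ e, IsPrimitiveOn (G.interval e) (z e) (ζ e))
    (hz2 : MeasureTheory.MemLp (unc z) 2 G.graphMeasure)
    (hζ2 : MeasureTheory.MemLp (unc ζ) 2 G.graphMeasure)
    (hK : ∀ x : X, ∑ᶠ (h : G.EdgeEnd) (_ : h.vertex = x), (h.sign : ℂ) * z h.edge h.pos = 0)
    (hv : G.IsH1 v r) :
    ∫ q, conj (unc z q) * unc r q + conj (unc ζ q) * unc v q ∂G.graphMeasure = 0 := by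
  obtain ⟨p⟩ := hG.1
  -- `v` is multiplied by cutoffs `χ n` of slope at most `ε n` that are nonzero at the ends of only
  -- finitely many edges. They need not have compact support on a ray, since integrability alone
  -- excludes a boundary term at infinity.
  set ε : ℕ → ℝ := fun n => 1 / ((n : ℝ) + 1) with hε
  have hε0 : ∀ n, 0 < ε n := fun n => by positivity
  have hε1 : ∀ n, ε n ≤ 1 := fun n => by
    rw [hε]
    exact div_le_one_of_le₀ (by linarith [n.cast_nonneg (α := ℝ)]) (by positivity)
  have hεt : Tendsto ε atTop (𝓝 0) := tendsto_one_div_add_atTop_nhds_zero_nat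
  set χ : ℕ → E → ℝ → ℝ := fun n => G.extend (ε n) (G.vertexCutoff p (ε n)) with hχ
  set χ' : ℕ → E → ℝ → ℝ := fun n => G.extendDeriv (ε n) (G.vertexCutoff p (ε n)) with hχ'
  have hχv : ∀ n, G.IsH1 (fun e x => χ n e x * v e x)
      (fun e x => χ n e x * r e x + χ' n e x * v e x) := fun n =>
    hv.extend_mul (hε0 n).le (vertexCutoff_mem_Icc (hε0 n).le)
      (fun e h => abs_vertexCutoff_sub_le hG (hε0 n).le e h)
  have hzero : ∀ n, ∫ q, conj (unc z q) * (χ n q.1 q.2 * unc r q + χ' n q.1 q.2 * unc v q) +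
      conj (unc ζ q) * (χ n q.1 q.2 * unc v q) ∂G.graphMeasure = 0 := by
    intro n
    have hS : {e | ∃ h : G.EdgeEnd, h.edge = e ∧
        (χ n h.edge h.pos * v h.edge h.pos : ℂ) ≠ 0}.Finite := by
      refine (finite_vertexCutoff_ne_zero hG hfin (p := p) (hε0 n)).subset ?_
      rintro e ⟨h, he, hh⟩
      refine ⟨h, he, ?_⟩
      have h1 := left_ne_zero_of_mul hh
      simp only [hχ, extend_end] at h1
      exact_mod_cast h1
    have h1 := IsH1.integral_eq_neg_finsum_ends hz hz2 hζ2 (hχv n) hS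
    rw [finsum_ends_eq_zero (hχv n).glued hK hS, neg_zero] at h1
    exact h1
  have hlim : Tendsto (fun n => ∫ q, conj (unc z q) *
      (χ n q.1 q.2 * unc r q + χ' n q.1 q.2 * unc v q) +
      conj (unc ζ q) * (χ n q.1 q.2 * unc v q) ∂G.graphMeasure) atTop
      (𝓝 (∫ q, conj (unc z q) * unc r q + conj (unc ζ q) * unc v q ∂G.graphMeasure)) := by
    -- Both `χ n` and `χ' n` are at most `1` in absolute value, which gives the dominating function;
    -- pointwise `χ n` tends to `1` and `χ' n` to `0`.
    refine tendsto_integral_of_dominated_convergence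
      (fun q => ‖conj (unc z q) * unc r q‖ + ‖conj (unc z q) * unc v q‖ +
        ‖conj (unc ζ q) * unc v q‖) (fun n => ?_)
      (((integrable_conj_mul hz2 hv.memLp_deriv).norm.add
        (integrable_conj_mul hz2 hv.memLp).norm).add (integrable_conj_mul hζ2 hv.memLp).norm)
      (fun n => ?_) ?_
    · exact ((integrable_conj_mul hz2 (hχv n).memLp_deriv).add
        (integrable_conj_mul hζ2 (hχv n).memLp)).aestronglyMeasurable
    · refine G.ae_graphMeasure_iff.2 fun e => ?_
      filter_upwards [ae_restrict_mem (G.measurableSet_interval e)] with x hx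
      obtain ⟨h1, h2⟩ := extend_mem_Icc (hε0 n).le
        (vertexCutoff_mem_Icc (p := p) (hε0 n).le) hx
      have h3 := (abs_extendDeriv_le (hε0 n).le (vertexCutoff_mem_Icc (p := p) (hε0 n).le)
        (fun e h => abs_vertexCutoff_sub_le hG (hε0 n).le e h) hx).trans (hε1 n)
      have h1' : ‖(χ n e x : ℂ)‖ ≤ 1 := by
        rw [Complex.norm_real, Real.norm_of_nonneg h1]
        exact h2
      have h3' : ‖(χ' n e x : ℂ)‖ ≤ 1 := by
        rw [Complex.norm_real]
        exact h3
      have key : conj (z e x) * (χ n e x * r e x + χ' n e x * v e x) +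
          conj (ζ e x) * (χ n e x * v e x) = χ n e x * (conj (z e x) * r e x) +
          χ' n e x * (conj (z e x) * v e x) + χ n e x * (conj (ζ e x) * v e x) := by ring
      simp only [unc]
      rw [key]
      refine (norm_add₃_le).trans ?_
      rw [norm_mul (χ n e x : ℂ), norm_mul (χ' n e x : ℂ), norm_mul (χ n e x : ℂ)]
      gcongr <;> exact mul_le_of_le_one_left (norm_nonneg _) ‹_›
    · refine G.ae_graphMeasure_iff.2 fun e => ?_
      filter_upwards [ae_restrict_mem (G.measurableSet_interval e)] with x hx
      have h1 : Tendsto (fun n => (χ n e x : ℂ)) atTop (𝓝 1) :=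
        (Complex.continuous_ofReal.tendsto' 1 1 Complex.ofReal_one).comp
          (tendsto_extend hεt (fun v => tendsto_vertexCutoff hεt v) e x)
      have h2 : Tendsto (fun n => (χ' n e x : ℂ)) atTop (𝓝 0) := by
        refine squeeze_zero_norm (fun n => ?_) hεt
        rw [Complex.norm_real]
        exact abs_extendDeriv_le (hε0 n).le (vertexCutoff_mem_Icc (p := p) (hε0 n).le)
          (fun e h => abs_vertexCutoff_sub_le hG (hε0 n).le e h) hx
      have h3 := (((h1.mul_const (r e x)).add (h2.mul_const (v e x))).const_mul
        (conj (z e x))).add ((h1.mul_const (v e x)).const_mul (conj (ζ e x)))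
      simpa using h3
  simp_rw [hzero] at hlim
  exact (tendsto_nhds_unique hlim tendsto_const_nhds)

/-! ### The magnetic derivative and the form -/

/-- `M` is a bounded magnetic potential with derivative `M'`, and `V` an electric potential. -/
structure IsPotential (G : MetricGraph X E) (M M' V : E → ℝ → ℝ) : Prop where
  isPrimitiveOn : ∀ e, IsPrimitiveOn (G.interval e) (M e) (M' e)
  bounded : ∃ C : ℝ, 0 ≤ C ∧ ∀ e, ∀ x ∈ G.interval e, |M e x| ≤ C
  isElectricPotential_deriv : G.IsElectricPotential M'
  isElectricPotential : G.IsElectricPotential V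

/-- The magnetic derivative of a function `u` with derivative `p`. -/
def mag (M : E → ℝ → ℝ) (u p : E → ℝ → ℂ) (e : E) (x : ℝ) : ℂ :=
  Complex.I * p e x + M e x * u e x

/-- The derivative of the magnetic derivative. -/
def magD (M M' : E → ℝ → ℝ) (u p q : E → ℝ → ℂ) (e : E) (x : ℝ) : ℂ :=
  Complex.I * q e x + (M e x * p e x + M' e x * u e x)

theorem ae_norm_le [Countable E] {u : E → ℝ → ℂ} {C : ℝ}
    (hC : ∀ e, ∀ x ∈ G.interval e, ‖u e x‖ ≤ C) : ∀ᵐ q ∂G.graphMeasure, ‖unc u q‖ ≤ C :=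
  G.ae_graphMeasure_iff.2 fun e => by
    filter_upwards [ae_restrict_mem (G.measurableSet_interval e)] with x hx using hC e x hx

theorem IsElectricPotential.memLp_mul [Countable E] (hG : G.Connected) {V : E → ℝ → ℝ}
    (hV : G.IsElectricPotential V) {u p : E → ℝ → ℂ} (hu : G.IsH1 u p) :
    MeasureTheory.MemLp (fun q => (V q.1 q.2 : ℂ) * unc u q) 2 G.graphMeasure := by
  obtain ⟨K, -, hK⟩ := hV.exists_mul_bound
  obtain ⟨C, hC, hb⟩ := exists_sup_norm_bound hG
  exact (hK _ _ (mul_nonneg hC (add_nonneg (norm2_nonneg _) (norm2_nonneg _))) hu.memLp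
    (ae_norm_le (hb u p hu))).1

namespace IsPotential

variable [Countable E] {M M' V : E → ℝ → ℝ} (hP : G.IsPotential M M' V)

include hP

theorem aestronglyMeasurable : AEStronglyMeasurable (unc M) G.graphMeasure :=
  G.aestronglyMeasurable_graphMeasure_iff.2 fun e =>
    ((hP.isPrimitiveOn e).continuousOn_interval G).aestronglyMeasurable (G.measurableSet_interval e)

theorem exists_mul_bound : ∃ C : ℝ, 0 ≤ C ∧ ∀ f : (Σ _ : E, ℝ) → ℂ,
    MeasureTheory.MemLp f 2 G.graphMeasure →
      MeasureTheory.MemLp (fun q => (M q.1 q.2 : ℂ) * f q) 2 G.graphMeasure ∧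
      G.norm2 (fun q => (M q.1 q.2 : ℂ) * f q) ≤ C * G.norm2 f := by
  obtain ⟨C, hC, hb⟩ := hP.bounded
  have h1 : ∀ f : (Σ _ : E, ℝ) → ℂ, ∀ᵐ q ∂G.graphMeasure, ‖(M q.1 q.2 : ℂ) * f q‖ ≤ C * ‖f q‖ := by
    intro f
    refine G.ae_graphMeasure_iff.2 fun e => ?_
    filter_upwards [ae_restrict_mem (G.measurableSet_interval e)] with x hx
    rw [norm_mul, Complex.norm_real]
    exact mul_le_mul_of_nonneg_right (hb e x hx) (norm_nonneg _)
  exact ⟨C, hC, fun f hf => ⟨hf.of_le_mul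
    ((Complex.continuous_ofReal.comp_aestronglyMeasurable hP.aestronglyMeasurable).mul hf.1) (h1 f),
    norm2_le_mul hC hf (h1 f)⟩⟩

theorem memLp_mul {f : (Σ _ : E, ℝ) → ℂ} (hf : MeasureTheory.MemLp f 2 G.graphMeasure) :
    MeasureTheory.MemLp (fun q => (M q.1 q.2 : ℂ) * f q) 2 G.graphMeasure := by
  obtain ⟨C, -, h⟩ := hP.exists_mul_bound
  exact (h f hf).1

theorem memLp_mag {u p : E → ℝ → ℂ} (hu : G.IsH1 u p) :
    MeasureTheory.MemLp (unc (mag M u p)) 2 G.graphMeasure :=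
  (hu.memLp_deriv.const_mul Complex.I).add (hP.memLp_mul hu.memLp)

theorem memLp_magD (hG : G.Connected) {u p q : E → ℝ → ℂ} (hu : G.IsH2 u p q) :
    MeasureTheory.MemLp (unc (magD M M' u p q)) 2 G.graphMeasure :=
  (hu.memLp_deriv_deriv.const_mul Complex.I).add ((hP.memLp_mul hu.isH1.memLp_deriv).add
    (hP.isElectricPotential_deriv.memLp_mul hG hu.isH1))

omit [Countable E] in
theorem isPrimitiveOn_mul {e : E} {u p : ℝ → ℂ} (hu : IsPrimitiveOn (G.interval e) u p) :
    IsPrimitiveOn (G.interval e) (fun x => (M e x : ℂ) * u x)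
      (fun x => (M e x : ℂ) * p x + M' e x * u x) :=
  ((hP.isPrimitiveOn e).clm Complex.ofRealCLM).smul (G.ordConnected_interval e) hu

omit [Countable E] in
theorem isPrimitiveOn_mag {u p q : E → ℝ → ℂ} (hu : G.IsH2 u p q) (e : E) :
    IsPrimitiveOn (G.interval e) (mag M u p e) (magD M M' u p q e) :=
  ((hu.isPrimitiveOn_deriv e).clm (Complex.I • ContinuousLinearMap.id ℝ ℂ)).add
    (hP.isPrimitiveOn_mul (hu.isH1.isPrimitiveOn e))

theorem integrable_form (hG : G.Connected) {u v : E → ℝ → ℂ} {p r z : E → ℝ → ℂ}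
    (hu : G.IsH1 u p) (hv : G.IsH1 v r) (hz : MeasureTheory.MemLp (unc z) 2 G.graphMeasure) :
    Integrable (fun q => conj (unc z q) * unc (mag M v r) q +
      (V q.1 q.2 : ℂ) * conj (unc u q) * unc v q) G.graphMeasure := by
  refine (integrable_conj_mul hz (hP.memLp_mag hv)).add ?_
  refine (integrable_conj_mul hu.memLp (hP.isElectricPotential.memLp_mul hG hv)).congr
    (Eventually.of_forall fun q => ?_)
  simp only
  ring

/-- The form as an integral involving the weak second derivatives, up to an expression that
vanishes by integration by parts. -/
theorem form_sub_eq (hG : G.Connected) {u p v r z ζ : E → ℝ → ℂ} (hu : G.IsH1 u p)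
    (hv : G.IsH1 v r) (hz : MeasureTheory.MemLp (unc z) 2 G.graphMeasure)
    (hζ : MeasureTheory.MemLp (unc ζ) 2 G.graphMeasure) {f : (Σ _ : E, ℝ) → ℂ}
    (hf : ∀ᵐ q ∂G.graphMeasure, f q = Complex.I * unc ζ q + M q.1 q.2 * unc z q +
      V q.1 q.2 * unc u q) :
    ∫ q, conj (unc z q) * unc (mag M v r) q + (V q.1 q.2 : ℂ) * conj (unc u q) * unc v q
      ∂G.graphMeasure - ∫ q, conj (f q) * unc v q ∂G.graphMeasure =
      Complex.I * ∫ q, conj (unc z q) * unc r q + conj (unc ζ q) * unc v q ∂G.graphMeasure := by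
  -- Nothing here says that `ζ` is the derivative of `z`: the identity is pointwise algebra, in
  -- which the terms with the real functions `M` and `V` cancel. So it can be used both for Green's
  -- formula and to find the weak derivative of `z`.
  have hf2 : MeasureTheory.MemLp f 2 G.graphMeasure :=
    (((hζ.const_mul Complex.I).add (hP.memLp_mul hz)).add
      (hP.isElectricPotential.memLp_mul hG hu)).ae_eq (hf.mono fun q hq => hq.symm)
  rw [← integral_sub (hP.integrable_form hG hu hv hz) (integrable_conj_mul hf2 hv.memLp),
    ← integral_const_mul]
  refine integral_congr_ae ?_
  filter_upwards [hf] with q hq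
  rw [hq]
  simp only [mag, unc, map_add, map_mul, Complex.conj_I, Complex.conj_ofReal]
  ring

/-- The form of an element of the operator domain and an element of `H¹`. -/
theorem form_eq_of_kirchhoff (hG : G.Connected) (hfin : G.LocallyFinite) {u p q v r : E → ℝ → ℂ}
    (hu : G.IsH2 u p q) (hK : ∀ x : X, ∑ᶠ (h : G.EdgeEnd) (_ : h.vertex = x),
      (h.sign : ℂ) * mag M u p h.edge h.pos = 0) (hv : G.IsH1 v r) {f : (Σ _ : E, ℝ) → ℂ}
    (hf : ∀ᵐ y ∂G.graphMeasure, f y = Complex.I * unc (magD M M' u p q) y +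
      M y.1 y.2 * unc (mag M u p) y + V y.1 y.2 * unc u y) :
    ∫ y, conj (unc (mag M u p) y) * unc (mag M v r) y +
      (V y.1 y.2 : ℂ) * conj (unc u y) * unc v y ∂G.graphMeasure =
      ∫ y, conj (f y) * unc v y ∂G.graphMeasure := by
  rw [← sub_eq_zero, hP.form_sub_eq hG hu.isH1 hv (hP.memLp_mag hu.isH1) (hP.memLp_magD hG hu) hf,
    IsH1.integral_eq_zero_of_kirchhoff hG hfin (hP.isPrimitiveOn_mag hu) (hP.memLp_mag hu.isH1)
      (hP.memLp_magD hG hu) hK hv, mul_zero]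

end IsPotential

/-! ### Regularity of weak solutions -/

open Classical in
/-- A function on one edge, extended by zero to the other edges. -/
noncomputable def onEdge (e : E) (f : ℝ → ℂ) (e' : E) (x : ℝ) : ℂ := if e' = e then f x else 0

theorem onEdge_self (e : E) (f : ℝ → ℂ) : onEdge e f e = f := by
  funext x
  simp [onEdge]

theorem onEdge_of_ne {e e' : E} (h : e' ≠ e) (f : ℝ → ℂ) : onEdge e f e' = 0 := by
  funext x
  simp [onEdge, h]

theorem end_notMem_interior (h : G.EdgeEnd) : h.pos ∉ interior (G.interval h.edge) := by
  rcases h with e | ⟨e, h⟩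
  · by_cases hl : G.len e = ⊤
    · simp [EdgeEnd.edge, EdgeEnd.pos, G.interval_of_eq_top hl]
    · simp [EdgeEnd.edge, EdgeEnd.pos, G.interval_of_ne_top hl]
  · simp [EdgeEnd.edge, EdgeEnd.pos, G.interval_of_ne_top h]

/-- These test functions see only the interior of one edge; they vanish at all edge ends, so gluing
imposes nothing. -/
theorem isH1_onEdge [Countable E] {e : E} {φ : ℝ → ℝ} (hφ : ContDiff ℝ (⊤ : ℕ∞) φ)
    (hφc : HasCompactSupport φ) (hφs : tsupport φ ⊆ interior (G.interval e)) :
    G.IsH1 (onEdge e fun x => (φ x : ℂ)) (onEdge e fun x => ((deriv φ x : ℝ) : ℂ)) := by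
  have hφ' : Continuous (deriv φ) := hφ.continuous_deriv (by simp)
  have h0 : ∀ h : G.EdgeEnd, onEdge e (fun x => (φ x : ℂ)) h.edge h.pos = 0 := by
    intro h
    by_cases he : h.edge = e
    · subst he
      rw [onEdge_self, image_eq_zero_of_notMem_tsupport fun h1 => end_notMem_interior h (hφs h1),
        Complex.ofReal_zero]
    · rw [onEdge_of_ne he]
      rfl
  have key : ∀ f : ℝ → ℝ, Continuous f → HasCompactSupport f →
      MeasureTheory.MemLp (unc (onEdge e fun x => (f x : ℂ))) 2 G.graphMeasure := by
    intro f hf hfc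
    refine memLp_of_finite_edges (finite_singleton e) (fun e' => ?_) fun e' he' => ?_
    · by_cases he : e' = e
      · rw [he, onEdge_self]
        exact ((hf.memLp_of_hasCompactSupport hfc).restrict _).ofReal
      · rw [onEdge_of_ne he]
        exact MeasureTheory.MemLp.zero
    · rw [onEdge_of_ne he']
  refine ⟨fun h h' _ => by rw [h0, h0], fun e' => ?_, key _ hφ.continuous hφc, key _ hφ' hφc.deriv⟩
  by_cases he : e' = e
  · rw [he, onEdge_self, onEdge_self]
    exact (IsPrimitiveOn.of_hasDerivAt (fun x => (hφ.differentiable (by simp) x).hasDerivAt)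
      hφ').clm Complex.ofRealCLM
  · rw [onEdge_of_ne he, onEdge_of_ne he]
    exact IsPrimitiveOn.of_hasDerivAt (fun x => hasDerivAt_const x (0 : ℂ)) continuous_const

theorem integral_eq_of_forall_ne {f : (Σ _ : E, ℝ) → ℂ}
    (hf : Integrable f G.graphMeasure) (e : E) (h : ∀ e', e' ≠ e → ∀ x, f ⟨e', x⟩ = 0) :
    ∫ q, f q ∂G.graphMeasure = ∫ x, f ⟨e, x⟩ ∂G.edgeMeasure e := by
  rw [G.integral_graphMeasure hf]
  exact tsum_eq_single e fun e' he' => by simp [h e' he']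

theorem locallyIntegrableOn_of_memLp [NormedAddCommGroup F] {f : (Σ _ : E, ℝ) → F}
    (hf : MeasureTheory.MemLp f 2 G.graphMeasure) (e : E) :
    LocallyIntegrableOn (fun x => f ⟨e, x⟩) (interior (G.interval e)) :=
  (locallyIntegrableOn_of_locallyIntegrable_restrict
    ((G.memLp_edge hf e).locallyIntegrable one_le_two)).mono_set interior_subset

/-- With `z` the magnetic derivative of `u`, solve `f = i ζ + M z + V u` for `ζ`. By
`IsPotential.form_sub_eq`, the weak equation tested with functions supported inside the edge says
exactly that `ζ` is the weak derivative of `z`. -/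
theorem IsPotential.hasWeakDeriv_mag [Countable E] {M M' V : E → ℝ → ℝ}
    (hP : G.IsPotential M M' V) (hG : G.Connected) {u p : E → ℝ → ℂ} {f : (Σ _ : E, ℝ) → ℂ}
    (hu : G.IsH1 u p) (hf : MeasureTheory.MemLp f 2 G.graphMeasure)
    (h : ∀ v r, G.IsH1 v r → ∫ y, conj (unc (mag M u p) y) * unc (mag M v r) y +
      (V y.1 y.2 : ℂ) * conj (unc u y) * unc v y ∂G.graphMeasure =
      ∫ y, conj (f y) * unc v y ∂G.graphMeasure) (e : E) :
    HasWeakDeriv (G.interval e) (mag M u p e)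
      (fun x => -Complex.I * (f ⟨e, x⟩ - M e x * mag M u p e x - V e x * u e x)) := by
  have hz := hP.memLp_mag hu
  have hζ : MeasureTheory.MemLp (fun y => -Complex.I * (f y - M y.1 y.2 * unc (mag M u p) y -
      V y.1 y.2 * unc u y)) 2 G.graphMeasure :=
    ((hf.sub (hP.memLp_mul hz)).sub (hP.isElectricPotential.memLp_mul hG hu)).const_mul _
  refine ⟨locallyIntegrableOn_of_memLp hz e, locallyIntegrableOn_of_memLp hζ e,
    fun φ hφ hφc hφs => ?_⟩
  have hv : G.IsH1 _ _ := isH1_onEdge hφ hφc hφs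
  have h0 : ∀ y, f y = Complex.I * (-Complex.I * (f y - M y.1 y.2 * unc (mag M u p) y -
      V y.1 y.2 * unc u y)) + M y.1 y.2 * unc (mag M u p) y + V y.1 y.2 * unc u y := fun y => by
    linear_combination (f y - M y.1 y.2 * unc (mag M u p) y - V y.1 y.2 * unc u y) *
      Complex.I_mul_I
  have h1 := hP.form_sub_eq hG hu hv hz (ζ := fun e x => -Complex.I * (f ⟨e, x⟩ -
    M e x * mag M u p e x - V e x * u e x)) hζ (Eventually.of_forall h0)
  · rw [h _ _ hv, sub_self, zero_eq_mul] at h1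
    have h2 := h1.resolve_left Complex.I_ne_zero
    have hi : Integrable (fun y => conj (unc (mag M u p) y) *
        unc (onEdge e fun x => ((deriv φ x : ℝ) : ℂ)) y +
        conj (-Complex.I * (f y - M y.1 y.2 * unc (mag M u p) y - V y.1 y.2 * unc u y)) *
        unc (onEdge e fun x => (φ x : ℂ)) y) G.graphMeasure :=
      (integrable_conj_mul hz hv.memLp_deriv).add (integrable_conj_mul hζ hv.memLp)
    have h2 := (integral_eq_of_forall_ne hi e fun e' he' x => by
      simp [unc, onEdge_of_ne he']).symm.trans h2
    simp only [unc, onEdge_self] at h2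
    rw [setIntegral_eq_integral_of_forall_compl_eq_zero fun x hx => ?_] at h2
    · have h3 := congrArg conj h2
      rw [← integral_conj, map_zero] at h3
      simp only [map_add, map_mul, Complex.conj_conj, Complex.conj_ofReal] at h3
      rw [integral_add] at h3
      · rw [eq_neg_iff_add_eq_zero, ← h3]
        congr 1 <;> refine integral_congr_ae (Eventually.of_forall fun x => ?_)
        · simp only [Complex.real_smul]
          ring
        · simp only [Complex.real_smul]
          ring
      · refine ((locallyIntegrableOn_of_memLp hz e).integrable_smul_of_tsupport_subset
          (hφ.continuous_deriv (by simp)) hφc.deriv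
          ((tsupport_deriv_subset).trans hφs)).congr (Eventually.of_forall fun x => ?_)
        simp only [Complex.real_smul]
        ring
      · refine ((locallyIntegrableOn_of_memLp hζ e).integrable_smul_of_tsupport_subset
          hφ.continuous hφc hφs).congr (Eventually.of_forall fun x => ?_)
        simp only [Complex.real_smul]
        ring
    · have hx' : x ∉ tsupport φ := fun h => hx (interior_subset (hφs h))
      rw [image_eq_zero_of_notMem_tsupport hx',
        image_eq_zero_of_notMem_tsupport fun h => hx' (tsupport_deriv_subset h)]
      simp

/-- A weak solution in `H¹` is in `H²` and satisfies the Kirchhoff condition. -/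
theorem IsPotential.exists_isH2 [Countable E] {M M' V : E → ℝ → ℝ}
    (hP : G.IsPotential M M' V) (hG : G.Connected) (hfin : G.LocallyFinite) {u p : E → ℝ → ℂ}
    {f : (Σ _ : E, ℝ) → ℂ}
    (hu : G.IsH1 u p) (hf : MeasureTheory.MemLp f 2 G.graphMeasure)
    (h : ∀ v r, G.IsH1 v r → ∫ y, conj (unc (mag M u p) y) * unc (mag M v r) y +
      (V y.1 y.2 : ℂ) * conj (unc u y) * unc v y ∂G.graphMeasure =
      ∫ y, conj (f y) * unc v y ∂G.graphMeasure) :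
    ∃ p' q, G.IsH2 u p' q ∧ (∀ x : X, ∑ᶠ (h : G.EdgeEnd) (_ : h.vertex = x),
      (h.sign : ℂ) * mag M u p' h.edge h.pos = 0) ∧
      ∀ᵐ y ∂G.graphMeasure, f y = Complex.I * unc (magD M M' u p' q) y +
        M y.1 y.2 * unc (mag M u p') y + V y.1 y.2 * unc u y := by
  classical
  have hI := Complex.I_mul_I
  have hz := hP.memLp_mag hu
  set ζ : E → ℝ → ℂ := fun e x =>
    -Complex.I * (f ⟨e, x⟩ - M e x * mag M u p e x - V e x * u e x) with hζdef
  have hζ : MeasureTheory.MemLp (unc ζ) 2 G.graphMeasure :=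
    ((hf.sub (hP.memLp_mul hz)).sub (hP.isElectricPotential.memLp_mul hG hu)).const_mul _
  have h1 : ∀ e, ∃ z, IsPrimitiveOn (G.interval e) z (ζ e) ∧ mag M u p e =ᵐ[G.edgeMeasure e] z :=
    fun e => (hP.hasWeakDeriv_mag hG hu hf h e).exists_isPrimitiveOn (G.ordConnected_interval e)
      (G.interior_interval_nonempty e)
      fun x hx y hy => G.intervalIntegrable_of_memLp one_le_two (G.memLp_edge hζ e) hx hy
  choose z hzp hzae using h1
  have hzae' : unc (mag M u p) =ᵐ[G.graphMeasure] unc z := G.ae_graphMeasure_iff.2 hzae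
  -- The derivative `p` is changed on a null set so that the magnetic derivative becomes the
  -- primitive `z` itself. The Kirchhoff condition involves its values at the edge ends, where
  -- almost everywhere equality is useless.
  set p' : E → ℝ → ℂ := fun e x => -Complex.I * (z e x - M e x * u e x) with hp'
  set q : E → ℝ → ℂ := fun e x => -Complex.I * (ζ e x - (M e x * p' e x + M' e x * u e x)) with hq
  have hmag : mag M u p' = z := by
    funext e x
    simp only [mag, hp']
    linear_combination -(z e x - M e x * u e x) * hI
  have hmagD : magD M M' u p' q = ζ := by
    funext e x
    simp only [magD, hq]
    linear_combination -(ζ e x - (M e x * p' e x + M' e x * u e x)) * hI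
  have hpp' : unc p =ᵐ[G.graphMeasure] unc p' := by
    filter_upwards [hzae'] with y hy
    simp only [unc, hp', mag] at hy ⊢
    rw [← hy]
    linear_combination p y.1 y.2 * hI
  have hp'L : MeasureTheory.MemLp (unc p') 2 G.graphMeasure := hu.memLp_deriv.ae_eq hpp'
  have hup' : ∀ e, IsPrimitiveOn (G.interval e) (u e) (p' e) := fun e =>
    (hu.isPrimitiveOn e).congr (G.ordConnected_interval e) (fun _ _ => rfl)
      (G.ae_graphMeasure_iff.1 hpp' e)
  have hH1 : G.IsH1 u p' := ⟨hu.glued, hup', hu.memLp, hp'L⟩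
  have hH2 : G.IsH2 u p' q := by
    refine ⟨hH1, fun e => ?_, ?_⟩
    · have h2 := (((hzp e).add ((hP.isPrimitiveOn_mul (hup' e)).clm
        (-ContinuousLinearMap.id ℝ ℂ))).clm ((-Complex.I) • ContinuousLinearMap.id ℝ ℂ))
      refine h2.congr (G.ordConnected_interval e) (fun x _ => ?_) (Eventually.of_forall fun x => ?_)
      · simp [hp', sub_eq_add_neg]
      · simp [hq, sub_eq_add_neg]
    · exact (hζ.sub ((hP.memLp_mul hp'L).add
        (hP.isElectricPotential_deriv.memLp_mul hG hu))).const_mul _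
  have hfae : ∀ᵐ y ∂G.graphMeasure, f y = Complex.I * unc (magD M M' u p' q) y +
      M y.1 y.2 * unc (mag M u p') y + V y.1 y.2 * unc u y := by
    filter_upwards [hzae'] with y hy
    rw [hmagD, hmag, ← hy]
    simp only [unc, hζdef]
    linear_combination (f y - M y.1 y.2 * mag M u p y.1 y.2 - V y.1 y.2 * u y.1 y.2) * hI
  refine ⟨p', q, hH2, fun x => ?_, hfae⟩
  -- For the Kirchhoff condition at `x` the test function is `1` at `x` and `0` at all other
  -- vertices, so that only the boundary terms at `x` survive.
  set k : X → ℝ := Pi.single x 1 with hk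
  have hS : {e | ∃ h : G.EdgeEnd, h.edge = e ∧ k h.vertex ≠ 0}.Finite := by
    refine (finite_edges_at hG hfin x).subset ?_
    rintro e ⟨h, he, hh⟩
    refine ⟨h, he, ?_⟩
    by_contra h3
    exact hh (by simp [hk, h3])
  obtain ⟨v, r, hv, hvk⟩ : ∃ v r, G.IsH1 v r ∧ ∀ h : G.EdgeEnd, v h.edge h.pos = k h.vertex :=
    ⟨_, _, isH1_extend (ε := 1) one_pos hS, fun h => by rw [extend_end]⟩
  have h3 : ∫ y, conj (unc (mag M u p') y) * unc (mag M v r) y +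
      (V y.1 y.2 : ℂ) * conj (unc u y) * unc v y ∂G.graphMeasure =
      ∫ y, conj (f y) * unc v y ∂G.graphMeasure := by
    rw [← h _ _ hv]
    refine integral_congr_ae ?_
    filter_upwards [hzae'] with y hy
    rw [hmag, ← hy]
  rw [← sub_eq_zero, hP.form_sub_eq hG hH1 hv (hP.memLp_mag hH1) (hP.memLp_magD hG hH2) hfae,
    mul_eq_zero, or_iff_right Complex.I_ne_zero,
    IsH1.integral_eq_neg_finsum_ends (hP.isPrimitiveOn_mag hH2) (hP.memLp_mag hH1)
      (hP.memLp_magD hG hH2) hv, neg_eq_zero] at h3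
  · have h4 : ∀ h : G.EdgeEnd, (h.sign : ℂ) * (conj (mag M u p' h.edge h.pos) *
        v h.edge h.pos) =
        ∑ᶠ (_ : h.vertex = x), (h.sign : ℂ) * conj (mag M u p' h.edge h.pos) := by
      intro h
      rw [hvk, finsum_eq_if]
      split_ifs with hx
      · simp [hk, hx]
      · simp [hk, hx]
    simp_rw [h4] at h3
    have hfe := finite_ends_at hG hfin x
    change ∑ᶠ (h : G.EdgeEnd) (_ : h ∈ {h : G.EdgeEnd | h.vertex = x}), _ = _ at h3
    change ∑ᶠ (h : G.EdgeEnd) (_ : h ∈ {h : G.EdgeEnd | h.vertex = x}), _ = _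
    rw [finsum_mem_eq_finite_toFinset_sum _ hfe] at h3 ⊢
    have h5 := congrArg conj h3
    rw [map_sum, map_zero] at h5
    simpa only [map_mul, Complex.conj_conj, Complex.conj_ofReal] using h5
  · refine hS.subset ?_
    rintro e ⟨h, he, hh⟩
    refine ⟨h, he, ?_⟩
    rw [hvk] at hh
    exact_mod_cast hh

/-- The Kirchhoff condition in terms of the derivative. -/
theorem IsH2.magneticKirchhoff_iff {M : E → ℝ → ℝ} {u p q : E → ℝ → ℂ} (hu : G.IsH2 u p q) (x : X) :
    G.MagneticKirchhoff M u x ↔ ∑ᶠ (h : G.EdgeEnd) (_ : h.vertex = x),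
      (h.sign : ℂ) * mag M u p h.edge h.pos = 0 := by
  have h1 : ∀ h : G.EdgeEnd, derivWithin (u h.edge) (G.interval h.edge) h.pos = p h.edge h.pos :=
    fun h => (hu.isH1.isPrimitiveOn _).derivWithin_eq
      ((hu.isPrimitiveOn_deriv _).continuousOn_interval G) h.pos_mem
  simp only [MagneticKirchhoff, h1, mag]

end MetricGraph

/-! ### Coercive operators on a Hilbert space -/

/-- The Lax-Milgram theorem for operators on a complex Hilbert space. -/
theorem ContinuousLinearMap.surjective_of_coercive {H : Type*} [NormedAddCommGroup H]
    [InnerProductSpace ℂ H] [CompleteSpace H] (S : H →L[ℂ] H) {c : ℝ} (hc : 0 < c)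
    (h : ∀ x, c * ‖x‖ ^ 2 ≤ (⟪S x, x⟫_ℂ).re) : Function.Surjective S := by
  have hb : ∀ x, c * ‖x‖ ≤ ‖S x‖ := by
    intro x
    rcases (norm_nonneg x).eq_or_lt with h0 | h0
    · rw [← h0, mul_zero]
      exact norm_nonneg _
    · have h1 := (h x).trans ((Complex.re_le_norm _).trans (norm_inner_le_norm (S x) x))
      rw [pow_two, ← mul_assoc] at h1
      exact le_of_mul_le_mul_right h1 h0
  -- The lower bound makes the range closed; a vector orthogonal to it satisfies `⟪S w, w⟫ = 0`,
  -- which coercivity allows only for `w = 0`.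
  have ha : AntilipschitzWith (Real.toNNReal c⁻¹) S := by
    refine S.antilipschitz_of_bound fun x => ?_
    rw [Real.coe_toNNReal _ (inv_nonneg.2 hc.le), ← div_eq_inv_mul, le_div_iff₀ hc, mul_comm]
    exact hb x
  have hcl : IsClosed (S.range : Set H) := ha.isClosed_range S.uniformContinuous
  have : CompleteSpace S.range := hcl.completeSpace_coe
  refine LinearMap.range_eq_top (f := (S : H →ₗ[ℂ] H)).1 ?_
  refine (Submodule.orthogonal_eq_bot_iff (K := S.range)).1 ?_
  rw [Submodule.eq_bot_iff]
  intro w hw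
  have h1 : ⟪S w, w⟫_ℂ = 0 := (Submodule.mem_orthogonal _ _).1 hw (S w) ⟨w, rfl⟩
  have h2 := h w
  rw [h1, Complex.zero_re] at h2
  have h3 : ‖w‖ ^ 2 = 0 := le_antisymm (by nlinarith) (sq_nonneg _)
  exact norm_eq_zero.1 (pow_eq_zero_iff two_ne_zero |>.1 h3)

namespace MetricGraph

variable {X E F : Type*} {G : MetricGraph X E}

/-! ### The Hilbert space `H¹` -/

theorem IsH1.add {u p v r : E → ℝ → ℂ} (hu : G.IsH1 u p) (hv : G.IsH1 v r) :
    G.IsH1 (fun e x => u e x + v e x) (fun e x => p e x + r e x) :=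
  ⟨fun h h' hv' => by simp only [hu.glued h h' hv', hv.glued h h' hv'],
    fun e => (hu.isPrimitiveOn e).add (hv.isPrimitiveOn e), hu.memLp.add hv.memLp,
    hu.memLp_deriv.add hv.memLp_deriv⟩

theorem IsH1.const_mul {u p : E → ℝ → ℂ} (hu : G.IsH1 u p) (c : ℂ) :
    G.IsH1 (fun e x => c * u e x) (fun e x => c * p e x) :=
  ⟨fun h h' hv' => by simp only [hu.glued h h' hv'],
    fun e => (hu.isPrimitiveOn e).clm (c • ContinuousLinearMap.id ℝ ℂ), hu.memLp.const_mul c,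
    hu.memLp_deriv.const_mul c⟩

theorem isH1_zero : G.IsH1 (fun _ _ => 0) (fun _ _ => 0) :=
  ⟨fun _ _ _ => rfl, fun _ => IsPrimitiveOn.of_hasDerivAt (fun x => hasDerivAt_const x (0 : ℂ))
    continuous_const, MeasureTheory.MemLp.zero, MeasureTheory.MemLp.zero⟩

/-- The space of square integrable functions on the disjoint union of the edges. -/
noncomputable abbrev LpGraph (G : MetricGraph X E) := Lp ℂ 2 G.graphMeasure

/-- The space of pairs of a function in `H¹` and its derivative. -/
noncomputable def h1Space (G : MetricGraph X E) :
    Submodule ℂ (WithLp 2 (G.LpGraph × G.LpGraph)) where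
  carrier := {U | ∃ u p, G.IsH1 u p ∧ U.fst =ᵐ[G.graphMeasure] unc u ∧
    U.snd =ᵐ[G.graphMeasure] unc p}
  zero_mem' := ⟨_, _, isH1_zero, Lp.coeFn_zero _ _ _, Lp.coeFn_zero _ _ _⟩
  add_mem' := by
    rintro U U' ⟨u, p, hu, h1, h2⟩ ⟨u', p', hu', h1', h2'⟩
    refine ⟨_, _, hu.add hu', ?_, ?_⟩
    · exact (Lp.coeFn_add _ _).trans (h1.add h1')
    · exact (Lp.coeFn_add _ _).trans (h2.add h2')
  smul_mem' := by
    rintro c U ⟨u, p, hu, h1, h2⟩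
    refine ⟨_, _, hu.const_mul c, ?_, ?_⟩
    · exact (Lp.coeFn_smul _ _).trans (h1.const_smul c)
    · exact (Lp.coeFn_smul _ _).trans (h2.const_smul c)

theorem mem_h1Space {U : WithLp 2 (G.LpGraph × G.LpGraph)} : U ∈ G.h1Space ↔
    ∃ u p, G.IsH1 u p ∧ U.fst =ᵐ[G.graphMeasure] unc u ∧ U.snd =ᵐ[G.graphMeasure] unc p := Iff.rfl

theorem norm_eq_norm2 {U : G.LpGraph} {u : (Σ _ : E, ℝ) → ℂ} (h : U =ᵐ[G.graphMeasure] u) :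
    ‖U‖ = G.norm2 u := by
  rw [Lp.norm_def, norm2, eLpNorm_congr_ae h]

theorem norm_fst_le (U : WithLp 2 (G.LpGraph × G.LpGraph)) : ‖U.fst‖ ≤ ‖U‖ := by
  refine abs_le_of_sq_le_sq' ?_ (norm_nonneg _) |>.2
  rw [WithLp.prod_norm_sq_eq_of_L2]
  nlinarith [sq_nonneg ‖U.snd‖]

theorem norm_snd_le (U : WithLp 2 (G.LpGraph × G.LpGraph)) : ‖U.snd‖ ≤ ‖U‖ := by
  refine abs_le_of_sq_le_sq' ?_ (norm_nonneg _) |>.2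
  rw [WithLp.prod_norm_sq_eq_of_L2]
  nlinarith [sq_nonneg ‖U.fst‖]

/-- Integration over a segment of one edge is, up to sign, the inner product with the indicator of
that segment. -/
theorem continuous_intervalIntegral_Lp {e : E} {x y : ℝ} (hx : x ∈ G.interval e)
    (hy : y ∈ G.interval e) :
    Continuous fun f : G.LpGraph => ∫ t in x..y, f ⟨e, t⟩ := by
  set J : Set ℝ := uIoc x y with hJ
  have hJI : J ⊆ G.interval e :=
    uIoc_subset_uIcc.trans ((G.ordConnected_interval e).uIcc_subset hx hy)
  set s : Set (Σ _ : E, ℝ) := Sigma.mk (β := fun _ : E => ℝ) e '' J with hs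
  have hsm : MeasurableSet s :=
    (measurableEmbedding_sigmaMk e).measurableSet_image.2 measurableSet_uIoc
  have hpre : Sigma.mk (β := fun _ : E => ℝ) e ⁻¹' s = J := preimage_image_eq _ sigma_mk_injective
  have hind : ∀ (g : (Σ _ : E, ℝ) → ℂ) (e' : E), e' ≠ e → ∀ t, s.indicator g ⟨e', t⟩ = 0 := by
    intro g e' he' t
    refine indicator_of_notMem ?_ _
    rintro ⟨t', -, h⟩
    exact he' (congrArg Sigma.fst h).symm
  have hind' : ∀ (g : (Σ _ : E, ℝ) → ℂ), (fun t => s.indicator g ⟨e, t⟩) =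
      J.indicator fun t => g ⟨e, t⟩ := by
    intro g
    rw [← hpre]
    rfl
  have hμ : G.graphMeasure s ≠ ∞ := by
    rw [← lintegral_indicator_one hsm, G.lintegral_graphMeasure, tsum_eq_single e]
    · have : (fun t => s.indicator (1 : (Σ _ : E, ℝ) → ℝ≥0∞) ⟨e, t⟩) = J.indicator 1 := by
        rw [← hpre]
        rfl
      rw [this, lintegral_indicator_one measurableSet_uIoc]
      refine ((Measure.restrict_apply_le _ _).trans_lt ?_).ne
      simp [uIoc]
    · intro e' he'
      have : ∀ t, s.indicator (1 : (Σ _ : E, ℝ) → ℝ≥0∞) ⟨e', t⟩ = 0 := by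
        intro t
        refine indicator_of_notMem ?_ _
        rintro ⟨t', -, h⟩
        exact he' (congrArg Sigma.fst h).symm
      simp [this]
  have key : ∀ f : G.LpGraph,
      ⟪indicatorConstLp 2 hsm hμ (1 : ℂ), f⟫_ℂ = ∫ t in J, f ⟨e, t⟩ := by
    intro f
    rw [L2.inner_indicatorConstLp_one, ← integral_indicator hsm]
    have hi : Integrable (s.indicator f) G.graphMeasure := by
      rw [integrable_indicator_iff hsm]
      have : IsFiniteMeasure (G.graphMeasure.restrict s) :=
        ⟨by rw [Measure.restrict_apply_univ]; exact hμ.lt_top⟩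
      exact ((Lp.memLp f).restrict s).integrable one_le_two
    rw [integral_eq_of_forall_ne hi e (hind f), hind', integral_indicator measurableSet_uIoc,
      Measure.restrict_restrict measurableSet_uIoc, inter_eq_left.2 hJI]
  simp_rw [intervalIntegral.intervalIntegral_eq_integral_uIoc, ← hJ, ← key]
  exact (continuous_const.inner continuous_id).const_smul _

/-- The sup bound turns convergence of the pairs into uniform convergence of the functions, so a
limit exists at every point and not only almost everywhere. The equality of values at a vertex and
the integral identity of a primitive then pass to the limit. -/
theorem isClosed_h1Space [Countable E] (hG : G.Connected) :
    IsClosed (G.h1Space : Set (WithLp 2 (G.LpGraph × G.LpGraph))) := by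
  refine IsSeqClosed.isClosed fun U U₀ hU hlim => ?_
  obtain ⟨C, hC, hb⟩ := exists_sup_norm_bound hG
  choose u p hu hUu hUp using fun n => mem_h1Space.1 (hU n)
  have hfst : Tendsto (fun n => (U n).fst) atTop (𝓝 U₀.fst) :=
    ((WithLp.fstL 2 ℂ G.LpGraph G.LpGraph).continuous.tendsto _).comp hlim
  have hsnd : Tendsto (fun n => (U n).snd) atTop (𝓝 U₀.snd) :=
    ((WithLp.sndL 2 ℂ G.LpGraph G.LpGraph).continuous.tendsto _).comp hlim
  have hdiff : ∀ n m e, ∀ x ∈ G.interval e, ‖u n e x - u m e x‖ ≤ 2 * C * ‖U n - U m‖ := by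
    intro n m e x hx
    have h1 := hb _ _ ((hu n).add ((hu m).const_mul (-1))) e x hx
    have h2 : ‖(U n - U m).fst‖ = G.norm2 (unc fun e x => u n e x + -1 * u m e x) := by
      refine norm_eq_norm2 ?_
      rw [WithLp.sub_fst]
      filter_upwards [Lp.coeFn_sub (U n).fst (U m).fst, hUu n, hUu m] with y h1 h2 h3
      rw [h1, Pi.sub_apply, h2, h3]
      simp only [unc]
      ring
    have h3 : ‖(U n - U m).snd‖ = G.norm2 (unc fun e x => p n e x + -1 * p m e x) := by
      refine norm_eq_norm2 ?_
      rw [WithLp.sub_snd]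
      filter_upwards [Lp.coeFn_sub (U n).snd (U m).snd, hUp n, hUp m] with y h1 h2 h3
      rw [h1, Pi.sub_apply, h2, h3]
      simp only [unc]
      ring
    rw [← h2, ← h3] at h1
    have h4 := norm_fst_le (U n - U m)
    have h5 := norm_snd_le (U n - U m)
    have h6 : u n e x - u m e x = u n e x + -1 * u m e x := by ring
    rw [h6]
    refine h1.trans ?_
    rw [mul_comm 2 C, mul_assoc]
    exact mul_le_mul_of_nonneg_left (by linarith) hC
  have hex : ∀ e x, ∃ l, x ∈ G.interval e → Tendsto (fun n => u n e x) atTop (𝓝 l) := by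
    intro e x
    by_cases hx : x ∈ G.interval e
    · have hcs : CauchySeq fun n => u n e x := by
        have h1 := hlim.cauchySeq
        rw [Metric.cauchySeq_iff'] at h1 ⊢
        intro ε hε
        -- The summand `1` is there because `C` may be zero.
        obtain ⟨N, hN⟩ := h1 (ε / (2 * C + 1)) (by positivity)
        refine ⟨N, fun n hn => ?_⟩
        have h2 := hN n hn
        rw [dist_eq_norm, lt_div_iff₀ (by positivity)] at h2
        rw [dist_eq_norm]
        refine (hdiff n N e x hx).trans_lt (lt_of_le_of_lt ?_ h2)
        rw [mul_comm]
        exact mul_le_mul_of_nonneg_left (by linarith) (norm_nonneg _)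
      obtain ⟨l, hl⟩ := cauchySeq_tendsto_of_complete hcs
      exact ⟨l, fun _ => hl⟩
    · exact ⟨0, fun h => absurd h hx⟩
  choose w hw using hex
  have hwae : U₀.fst =ᵐ[G.graphMeasure] unc w := by
    obtain ⟨ns, hns, hae⟩ := (tendstoInMeasure_of_tendsto_Lp hfst).exists_seq_tendsto_ae
    have hI : ∀ᵐ y ∂G.graphMeasure, y.2 ∈ G.interval y.1 :=
      G.ae_graphMeasure_iff.2 fun e => ae_restrict_mem (G.measurableSet_interval e)
    filter_upwards [hae, ae_all_iff.2 hUu, hI] with y h1 h2 h3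
    refine tendsto_nhds_unique h1 ?_
    simp only [h2]
    exact (hw y.1 y.2 h3).comp hns.tendsto_atTop
  refine ⟨w, fun e x => U₀.snd ⟨e, x⟩, ⟨fun h h' hv => ?_, fun e x hx y hy => ?_,
    (Lp.memLp U₀.fst).ae_eq hwae, Lp.memLp U₀.snd⟩, hwae, EventuallyEq.refl _ _⟩
  · refine tendsto_nhds_unique (hw _ _ h.pos_mem) ?_
    simp only [fun n => (hu n).glued h h' hv]
    exact hw _ _ h'.pos_mem
  · refine ⟨G.intervalIntegrable_of_memLp one_le_two (G.memLp_edge (Lp.memLp U₀.snd) e) hx hy, ?_⟩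
    have h1 : Tendsto (fun n => ∫ t in x..y, (U n).snd ⟨e, t⟩) atTop
        (𝓝 (∫ t in x..y, U₀.snd ⟨e, t⟩)) :=
      ((continuous_intervalIntegral_Lp hx hy).tendsto _).comp hsnd
    refine tendsto_nhds_unique h1 (((hw e y hy).sub (hw e x hx)).congr fun n => ?_)
    have h2 := ((hu n).isPrimitiveOn e).congr (G.ordConnected_interval e) (fun _ _ => rfl)
      ((G.ae_graphMeasure_iff.1 (hUp n) e).mono fun t ht => ht.symm)
    exact (h2 x hx y hy).2.symm

/-! ### Existence of weak solutions -/

theorem IsPotential.exists_mul_clm [Countable E] {M M' V : E → ℝ → ℝ} (hP : G.IsPotential M M' V) :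
    ∃ L : G.LpGraph →L[ℂ] G.LpGraph, ∀ f : G.LpGraph,
      L f =ᵐ[G.graphMeasure] fun q => (M q.1 q.2 : ℂ) * f q := by
  obtain ⟨C, -, h⟩ := hP.exists_mul_bound
  have hae : ∀ f : G.LpGraph, (h _ (Lp.memLp f)).1.toLp =ᵐ[G.graphMeasure]
      fun q => (M q.1 q.2 : ℂ) * f q := fun f => (h _ (Lp.memLp f)).1.coeFn_toLp
  let L : G.LpGraph →ₗ[ℂ] G.LpGraph :=
    { toFun := fun f => (h _ (Lp.memLp f)).1.toLp
      map_add' := fun f g => by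
        refine Lp.ext ?_
        filter_upwards [hae (f + g), hae f, hae g, Lp.coeFn_add f g,
          Lp.coeFn_add ((h _ (Lp.memLp f)).1.toLp) ((h _ (Lp.memLp g)).1.toLp)]
          with q h1 h2 h3 h4 h5
        rw [h1, h5, Pi.add_apply, h2, h3, h4, Pi.add_apply, mul_add]
      map_smul' := fun c f => by
        refine Lp.ext ?_
        filter_upwards [hae (c • f), hae f, Lp.coeFn_smul c f,
          Lp.coeFn_smul c ((h _ (Lp.memLp f)).1.toLp)] with q h1 h2 h3 h4
        rw [h1, RingHom.id_apply, h4, Pi.smul_apply, h2, h3, Pi.smul_apply, smul_eq_mul,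
          smul_eq_mul]
        ring }
  refine ⟨L.mkContinuous C fun f => ?_, hae⟩
  rw [norm_eq_norm2 (U := L f) (hae f), norm_eq_norm2 (EventuallyEq.refl _ f)]
  exact (h _ (Lp.memLp f)).2

/-- Multiplication by `V` is bounded from `H¹` to `L²` by the sup bound. The estimate in terms of
the norms of the function and its derivative separately is the one that coercivity requires. -/
theorem IsElectricPotential.exists_mul_clm [Countable E] (hG : G.Connected) {V : E → ℝ → ℝ}
    (hV : G.IsElectricPotential V) : ∃ W : G.h1Space →L[ℂ] G.LpGraph,
      (∀ U : G.h1Space, W U =ᵐ[G.graphMeasure] fun q => (V q.1 q.2 : ℂ) * U.1.fst q) ∧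
      ∃ K : ℝ, ∀ U : G.h1Space,
        ‖W U‖ ≤ K * (‖U.1.fst‖ +
          ‖U.1.snd‖) := by
  obtain ⟨K, hK0, hK⟩ := hV.exists_mul_bound
  obtain ⟨C, hC, hb⟩ := exists_sup_norm_bound hG
  have h : ∀ U : G.h1Space,
      MeasureTheory.MemLp (fun q => (V q.1 q.2 : ℂ) * U.1.fst q) 2 G.graphMeasure ∧
      G.norm2 (fun q => (V q.1 q.2 : ℂ) * U.1.fst q) ≤
        K * (C + 1) * (‖U.1.fst‖ +
          ‖U.1.snd‖) := by
    rintro ⟨U, u, p, hu, hUu, hUp⟩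
    have h1 : ∀ᵐ q ∂G.graphMeasure, ‖U.fst q‖ ≤ C * (‖U.fst‖ + ‖U.snd‖) := by
      filter_upwards [hUu, ae_norm_le (hb u p hu)] with q h1 h2
      rw [h1, norm_eq_norm2 hUu, norm_eq_norm2 hUp]
      exact h2
    obtain ⟨h2, h3⟩ := hK _ _ (by positivity) (Lp.memLp U.fst) h1
    refine ⟨h2, h3.trans ?_⟩
    rw [← norm_eq_norm2 (EventuallyEq.refl _ U.fst), mul_assoc]
    refine mul_le_mul_of_nonneg_left ?_ hK0
    nlinarith [norm_nonneg U.snd]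
  have hae : ∀ U : G.h1Space, (h U).1.toLp =ᵐ[G.graphMeasure]
      fun q => (V q.1 q.2 : ℂ) * U.1.fst q := fun U => (h U).1.coeFn_toLp
  let L : G.h1Space →ₗ[ℂ] G.LpGraph :=
    { toFun := fun U => (h U).1.toLp
      map_add' := fun U U' => by
        refine Lp.ext ?_
        filter_upwards [hae (U + U'), hae U, hae U',
          Lp.coeFn_add U.1.fst U'.1.fst,
          Lp.coeFn_add ((h U).1.toLp) ((h U').1.toLp)] with q h1 h2 h3 h4 h5
        rw [h1, h5, Pi.add_apply, h2, h3, Submodule.coe_add, WithLp.add_fst, h4, Pi.add_apply,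
          mul_add]
      map_smul' := fun c U => by
        refine Lp.ext ?_
        filter_upwards [hae (c • U), hae U,
          Lp.coeFn_smul c U.1.fst,
          Lp.coeFn_smul c ((h U).1.toLp)] with q h1 h2 h3 h4
        rw [h1, RingHom.id_apply, h4, Pi.smul_apply, h2, Submodule.coe_smul, WithLp.smul_fst, h3,
          Pi.smul_apply, smul_eq_mul, smul_eq_mul]
        ring }
  have hL : ∀ U : G.h1Space, ‖L U‖ ≤ K * (C + 1) * (‖U.1.fst‖ +
      ‖U.1.snd‖) := fun U => by
    rw [norm_eq_norm2 (U := L U) (hae U)]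
    exact (h U).2
  refine ⟨L.mkContinuous (2 * (K * (C + 1))) fun U => ?_, hae, K * (C + 1), hL⟩
  refine (hL U).trans ?_
  have h1 := norm_fst_le (U : WithLp 2 (G.LpGraph × G.LpGraph))
  have h2 := norm_snd_le (U : WithLp 2 (G.LpGraph × G.LpGraph))
  have h4 : ‖U.1.fst‖ + ‖U.1.snd‖ ≤ 2 * ‖U‖ := by
    rw [Submodule.coe_norm]
    linarith
  calc K * (C + 1) * (‖U.1.fst‖ + ‖U.1.snd‖) ≤ K * (C + 1) * (2 * ‖U‖) :=
        mul_le_mul_of_nonneg_left h4 (mul_nonneg hK0 (by linarith))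
    _ = 2 * (K * (C + 1)) * ‖U‖ := by ring

/-- Solvability of the equation of a form that is bounded below. -/
theorem _root_.ContinuousLinearMap.exists_solution_of_form {H K : Type*} [NormedAddCommGroup H]
    [InnerProductSpace ℂ H] [CompleteSpace H] [NormedAddCommGroup K] [InnerProductSpace ℂ K]
    [CompleteSpace K] (ι δ W : H →L[ℂ] K) (L : K →L[ℂ] K) {k : ℝ}
    (hnorm : ∀ U, ‖U‖ ^ 2 = ‖ι U‖ ^ 2 + ‖δ U‖ ^ 2) (hW : ∀ U, ‖W U‖ ≤ k * (‖ι U‖ + ‖δ U‖)) :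
    ∃ l : ℝ, ∀ f : K, ∃ U, ∀ U', ⟪f, ι U'⟫_ℂ =
      ⟪Complex.I • δ U + L (ι U), Complex.I • δ U' + L (ι U')⟫_ℂ + ⟪W U, ι U'⟫_ℂ +
        l * ⟪ι U, ι U'⟫_ℂ := by
  set T : H →L[ℂ] K := Complex.I • δ + L.comp ι with hT
  set c := ‖L‖ with hc
  -- Write `a = ‖ι U‖` and `b = ‖δ U‖`. Then `‖T U‖² ≥ b²/2 - c² a²` and `k a b ≤ b²/4 + k² a²`, so
  -- this `l` leaves `(a² + b²)/4`. No smallness of `k` is needed, because `W U` is paired with `ι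
  -- U` and the term `b²` never carries the factor `k`.
  set l : ℝ := 1 / 4 + c ^ 2 + k + k ^ 2 with hl
  set S : H →L[ℂ] H := (ContinuousLinearMap.adjoint T).comp T +
    (ContinuousLinearMap.adjoint ι).comp W + (l : ℂ) • (ContinuousLinearMap.adjoint ι).comp ι with hS
  have hSi : ∀ U U' : H, ⟪S U, U'⟫_ℂ = ⟪T U, T U'⟫_ℂ + ⟪W U, ι U'⟫_ℂ + l * ⟪ι U, ι U'⟫_ℂ := by
    intro U U'
    have h1 : S U = (ContinuousLinearMap.adjoint T) (T U) + (ContinuousLinearMap.adjoint ι) (W U) +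
      (l : ℂ) • (ContinuousLinearMap.adjoint ι) (ι U) := rfl
    rw [h1, inner_add_left, inner_add_left, inner_smul_left, ContinuousLinearMap.adjoint_inner_left,
      ContinuousLinearMap.adjoint_inner_left, ContinuousLinearMap.adjoint_inner_left,
      Complex.conj_ofReal]
  have hcoer : ∀ U : H, 1 / 4 * ‖U‖ ^ 2 ≤ (⟪S U, U⟫_ℂ).re := by
    intro U
    set a := ‖ι U‖ with ha
    set b := ‖δ U‖ with hb
    have ha0 : 0 ≤ a := norm_nonneg _
    have hb0 : 0 ≤ b := norm_nonneg _
    have hc0 : 0 ≤ c := norm_nonneg _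
    have hTU : b ≤ ‖T U‖ + c * a := by
      have h1 : Complex.I • δ U = T U - L (ι U) := (add_sub_cancel_right _ _).symm
      have h2 : b = ‖Complex.I • δ U‖ := by rw [norm_smul, Complex.norm_I, one_mul]
      rw [h2, h1]
      exact (norm_sub_le _ _).trans (add_le_add le_rfl (L.le_opNorm _))
    have hW1 : -(k * (a + b) * a) ≤ (⟪W U, ι U⟫_ℂ).re := by
      have h1 := (Complex.abs_re_le_norm _).trans (norm_inner_le_norm (𝕜 := ℂ) (W U) (ι U))
      have h2 : ‖W U‖ * ‖ι U‖ ≤ k * (a + b) * a := mul_le_mul_of_nonneg_right (hW U) ha0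
      linarith [neg_abs_le (⟪W U, ι U⟫_ℂ).re]
    have h1 : (⟪T U, T U⟫_ℂ).re = ‖T U‖ ^ 2 := inner_self_eq_norm_sq (𝕜 := ℂ) (T U)
    have h2 : (⟪ι U, ι U⟫_ℂ).re = a ^ 2 := inner_self_eq_norm_sq (𝕜 := ℂ) (ι U)
    rw [hSi, Complex.add_re, Complex.add_re, Complex.re_ofReal_mul, h1, h2, hnorm U, hl]
    have h3 : b ^ 2 ≤ 2 * ‖T U‖ ^ 2 + 2 * (c * a) ^ 2 := by
      have h4 : b ^ 2 ≤ (‖T U‖ + c * a) ^ 2 := pow_le_pow_left₀ hb0 hTU 2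
      nlinarith [sq_nonneg (‖T U‖ - c * a)]
    nlinarith [sq_nonneg (b / 2 - k * a)]
  refine ⟨l, fun f => ?_⟩
  obtain ⟨U, hU⟩ := S.surjective_of_coercive (by norm_num) hcoer (ContinuousLinearMap.adjoint ι f)
  refine ⟨U, fun U' => ?_⟩
  rw [← ContinuousLinearMap.adjoint_inner_left, ← hU, hSi]
  rfl

theorem inner_eq_integral {f g : G.LpGraph} {u v : (Σ _ : E, ℝ) → ℂ}
    (hf : f =ᵐ[G.graphMeasure] u) (hg : g =ᵐ[G.graphMeasure] v) :
    ⟪f, g⟫_ℂ = ∫ q, conj (u q) * v q ∂G.graphMeasure := by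
  rw [L2.inner_def]
  refine integral_congr_ae ?_
  filter_upwards [hf, hg] with q h1 h2
  rw [h1, h2, RCLike.inner_apply, mul_comm]

/-- For large `l` the form of `A + l` is coercive, which yields weak solutions. -/
theorem IsPotential.exists_weak_solution [Countable E] {M M' V : E → ℝ → ℝ}
    (hP : G.IsPotential M M' V)
    (hG : G.Connected) : ∃ l : ℝ, ∀ f : (Σ _ : E, ℝ) → ℂ,
      MeasureTheory.MemLp f 2 G.graphMeasure → ∃ u p, G.IsH1 u p ∧ ∀ v r, G.IsH1 v r →
        ∫ y, conj (unc (mag M u p) y) * unc (mag M v r) y +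
          (V y.1 y.2 : ℂ) * conj (unc u y) * unc v y ∂G.graphMeasure =
        ∫ y, conj (f y - l * unc u y) * unc v y ∂G.graphMeasure := by
  have : CompleteSpace G.h1Space := (isClosed_h1Space hG).completeSpace_coe
  obtain ⟨L, hL⟩ := hP.exists_mul_clm
  obtain ⟨W, hW, K, hK⟩ := hP.isElectricPotential.exists_mul_clm hG
  set ι : G.h1Space →L[ℂ] G.LpGraph := (WithLp.fstL 2 ℂ _ _).comp G.h1Space.subtypeL with hι
  set δ : G.h1Space →L[ℂ] G.LpGraph := (WithLp.sndL 2 ℂ _ _).comp G.h1Space.subtypeL with hδ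
  have hTae : ∀ (U : G.h1Space) (u p : E → ℝ → ℂ), ι U =ᵐ[G.graphMeasure] unc u →
      δ U =ᵐ[G.graphMeasure] unc p → Complex.I • δ U + L (ι U) =ᵐ[G.graphMeasure] unc (mag M u p) := by
    intro U u p h1 h2
    filter_upwards [Lp.coeFn_add (Complex.I • δ U) (L (ι U)), Lp.coeFn_smul Complex.I (δ U),
      hL (ι U), h1, h2] with q h4 h5 h6 h7 h8
    rw [h4, Pi.add_apply, h5, Pi.smul_apply, h6, h7, h8]
    rfl
  obtain ⟨l, hl⟩ := ContinuousLinearMap.exists_solution_of_form ι δ W L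
    (fun U => WithLp.prod_norm_sq_eq_of_L2 U.1) hK
  refine ⟨l, fun f hf => ?_⟩
  obtain ⟨U, hU⟩ := hl (hf.toLp f)
  obtain ⟨u, p, hu, hUu, hUp⟩ := mem_h1Space.1 U.2
  refine ⟨u, p, hu, fun v r hv => ?_⟩
  set Φ : G.h1Space := ⟨WithLp.toLp 2 (hv.memLp.toLp _, hv.memLp_deriv.toLp _),
    v, r, hv, hv.memLp.coeFn_toLp, hv.memLp_deriv.coeFn_toLp⟩ with hΦ
  have hΦv : ι Φ =ᵐ[G.graphMeasure] unc v := hv.memLp.coeFn_toLp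
  have hΦr : δ Φ =ᵐ[G.graphMeasure] unc r := hv.memLp_deriv.coeFn_toLp
  have hWU : W U =ᵐ[G.graphMeasure] fun q => (V q.1 q.2 : ℂ) * unc u q := by
    filter_upwards [hW U, hUu] with q h1 h2
    rw [h1, h2]
  have h1 := hU Φ
  have h5 := hP.isElectricPotential.memLp_mul hG hu
  rw [inner_eq_integral hf.coeFn_toLp hΦv,
    inner_eq_integral (hTae U u p hUu hUp) (hTae Φ v r hΦv hΦr), inner_eq_integral hWU hΦv,
    inner_eq_integral (show ι U =ᵐ[G.graphMeasure] unc u from hUu) hΦv] at h1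
  have h2 : ∫ y, conj (f y - l * unc u y) * unc v y ∂G.graphMeasure =
      ∫ y, conj (f y) * unc v y ∂G.graphMeasure -
        l * ∫ y, conj (unc u y) * unc v y ∂G.graphMeasure := by
    rw [← integral_const_mul, ← integral_sub (integrable_conj_mul hf hv.memLp)
      ((integrable_conj_mul hu.memLp hv.memLp).const_mul _)]
    refine integral_congr_ae (Eventually.of_forall fun y => ?_)
    simp only [map_sub, map_mul, Complex.conj_ofReal]
    ring
  rw [h2, h1, ← integral_add (integrable_conj_mul (hP.memLp_mag hu) (hP.memLp_mag hv))
    (integrable_conj_mul h5 hv.memLp), add_sub_cancel_right]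
  refine integral_congr_ae (Eventually.of_forall fun y => ?_)
  simp only [map_mul, Complex.conj_ofReal]

end MetricGraph

/-! ### A criterion for self-adjointness -/

/-- A symmetric operator `A` such that `A + l` is surjective for some real number `l` is densely
defined and self-adjoint. -/
theorem LinearPMap.dense_and_isSelfAdjoint_of_surjective {H : Type*} [NormedAddCommGroup H]
    [InnerProductSpace ℂ H] [CompleteSpace H] (A : H →ₗ.[ℂ] H)
    (hsym : ∀ x y : A.domain, ⟪A x, (y : H)⟫_ℂ = ⟪(x : H), A y⟫_ℂ) (l : ℝ)
    (hsurj : ∀ f : H, ∃ x : A.domain, A x + (l : ℂ) • (x : H) = f) :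
    Dense (A.domain : Set H) ∧ IsSelfAdjoint A := by
  have hd : Dense (A.domain : Set H) := by
    rw [Submodule.dense_iff_topologicalClosure_eq_top, Submodule.topologicalClosure_eq_top_iff,
      Submodule.eq_bot_iff]
    intro w hw
    obtain ⟨x, hx⟩ := hsurj w
    -- By symmetry, `w = (A + l) x` orthogonal to the domain means that `x` is orthogonal to the
    -- range of `A + l`, which is everything.
    have h1 : ∀ y : A.domain, ⟪(x : H), A y + (l : ℂ) • (y : H)⟫_ℂ = 0 := by
      intro y
      have h2 := (Submodule.mem_orthogonal' _ _).1 hw y y.2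
      rw [← hx, inner_add_left, hsym, inner_smul_left, Complex.conj_ofReal] at h2
      rw [inner_add_right, inner_smul_right, h2]
    obtain ⟨y, hy⟩ := hsurj x
    have h2 := h1 y
    rw [hy, inner_self_eq_zero] at h2
    have h3 : x = 0 := Subtype.ext h2
    rw [← hx, h3]
    simp
  refine ⟨hd, ?_⟩
  rw [LinearPMap.isSelfAdjoint_def]
  have hle : A ≤ A.adjoint := LinearPMap.IsFormalAdjoint.le_adjoint hd fun x y => hsym x y
  refine (LinearPMap.eq_of_le_of_domain_eq hle (le_antisymm hle.1 fun y hy => ?_)).symm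
  -- `x` in the domain of `A` solves the same equation as `y`; the difference `x - y` is orthogonal
  -- to the range of `A + l`, so `y = x`.
  obtain ⟨x, hx⟩ := hsurj (A.adjoint ⟨y, hy⟩ + (l : ℂ) • y)
  have hadj := LinearPMap.adjoint_isFormalAdjoint hd
  have h1 : ∀ w : A.domain, ⟪(x : H) - y, A w + (l : ℂ) • (w : H)⟫_ℂ = 0 := by
    intro w
    have h2 := congrArg (fun f => ⟪f, (w : H)⟫_ℂ) hx
    simp only [inner_add_left, inner_smul_left, Complex.conj_ofReal] at h2
    have h3 : ⟪A.adjoint ⟨y, hy⟩, (w : H)⟫_ℂ = ⟪y, A w⟫_ℂ := hadj ⟨y, hy⟩ w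
    rw [h3, hsym] at h2
    rw [inner_sub_left, inner_add_right, inner_add_right, inner_smul_right, inner_smul_right, h2,
      sub_self]
  obtain ⟨w, hw⟩ := hsurj (x - y)
  have h2 := h1 w
  rw [hw, inner_self_eq_zero, sub_eq_zero] at h2
  rw [← h2]
  exact x.2

namespace MetricGraph

variable {X E : Type*} {G : MetricGraph X E}

/-! ### The magnetic Schrödinger operator -/

theorem IsH2.add {u p q v r s : E → ℝ → ℂ} (hu : G.IsH2 u p q) (hv : G.IsH2 v r s) :
    G.IsH2 (fun e x => u e x + v e x) (fun e x => p e x + r e x) (fun e x => q e x + s e x) :=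
  ⟨hu.isH1.add hv.isH1, fun e => (hu.isPrimitiveOn_deriv e).add (hv.isPrimitiveOn_deriv e),
    hu.memLp_deriv_deriv.add hv.memLp_deriv_deriv⟩

theorem IsH2.const_mul {u p q : E → ℝ → ℂ} (hu : G.IsH2 u p q) (c : ℂ) :
    G.IsH2 (fun e x => c * u e x) (fun e x => c * p e x) (fun e x => c * q e x) :=
  ⟨hu.isH1.const_mul c, fun e => (hu.isPrimitiveOn_deriv e).clm (c • ContinuousLinearMap.id ℝ ℂ),
    hu.memLp_deriv_deriv.const_mul c⟩

/-- The function `w`, with first and second derivatives `p` and `q`, is a representative of `u` that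
shows that `u` is in the domain of the magnetic Schrödinger operator. -/
structure IsDomainRep (G : MetricGraph X E) (M : E → ℝ → ℝ) (u : G.L2) (w p q : E → ℝ → ℂ) :
    Prop where
  ae_eq : ∀ e, u e =ᵐ[G.edgeMeasure e] w e
  isH2 : G.IsH2 w p q
  kirchhoff : ∀ x : X, ∑ᶠ (h : G.EdgeEnd) (_ : h.vertex = x),
    (h.sign : ℂ) * mag M w p h.edge h.pos = 0

theorem memDomain_iff [Countable E] {M : E → ℝ → ℝ} {u : G.L2} :
    G.MemDomain M u ↔ ∃ w p q, G.IsDomainRep M u w p q := by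
  constructor
  · rintro ⟨w, h1, h2, h3⟩
    obtain ⟨p, q, h⟩ := memSobolev_two_two_iff.1 h2
    exact ⟨w, p, q, h1, h, fun x => (h.magneticKirchhoff_iff x).1 (h3 x)⟩
  · rintro ⟨w, p, q, h⟩
    exact ⟨w, h.ae_eq, memSobolev_two_two_iff.2 ⟨p, q, h.isH2⟩,
      fun x => (h.isH2.magneticKirchhoff_iff x).2 (h.kirchhoff x)⟩

theorem IsDomainRep.add (hG : G.Connected) (hfin : G.LocallyFinite) {M : E → ℝ → ℝ} {u v : G.L2}
    {w p q w' p' q' : E → ℝ → ℂ} (hu : G.IsDomainRep M u w p q)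
    (hv : G.IsDomainRep M v w' p' q') :
    G.IsDomainRep M (u + v) (fun e x => w e x + w' e x) (fun e x => p e x + p' e x)
      (fun e x => q e x + q' e x) := by
  refine ⟨fun e => ?_, hu.isH2.add hv.isH2, fun x => ?_⟩
  · filter_upwards [Lp.coeFn_add (u e) (v e), hu.ae_eq e, hv.ae_eq e] with y h1 h2 h3
    rw [lp.coeFn_add, Pi.add_apply, h1, Pi.add_apply, h2, h3]
  · have h1 := hu.kirchhoff x
    have h2 := hv.kirchhoff x
    -- A `finsum` with infinite support is zero by convention and need not be additive, so the
    -- finiteness of the set of ends at `x` matters.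
    have hfe := finite_ends_at hG hfin x
    change ∑ᶠ (h : G.EdgeEnd) (_ : h ∈ {h : G.EdgeEnd | h.vertex = x}), _ = _ at h1 h2
    change ∑ᶠ (h : G.EdgeEnd) (_ : h ∈ {h : G.EdgeEnd | h.vertex = x}), _ = _
    rw [finsum_mem_eq_finite_toFinset_sum _ hfe] at h1 h2 ⊢
    rw [← add_zero (0 : ℂ), ← congrArg₂ (· + ·) h1 h2, ← Finset.sum_add_distrib]
    refine Finset.sum_congr rfl fun h _ => ?_
    simp only [mag]
    ring

theorem IsDomainRep.const_smul (hG : G.Connected) (hfin : G.LocallyFinite) {M : E → ℝ → ℝ}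
    {u : G.L2} {w p q : E → ℝ → ℂ} (hu : G.IsDomainRep M u w p q) (c : ℂ) :
    G.IsDomainRep M (c • u) (fun e x => c * w e x) (fun e x => c * p e x)
      (fun e x => c * q e x) := by
  refine ⟨fun e => ?_, hu.isH2.const_mul c, fun x => ?_⟩
  · filter_upwards [Lp.coeFn_smul c (u e), hu.ae_eq e] with y h1 h2
    rw [lp.coeFn_smul, Pi.smul_apply, h1, Pi.smul_apply, h2, smul_eq_mul]
  · have h1 := hu.kirchhoff x
    change ∑ᶠ (h : G.EdgeEnd) (_ : h ∈ {h : G.EdgeEnd | h.vertex = x}), _ = _ at h1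
    change ∑ᶠ (h : G.EdgeEnd) (_ : h ∈ {h : G.EdgeEnd | h.vertex = x}), _ = _
    rw [finsum_mem_eq_finite_toFinset_sum _ (finite_ends_at hG hfin x)] at h1 ⊢
    rw [← mul_zero c, ← h1, Finset.mul_sum]
    refine Finset.sum_congr rfl fun h _ => ?_
    simp only [mag]
    ring

theorem isDomainRep_zero {M : E → ℝ → ℝ} :
    G.IsDomainRep M 0 (fun _ _ => 0) (fun _ _ => 0) (fun _ _ => 0) := by
  refine ⟨fun e => Lp.coeFn_zero _ _ _, ⟨isH1_zero, isH1_zero.isPrimitiveOn,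
    MeasureTheory.MemLp.zero⟩, fun x => ?_⟩
  simp [mag]

/-- The expression `(i d/dx + M)² u + V u`. -/
noncomputable def schrodingerExpr (G : MetricGraph X E) (M V : E → ℝ → ℝ) (u : E → ℝ → ℂ) (e : E)
    (x : ℝ) : ℂ :=
  magDeriv (G.interval e) (M e) (magDeriv (G.interval e) (M e) (u e)) x + V e x * u e x

/-- The operator in terms of the derivatives of a representative. -/
def schrodingerRep (M M' V : E → ℝ → ℝ) (w p q : E → ℝ → ℂ) (e : E) (x : ℝ) : ℂ :=
  Complex.I * magD M M' w p q e x + M e x * mag M w p e x + V e x * w e x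

theorem IsH1.magDeriv_ae_eq {M : E → ℝ → ℝ} {u w p : E → ℝ → ℂ} (hw : G.IsH1 w p) {e : E}
    (h : u e =ᵐ[G.edgeMeasure e] w e) :
    magDeriv (G.interval e) (M e) (u e) =ᵐ[G.edgeMeasure e] mag M w p e :=
  ((hw.isPrimitiveOn e).hasWeakDeriv (G.ordConnected_interval e)).magDeriv_ae_eq
    (G.ordConnected_interval e) h

theorem IsH1.weaklyDifferentiable {u w p : E → ℝ → ℂ} (hw : G.IsH1 w p) {e : E}
    (h : u e =ᵐ[G.edgeMeasure e] w e) : WeaklyDifferentiable (G.interval e) (u e) :=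
  ⟨p e, ((hw.isPrimitiveOn e).hasWeakDeriv (G.ordConnected_interval e)).congr_ae h.symm
    (EventuallyEq.refl _ _)⟩

/-- `weakDeriv` is a classical choice and is known only up to null sets. This replaces it by the
explicit derivatives of a representative. -/
theorem IsPotential.schrodingerExpr_ae_eq {M M' V : E → ℝ → ℝ} (hP : G.IsPotential M M' V)
    {u w p q : E → ℝ → ℂ} (hw : G.IsH2 w p q) {e : E} (h : u e =ᵐ[G.edgeMeasure e] w e) :
    WeaklyDifferentiable (G.interval e) (magDeriv (G.interval e) (M e) (u e)) ∧
    G.schrodingerExpr M V u e =ᵐ[G.edgeMeasure e] schrodingerRep M M' V w p q e := by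
  have h1 := hw.isH1.magDeriv_ae_eq (M := M) h
  have h2 := (hP.isPrimitiveOn_mag hw e).hasWeakDeriv (G.ordConnected_interval e)
  refine ⟨⟨_, h2.congr_ae h1.symm (EventuallyEq.refl _ _)⟩, ?_⟩
  filter_upwards [h2.magDeriv_ae_eq (m := M e) (G.ordConnected_interval e) h1, h] with x h3 h4
  rw [schrodingerExpr, h3, h4, schrodingerRep]

theorem IsPotential.memLp_schrodingerRep [Countable E] (hG : G.Connected) {M M' V : E → ℝ → ℝ}
    (hP : G.IsPotential M M' V) {w p q : E → ℝ → ℂ} (hw : G.IsH2 w p q) :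
    MeasureTheory.MemLp (unc (schrodingerRep M M' V w p q)) 2 G.graphMeasure :=
  (((hP.memLp_magD hG hw).const_mul _).add (hP.memLp_mul (hP.memLp_mag hw.isH1))).add
    (hP.isElectricPotential.memLp_mul hG hw.isH1)

theorem L2_ext {u v : G.L2} (h : ∀ e, u e =ᵐ[G.edgeMeasure e] v e) : u = v :=
  lp.ext (funext fun e => Lp.ext (h e))

/-- Linearity is read off from `schrodingerRep`, which is linear in a representative together with
its two derivatives; the chosen weak derivatives respect sums only almost everywhere. -/
theorem IsPotential.exists_operator [Countable E] (hG : G.Connected) (hfin : G.LocallyFinite)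
    {M M' V : E → ℝ → ℝ} (hP : G.IsPotential M M' V) :
    ∃ A : G.L2 →ₗ.[ℂ] G.L2, G.IsMagneticSchrodinger M V A := by
  have hex : ∀ u : G.L2, ∃ a : G.L2, G.MemDomain M u → ∀ e, a e =ᵐ[G.edgeMeasure e]
      G.schrodingerExpr M V (fun e => u e) e := by
    intro u
    by_cases h : G.MemDomain M u
    · obtain ⟨w, p, q, hw⟩ := memDomain_iff.1 h
      obtain ⟨a, ha⟩ := G.exists_L2 (hP.memLp_schrodingerRep hG hw.isH2)
      exact ⟨a, fun _ e => (ha e).trans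
        (hP.schrodingerExpr_ae_eq (u := fun e => u e) hw.isH2 (hw.ae_eq e)).2.symm⟩
    · exact ⟨0, fun h' => absurd h' h⟩
  choose a ha using hex
  have hrep : ∀ {u : G.L2} {w p q : E → ℝ → ℂ}, G.IsDomainRep M u w p q → ∀ e,
      a u e =ᵐ[G.edgeMeasure e] schrodingerRep M M' V w p q e := fun {u w p q} hw e =>
    (ha u (memDomain_iff.2 ⟨w, p, q, hw⟩) e).trans
      (hP.schrodingerExpr_ae_eq (u := fun e => u e) hw.isH2 (hw.ae_eq e)).2
  let D : Submodule ℂ G.L2 :=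
    { carrier := {u | G.MemDomain M u}
      zero_mem' := memDomain_iff.2 ⟨_, _, _, isDomainRep_zero⟩
      add_mem' := by
        intro u v hu hv
        obtain ⟨w, p, q, hw⟩ := memDomain_iff.1 hu
        obtain ⟨w', p', q', hw'⟩ := memDomain_iff.1 hv
        exact memDomain_iff.2 ⟨_, _, _, hw.add hG hfin hw'⟩
      smul_mem' := by
        intro c u hu
        obtain ⟨w, p, q, hw⟩ := memDomain_iff.1 hu
        exact memDomain_iff.2 ⟨_, _, _, hw.const_smul hG hfin c⟩ }
  let A : G.L2 →ₗ.[ℂ] G.L2 :=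
    { domain := D
      toFun :=
        { toFun := fun u => a u
          map_add' := by
            rintro ⟨u, hu⟩ ⟨v, hv⟩
            obtain ⟨w, p, q, hw⟩ := memDomain_iff.1 hu
            obtain ⟨w', p', q', hw'⟩ := memDomain_iff.1 hv
            refine L2_ext fun e => ?_
            filter_upwards [hrep (hw.add hG hfin hw') e, hrep hw e, hrep hw' e,
              Lp.coeFn_add (a u e) (a v e)] with x h1 h2 h3 h4
            rw [lp.coeFn_add, Pi.add_apply, h4, Pi.add_apply, h2, h3]
            refine h1.trans ?_
            simp only [schrodingerRep, mag, magD]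
            ring
          map_smul' := by
            rintro c ⟨u, hu⟩
            obtain ⟨w, p, q, hw⟩ := memDomain_iff.1 hu
            refine L2_ext fun e => ?_
            filter_upwards [hrep (hw.const_smul hG hfin c) e, hrep hw e, Lp.coeFn_smul c (a u e)]
              with x h1 h2 h3
            rw [RingHom.id_apply, lp.coeFn_smul, Pi.smul_apply, h3, Pi.smul_apply, h2]
            refine h1.trans ?_
            simp only [schrodingerRep, mag, magD, smul_eq_mul]
            ring } }
  refine ⟨A, fun u => Iff.rfl, fun u e => ?_⟩
  obtain ⟨w, p, q, hw⟩ := memDomain_iff.1 (show G.MemDomain M u from u.2)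
  exact ⟨hw.isH2.isH1.weaklyDifferentiable (u := fun e => (u : G.L2) e) (hw.ae_eq e),
    (hP.schrodingerExpr_ae_eq (u := fun e => (u : G.L2) e) hw.isH2 (hw.ae_eq e)).1, ha u u.2 e⟩

theorem IsMagneticSchrodinger.ae_eq {M V : E → ℝ → ℝ} {A : G.L2 →ₗ.[ℂ] G.L2}
    (hA : G.IsMagneticSchrodinger M V A) (u : A.domain) (e : E) :
    A u e =ᵐ[G.edgeMeasure e] G.schrodingerExpr M V (fun e => (u : G.L2) e) e :=
  (hA.2 u e).2.2

theorem IsMagneticSchrodinger.unique {M V : E → ℝ → ℝ} {A B : G.L2 →ₗ.[ℂ] G.L2}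
    (hA : G.IsMagneticSchrodinger M V A) (hB : G.IsMagneticSchrodinger M V B) : A = B := by
  refine LinearPMap.ext (Submodule.ext fun u => (hA.1 u).trans (hB.1 u).symm) ?_
  intro u hu hu'
  refine L2_ext fun e => ?_
  exact (hA.ae_eq ⟨u, hu⟩ e).trans (hB.ae_eq ⟨u, hu'⟩ e).symm

/-! ### The form -/

theorem formIntegrand_ae_eq [Countable E] {M V : E → ℝ → ℝ} {u v w p w' p' : E → ℝ → ℂ}
    (hw : G.IsH1 w p) (hw' : G.IsH1 w' p') (hu : ∀ e, u e =ᵐ[G.edgeMeasure e] w e)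
    (hv : ∀ e, v e =ᵐ[G.edgeMeasure e] w' e) :
    unc (G.formIntegrand M V u v) =ᵐ[G.graphMeasure] fun q =>
      conj (unc (mag M w p) q) * unc (mag M w' p') q +
        (V q.1 q.2 : ℂ) * conj (unc w q) * unc w' q := by
  refine G.ae_graphMeasure_iff.2 fun e => ?_
  filter_upwards [hw.magDeriv_ae_eq (M := M) (hu e), hw'.magDeriv_ae_eq (M := M) (hv e), hu e, hv e]
    with x h1 h2 h3 h4
  simp only [unc, formIntegrand, h1, h2, h3, h4]

theorem IsPotential.integrable_formIntegrand [Countable E] (hG : G.Connected) {M M' V : E → ℝ → ℝ}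
    (hP : G.IsPotential M M' V) {u v w p w' p' : E → ℝ → ℂ}
    (hw : G.IsH1 w p) (hw' : G.IsH1 w' p') (hu : ∀ e, u e =ᵐ[G.edgeMeasure e] w e)
    (hv : ∀ e, v e =ᵐ[G.edgeMeasure e] w' e) :
    Integrable (unc (G.formIntegrand M V u v)) G.graphMeasure :=
  (hP.integrable_form hG hw hw' (hP.memLp_mag hw)).congr (formIntegrand_ae_eq hw hw' hu hv).symm

theorem IsPotential.form_eq [Countable E] (hG : G.Connected) {M M' V : E → ℝ → ℝ}
    (hP : G.IsPotential M M' V) {u v w p w' p' : E → ℝ → ℂ}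
    (hw : G.IsH1 w p) (hw' : G.IsH1 w' p') (hu : ∀ e, u e =ᵐ[G.edgeMeasure e] w e)
    (hv : ∀ e, v e =ᵐ[G.edgeMeasure e] w' e) :
    G.form M V u v = ∫ q, conj (unc (mag M w p) q) * unc (mag M w' p') q +
        (V q.1 q.2 : ℂ) * conj (unc w q) * unc w' q ∂G.graphMeasure := by
  rw [← integral_congr_ae (formIntegrand_ae_eq hw hw' hu hv),
    G.integral_graphMeasure (hP.integrable_formIntegrand hG hw hw' hu hv)]
  rfl

/-- This is Green's formula for the magnetic derivative of `u`; the Kirchhoff condition is used for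
`u` only, while of `v` it matters only that it is in `H¹`. -/
theorem IsPotential.inner_eq_form [Countable E] (hG : G.Connected) (hfin : G.LocallyFinite)
    {M M' V : E → ℝ → ℝ} (hP : G.IsPotential M M' V) {A : G.L2 →ₗ.[ℂ] G.L2}
    (hA : G.IsMagneticSchrodinger M V A) (u v : A.domain) :
    ⟪A u, (v : G.L2)⟫_ℂ = G.form M V (fun e => (u : G.L2) e) (fun e => (v : G.L2) e) := by
  obtain ⟨w, p, q, hw⟩ := memDomain_iff.1 ((hA.1 u).1 u.2)
  obtain ⟨w', p', q', hw'⟩ := memDomain_iff.1 ((hA.1 v).1 v.2)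
  have hae : ∀ᵐ y ∂G.graphMeasure, A u y.1 y.2 = schrodingerRep M M' V w p q y.1 y.2 :=
    (G.ae_graphMeasure_iff (p := fun y => A u y.1 y.2 = schrodingerRep M M' V w p q y.1 y.2)).2
      fun e => (hA.ae_eq u e).trans
        (hP.schrodingerExpr_ae_eq (u := fun e => (u : G.L2) e) hw.isH2 (hw.ae_eq e)).2
  have hae' : ∀ᵐ y ∂G.graphMeasure, (v : G.L2) y.1 y.2 = w' y.1 y.2 :=
    (G.ae_graphMeasure_iff (p := fun y => (v : G.L2) y.1 y.2 = w' y.1 y.2)).2 hw'.ae_eq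
  rw [hP.form_eq hG hw.isH2.isH1 hw'.isH2.isH1 hw.ae_eq hw'.ae_eq,
    hP.form_eq_of_kirchhoff hG hfin hw.isH2 hw.kirchhoff hw'.isH2.isH1
      (f := fun y => A u y.1 y.2) hae, G.inner_L2]
  refine integral_congr_ae ?_
  filter_upwards [hae'] with y hy
  rw [hy]

theorem IsPotential.form_conj_symm [Countable E] (hG : G.Connected) {M M' V : E → ℝ → ℝ}
    (hP : G.IsPotential M M' V) {u v w p w' p' : E → ℝ → ℂ}
    (hw : G.IsH1 w p) (hw' : G.IsH1 w' p') (hu : ∀ e, u e =ᵐ[G.edgeMeasure e] w e)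
    (hv : ∀ e, v e =ᵐ[G.edgeMeasure e] w' e) : conj (G.form M V v u) = G.form M V u v := by
  rw [hP.form_eq hG hw hw' hu hv, hP.form_eq hG hw' hw hv hu, ← integral_conj]
  refine integral_congr_ae (Eventually.of_forall fun y => ?_)
  simp only [map_add, map_mul, Complex.conj_conj, Complex.conj_ofReal]
  ring

/-- A weak solution `u` of `A u = f - l u` exists by coercivity, and regularity places it in the
domain of `A`. -/
theorem IsPotential.exists_add_smul_eq [Countable E] (hG : G.Connected) (hfin : G.LocallyFinite)
    {M M' V : E → ℝ → ℝ} (hP : G.IsPotential M M' V) {A : G.L2 →ₗ.[ℂ] G.L2}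
    (hA : G.IsMagneticSchrodinger M V A) :
    ∃ l : ℝ, ∀ f : G.L2, ∃ u : A.domain, A u + (l : ℂ) • (u : G.L2) = f := by
  obtain ⟨l, hl⟩ := hP.exists_weak_solution hG
  refine ⟨l, fun f => ?_⟩
  have hf := G.memLp_L2 f
  obtain ⟨w, p₀, hw, hweak⟩ := hl _ hf
  obtain ⟨p, q, hH2, hK, hae⟩ := hP.exists_isH2 hG hfin hw
    (hf.sub (hw.memLp.const_mul (l : ℂ))) hweak
  obtain ⟨u, hu⟩ := G.exists_L2 hw.memLp
  have hrep : G.IsDomainRep M u w p q := ⟨hu, hH2, hK⟩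
  have hdom : u ∈ A.domain := (hA.1 u).2 (memDomain_iff.2 ⟨w, p, q, hrep⟩)
  refine ⟨⟨u, hdom⟩, L2_ext fun e => ?_⟩
  filter_upwards [(hA.ae_eq ⟨u, hdom⟩ e).trans
      (hP.schrodingerExpr_ae_eq (u := fun e => u e) hH2 (hu e)).2, hu e,
    Lp.coeFn_add (A ⟨u, hdom⟩ e) (((l : ℂ) • u : G.L2) e), Lp.coeFn_smul (l : ℂ) (u e),
    G.ae_graphMeasure_iff.1 hae e] with x h1 h2 h3 h4 h5
  rw [lp.coeFn_add, Pi.add_apply, h3, Pi.add_apply, lp.coeFn_smul, Pi.smul_apply, h4,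
    Pi.smul_apply, h1, h2, smul_eq_mul]
  refine eq_sub_iff_add_eq.1 ?_
  exact h5.symm

end MetricGraph

/-! ### Main theorem -/

theorem mainTheorem12 {X : Type*} {E : Type*} (G : MetricGraph X E)
    (hconn : G.Connected) (hfin : G.LocallyFinite) (M V : E → ℝ → ℝ)
    (hM : G.IsMagneticPotential M) (hV : G.IsElectricPotential V) :
    (∀ u v : E → ℝ → ℂ, G.MemSobolev 1 2 u → G.MemSobolev 1 2 v →
      G.IntegrableOnGraph (G.formIntegrand M V u v)) ∧
    (∃! A : G.L2 →ₗ.[ℂ] G.L2, G.IsMagneticSchrodinger M V A) ∧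
    ∀ A : G.L2 →ₗ.[ℂ] G.L2, G.IsMagneticSchrodinger M V A →
      Dense (A.domain : Set G.L2) ∧ IsSelfAdjoint A ∧
      ∀ u v : A.domain, ⟪A u, (v : G.L2)⟫_ℂ =
        G.form M V (fun e => (u : G.L2) e) (fun e => (v : G.L2) e) := by
  have : Countable E := hfin.1
  obtain ⟨M', h1, h2, h3⟩ := hM.exists_isPrimitiveOn hconn
  have hP : G.IsPotential M M' V := ⟨h1, h3, h2, hV⟩
  refine ⟨fun u v hu hv => ?_, ?_, fun A hA => ?_⟩
  · obtain ⟨p, hp⟩ := MetricGraph.memSobolev_one_two_iff.1 hu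
    obtain ⟨r, hr⟩ := MetricGraph.memSobolev_one_two_iff.1 hv
    exact G.integrable_graphMeasure_iff.1 (hP.integrable_formIntegrand hconn hp hr
      (fun e => EventuallyEq.refl _ _) fun e => EventuallyEq.refl _ _)
  · obtain ⟨A, hA⟩ := hP.exists_operator hconn hfin
    exact ⟨A, hA, fun B hB => hB.unique hA⟩
  · have hform := hP.inner_eq_form hconn hfin hA
    have hsym : ∀ u v : A.domain, ⟪A u, (v : G.L2)⟫_ℂ = ⟪(u : G.L2), A v⟫_ℂ := by
      intro u v
      obtain ⟨w, p, q, hw⟩ := MetricGraph.memDomain_iff.1 ((hA.1 u).1 u.2)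
      obtain ⟨w', p', q', hw'⟩ := MetricGraph.memDomain_iff.1 ((hA.1 v).1 v.2)
      rw [hform, ← inner_conj_symm, hform]
      exact (hP.form_conj_symm hconn hw.isH2.isH1 hw'.isH2.isH1 hw.ae_eq hw'.ae_eq).symm
    obtain ⟨l, hl⟩ := hP.exists_add_smul_eq hconn hfin hA
    obtain ⟨h4, h5⟩ := A.dense_and_isSelfAdjoint_of_surjective hsym l hl
    exact ⟨h4, h5, hform⟩
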